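/- **Setting.** Let $(\Omega,P)$ be a probability space with a measurable, measure-preserving, ergodic action $\tau_x$ of $\mathbb R^d$ such that the unitary group $(T_xf)(\omega)=f(\tau_{-x}\omega)$ is strongly continuous on $L^2(\Omega,P;\mathbb C)$. Write $\langle\cdot\rangle$ for the mean, $\mathscr H=L^2(\Omega,P;\mathbb C)^d$, $\boldsymbol e_j$ for the standard basis vectors, and let $x\cdot y$ conjugate its second factor. Let $L_i$ be the $L^2$-generator of translations in direction $i$, $D_1=\bigcap_i\mathrm{dom}(L_i)$, $D_2=\{f\in D_1:L_jf\in D_1\ \forall j\}$, and let $\mathscr H^1,\mathscr H^2$ be the spaces of mean-zero vector fields with components in $D_1$, $D_2$. Put $\nabla=(L_1,\dots,L_d)$, $\nabla^*\zeta=-\sum_iL_i\zeta_i$; for $d=2,3$ let $\nabla\times$ be the usual curl built from the $L_i$ (for $d=2$, $\nabla\times\xi=L_1\xi_2-L_2\xi_1$). A field in $\mathscr H$ is called curl-free or divergence-free if it is so weakly (tested against $D_1$). Let $\mathscr H_\times$, $\mathscr H_\bullet$ be the mean-zero curl-free, respectively divergence-free, fields. A two-component medium is given by a measurable partition of $\Omega$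 into two sets with characteristic functions $\chi_1,\chi_2$, acting on $\mathscr H$ by multiplication. For $i\in\{1,2\}$ let $i'$ be the other index. For $a\in\mathbb C^2$ write $a=a_1\chi_1+a_2\chi_2$; call it admissible if $a_1/a_2\notin(-\infty,0]$ ($a_2\neq0$). The conductivity is $\sigma=\sigma_1\chi_1+\sigma_2\chi_2$ and the resistivity is $\rho=\rho_1\chi_1+\rho_2\chi_2$, $\rho_i=1/\sigma_i$. Let $(\mathscr V,\mathscr W)$ be either (curl-free, divergence-free), with $a=\sigma$ and $U=E$, or (divergence-free, curl-free), with $a=\rho$ and $U=J$. The field problem with mean $U_0\in\mathbb C^d$ is: $U\in\mathscr V$, $aU\in\mathscr W$, $\langle U\rangle=U_0$. The effective matrix $a^*$ has as $j$-th column $\langle aU\rangle$, where $U$ has mean $\boldsymbol e_j$, and $a^*_{jk}=a^*\boldsymbol e_j\cdot\boldsymbol e_k$. **Theorem.** 1. $\chi_i^*=\chi_i$, $\chi_i\chi_j=\delta_{ij}\chi_i$, $\chi_1+\chi_2=1$, and $\sigma\rho=1$. 2. For both choices of $(\mathscr V,\mathscr W)$ and every admissible $a$: there is $\kappa>0$ with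 $|\langle a\xi\cdot\xi\rangle|\ge\kappa\|\xi\|^2$ for all mean-zero $\xi\in\mathscr V$; the field problem has a unique solution for every $U_0$, and $a^*U_0=\langle aU\rangle$. For $i=1,2$ and a fixed $a_{i'}\ne0$, each $a^*_{jk}$ is an analytic function of $h=a_i/a_{i'}\in\mathbb C\setminus(-\infty,0]$. 3. There is a bounded operator $\Gamma$ on $\mathscr H$ whose graph is the closure of the graph of $\nabla(\nabla^*\nabla)^{-1}\nabla^*$ (with $(\nabla^*\nabla)^{-1}$ valued in the mean-zero elements of $D_2$). It is the orthogonal projection onto $\mathscr H_\times$, which is the closure of $\nabla\{f\in D_1:\langle f\rangle=0\}$; it maps $D_1^d$ into $\mathscr H^1$; and it is essentially self-adjoint on $\mathscr H^1$. If $d=2$ or $3$, there is likewise $\Upsilon$, whose graph is the closure of the graph of $(\nabla\times)^*\big(\nabla\times(\nabla\times)^*\big)^{-1}\nabla\times$ (the inverse being valued in the mean-zero fields with components in $D_2$ that are orthogonal to the kernel of $(\nabla\times)^*$; for $d=3$ this is $\nabla\times(\nabla\times\nabla\times)^{-1}\nabla\times$). It is the orthogonal projection onto $\mathscr H_\bullet$,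 the closure of the image under $(\nabla\times)^*$ of the mean-zero fields with components in $D_1$; it maps $D_1^d$ into $\mathscr H^1$; and it is essentially self-adjoint on $\mathscr H^1$. 4. Let $\Lambda=\Gamma$ with $(\mathscr V,\mathscr W)=$ (curl-free, divergence-free), or, for $d=2,3$, $\Lambda=\Upsilon$ with $(\mathscr V,\mathscr W)=$ (divergence-free, curl-free). For $i=1,2$: - $\chi_i\Lambda\chi_i$ is bounded, self-adjoint and positive on $\mathscr H$, with norm at most $1$ and spectrum in $[0,1]$, and it is essentially self-adjoint on $D_1^d$ and on $D_2^d$. - If $\chi_1,\chi_2$ map $\mathscr H^1$ into $\mathscr H^1$, then $\chi_i\Lambda\chi_i$ maps $\mathscr H^1$ into $\mathscr H^1$ and is essentially self-adjoint (in the $L^2$ completions) with domain $\mathscr H^1$ and with domain $\mathscr H^2$. - If $a$ is admissible and $a_1\ne a_2$, then $r_i=1/(1-a_i/a_{i'})$ is in the resolvent set of $\chi_i\Lambda\chi_i$ and $\chi_iU=r_i(r_i-\chi_i\Lambda\chi_i)^{-1}\chi_iU_0$. (With $h=\sigma_1/\sigma_2$, $s=1/(1-h)$, $t=1-s$: $r_1=s$,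 $r_2=t$ for $a=\sigma$, and $r_1=t$, $r_2=s$ for $a=\rho$.) - $\chi_i\Lambda\chi_i$ has a unique right-continuous resolution of the identity $Q(\lambda)$, with $Q(\lambda)=0$ for $\lambda<0$ and $Q(\lambda)=I$ for $\lambda\ge1$; $Q(\lambda)$ commutes with $\chi_i$. There are finite signed measures $\mu_{jk}$ with $\mu_{jk}((-\infty,\lambda])=\langle Q(\lambda)\chi_i\boldsymbol e_j\cdot\boldsymbol e_k\rangle$; the $\mu_{kk}$ are positive; and $$\langle(s-\chi_i\Lambda\chi_i)^{-1}\chi_i\boldsymbol e_j\cdot\boldsymbol e_k\rangle=\int_{[0,1]}\frac{d\mu_{jk}(\lambda)}{s-\lambda}\quad(s\in\mathbb C\setminus[0,1]),\qquad \frac{a^*_{jk}}{a_{i'}}=\delta_{jk}-\int_{[0,1]}\frac{d\mu_{jk}(\lambda)}{r_i-\lambda}$$ for admissible $a$ with $a_1\neq a_2$. 5. Call a *potential* a family $\varphi(x)\in L^2(\Omega,P)$, $x\in\mathbb R^d$, with $\varphi(x+y)=\varphi(x)+T_x\varphi(y)$ whose derivatives $(\nabla\varphi)_i=\frac{d}{dt}\varphi(t\boldsymbol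 e_i)|_{t=0}$ exist in $L^2$; examples are $T_xf-f$ for $f\in D_1$ and $\varphi_0=E_0\cdot x$. Let $\mathscr P_0$ be the potentials with mean-zero gradient, and put $(f,g)_i=\langle\chi_i\nabla f\cdot\nabla g\rangle$. For each $i$ there is a linear map $M=(\nabla^*\nabla)^{-1}\nabla^*\chi_i\nabla$ on potentials: $Mf$ is the unique weak solution $g\in\mathscr P_0$ of $\nabla^*\nabla g=\nabla^*\chi_i\nabla f$. Moreover: - $\nabla M^nf=[\Gamma\chi_i]^n\nabla f$ for all $n\ge0$; $(Mf,g)_i=(f,Mg)_i$, $(Mf,f)_i\ge0$, $(Mf,Mf)_i\le(f,f)_i$. - $\nabla$ is a bijection of $\mathscr P_0$ onto $\mathscr H_\times$ (hence isometric for $\|\nabla f\|$), and of $\{f\in\mathscr P_0:\chi_i\nabla f\ne0\}$ onto $\{\xi\in\mathscr H_\times:\chi_i\xi\ne0\}$. Also $\chi_i\Gamma\chi_i\nabla f=\chi_i\nabla Mf$, $\|\chi_i\Gamma\chi_i\nabla f\|^2=(Mf,Mf)_i$, and $g\mapsto\chi_i\nabla g$ is a bijection between the images of these two sets under $M$ and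 under $\chi_i\Gamma\chi_i$. - For admissible $\sigma$ with $\sigma_1\neq\sigma_2$ and $r_i=1/(1-\sigma_i/\sigma_{i'})$, $r_i-M$ is invertible and $E=E_0+\nabla\varphi$ with $\varphi\in\mathscr P_0$, $\varphi=(r_i-M)^{-1}M\varphi_0$, $\varphi_0=E_0\cdot x$. - Let $K$ be the Hilbert space completion with respect to $(\cdot,\cdot)_i$ of any space of potentials containing $\mathscr P_0$ (potentials with $\chi_i\nabla f=0$ being identified with $0$). Then $M$ extends to a positive self-adjoint bounded operator on $K$ with norm at most $1$ and spectrum in $[0,1]$, with a unique resolution of the identity $\tilde Q$, and, with $Q$ the resolution of the identity of $\chi_i\Gamma\chi_i$, $\chi_i\nabla\tilde Q(\lambda)=\chi_iQ(\lambda)\nabla$, where $\chi_i\nabla$ denotes the isometric extension to $K$. If $\varphi_0=\boldsymbol e_j\cdot x$ belongs to the space, there is a finite positive measure $\nu_{jj}$ with $\nu_{jj}((-\infty,\lambda])=(\tilde Q(\lambda)\varphi_0,\varphi_0)_i$; it equals the measure $\mu_{jj}$ of item 4 (for $\Lambda=\Gamma$), and $\sigma^*_{jj}/\sigma_{i'}=1-\int_{[0,1]}\frac{d\nu_{jj}(\lambda)}{r_i-\lambda}$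 for admissible $\sigma$ with $\sigma_1\ne\sigma_2$. -/

import Mathlib

open MeasureTheory Filter Topology
open scoped ENNReal InnerProductSpace

noncomputable section

set_option linter.unusedSectionVars false

namespace TwoComponent

universe u

/-! ### Random fields -/

/-- The Hilbert space `L²(Ω, P)` of complex scalar random fields. -/
abbrev ScalarField {Ω : Type u} [MeasurableSpace Ω] (P : Measure Ω) : Type u := Lp ℂ 2 P

/-- The Hilbert space of random fields with `m` components in `L²(Ω, P)`, with inner product
`∑ k, ⟪ξ k, ζ k⟫` (conjugate linear in the first slot, Mathlib's convention). -/
abbrev VField {Ω : Type u} [MeasurableSpace Ω] (P : Measure Ω) (m : ℕ) : Type u :=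
  PiLp 2 (fun _ : Fin m => ScalarField P)

section Fields

variable {Ω : Type u} [MeasurableSpace Ω] (P : Measure Ω) [IsProbabilityMeasure P]

/-- The ensemble average of a scalar field. -/
def mean : ScalarField P →ₗ[ℂ] ℂ where
  toFun f := ∫ ω, f ω ∂P
  map_add' f g := by
    rw [← integral_add ((Lp.memLp f).integrable one_le_two) ((Lp.memLp g).integrable one_le_two)]
    exact integral_congr_ae (Lp.coeFn_add f g)
  map_smul' a f := by
    rw [RingHom.id_apply, ← integral_smul]
    exact integral_congr_ae (Lp.coeFn_smul a f)

/-- The ensemble average of a vector field. -/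
def meanV {m : ℕ} (U : VField P m) : Fin m → ℂ := fun k => mean P (U k)

/-- The constant vector field. -/
def constV {m : ℕ} (a : Fin m → ℂ) : VField P m :=
  WithLp.toLp 2 (fun k => Lp.const 2 P (a k))

variable {P}

/-- Vector fields all of whose components lie in a given space of scalar fields. -/
def vec (S : Submodule ℂ (ScalarField P)) (m : ℕ) : Submodule ℂ (VField P m) where
  carrier := {ξ | ∀ k, ξ k ∈ S}
  add_mem' h h' k := S.add_mem (h k) (h' k)
  zero_mem' _ := S.zero_mem
  smul_mem' a _ h k := S.smul_mem a (h k)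

/-- Multiplication of a scalar field by the indicator function of a measurable set. -/
def indicatorFun {S : Set Ω} (hS : MeasurableSet S) (f : ScalarField P) : ScalarField P :=
  ((Lp.memLp f).indicator hS).toLp (S.indicator f)

theorem coeFn_indicatorFun {S : Set Ω} (hS : MeasurableSet S) (f : ScalarField P) :
    (indicatorFun hS f : Ω → ℂ) =ᵐ[P] S.indicator f := by
  rw [indicatorFun]
  exact MemLp.coeFn_toLp _

theorem indicatorFun_add {S : Set Ω} (hS : MeasurableSet S) (f g : ScalarField P) :
    indicatorFun hS (f + g) = indicatorFun hS f + indicatorFun hS g := by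
  refine Lp.ext ?_
  filter_upwards [coeFn_indicatorFun hS (f + g), coeFn_indicatorFun hS f, coeFn_indicatorFun hS g,
    Lp.coeFn_add f g, Lp.coeFn_add (indicatorFun hS f) (indicatorFun hS g)] with ω h1 h2 h3 h4 h5
  rw [h1, h5, Pi.add_apply, h2, h3]
  by_cases hω : ω ∈ S
  · rw [Set.indicator_of_mem hω, Set.indicator_of_mem hω, Set.indicator_of_mem hω, h4, Pi.add_apply]
  · rw [Set.indicator_of_notMem hω, Set.indicator_of_notMem hω, Set.indicator_of_notMem hω,
      add_zero]

theorem indicatorFun_smul {S : Set Ω} (hS : MeasurableSet S) (a : ℂ) (f : ScalarField P) :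
    indicatorFun hS (a • f) = a • indicatorFun hS f := by
  refine Lp.ext ?_
  filter_upwards [coeFn_indicatorFun hS (a • f), coeFn_indicatorFun hS f,
    Lp.coeFn_smul a f, Lp.coeFn_smul a (indicatorFun hS f)] with ω h1 h2 h4 h5
  rw [h1, h5, Pi.smul_apply, h2]
  by_cases hω : ω ∈ S
  · rw [Set.indicator_of_mem hω, Set.indicator_of_mem hω, h4, Pi.smul_apply]
  · rw [Set.indicator_of_notMem hω, Set.indicator_of_notMem hω, smul_zero]

/-- Multiplication by the indicator function of a measurable set, as a linear map. -/
def indicatorLin {S : Set Ω} (hS : MeasurableSet S) : ScalarField P →ₗ[ℂ] ScalarField P where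
  toFun f := indicatorFun hS f
  map_add' f g := indicatorFun_add hS f g
  map_smul' a f := indicatorFun_smul hS a f

theorem norm_indicatorLin_le {S : Set Ω} (hS : MeasurableSet S) (f : ScalarField P) :
    ‖indicatorLin hS f‖ ≤ 1 * ‖f‖ := by
  rw [one_mul]
  refine Lp.norm_le_norm_of_ae_le ?_
  filter_upwards [coeFn_indicatorFun hS f] with ω h
  have h' : (indicatorLin hS f : Ω → ℂ) ω = S.indicator f ω := h
  rw [h']
  exact norm_indicator_le_norm_self _ _

/-- Multiplication of scalar fields by the indicator function of a measurable set. -/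
def indicatorOp {S : Set Ω} (hS : MeasurableSet S) : ScalarField P →L[ℂ] ScalarField P :=
  (indicatorLin hS).mkContinuous 1 (norm_indicatorLin_le hS)

/-- The characteristic function `χ i` of material component `i`, acting by multiplication on
vector fields. Here `c ω` is the component present at the origin in the realization `ω`; the
component present at `x` is `c (-x +ᵥ ω)`. -/
def chi {c : Ω → Fin 2} (hc : Measurable c) {m : ℕ} (i : Fin 2) : VField P m →L[ℂ] VField P m :=
  (PiLp.continuousLinearEquiv 2 ℂ (fun _ : Fin m => ScalarField P)).symm.toContinuousLinearMap ∘L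
    (ContinuousLinearMap.pi fun k =>
      (indicatorOp (P := P) (hc (measurableSet_singleton i))) ∘L ContinuousLinearMap.proj k) ∘L
    (PiLp.continuousLinearEquiv 2 ℂ (fun _ : Fin m => ScalarField P)).toContinuousLinearMap

/-- Multiplication by the scalar function `a 0 * χ 0 + a 1 * χ 1`
(local conductivity or resistivity of the two-component medium). -/
def medium {c : Ω → Fin 2} (hc : Measurable c) {m : ℕ} (a : Fin 2 → ℂ) :
    VField P m →L[ℂ] VField P m :=
  a 0 • chi hc 0 + a 1 • chi hc 1

end Fields

/-! ### The translation group and the operators `L i` -/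

section Operators

variable {Ω : Type u} [MeasurableSpace Ω] (P : Measure Ω) [IsProbabilityMeasure P]
variable (d : ℕ) [AddAction (Fin d → ℝ) Ω] [MeasurableConstVAdd (Fin d → ℝ) Ω]
variable [VAddInvariantMeasure (Fin d → ℝ) Ω P]

/-- The unitary group `(T x f)(ω) = f (τ₋ₓ ω)`. -/
def translate (x : Fin d → ℝ) : ScalarField P →ₗᵢ[ℂ] ScalarField P :=
  Lp.compMeasurePreservingₗᵢ ℂ (fun ω => (-x) +ᵥ ω) (measurePreserving_vadd (-x) P)

/-- The generator `L i` of translations in the direction `i`, the derivative being taken in the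
sense of convergence in `L²(Ω, P)` (only used where that derivative exists). -/
def L (i : Fin d) (f : ScalarField P) : ScalarField P :=
  deriv (fun t : ℝ => translate P d (Pi.single i t) f) 0

/-- The intersection of the domains of the generators `L i`. -/
def D1 : Submodule ℂ (ScalarField P) where
  carrier := {f | ∀ i : Fin d, DifferentiableAt ℝ
    (fun t : ℝ => translate P d (Pi.single i t) f) 0}
  add_mem' h h' i := by
    simp only [map_add]
    exact DifferentiableAt.fun_add (h i) (h' i)
  zero_mem' i := by simp
  smul_mem' a f h i := by
    simp only [map_smul]
    exact DifferentiableAt.fun_const_smul (h i) a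

theorem L_add {f g : ScalarField P} (hf : f ∈ D1 P d) (hg : g ∈ D1 P d) (i : Fin d) :
    L P d i (f + g) = L P d i f + L P d i g := by
  simp only [L, map_add]
  exact deriv_add (hf i) (hg i)

theorem L_smul {f : ScalarField P} (hf : f ∈ D1 P d) (a : ℂ) (i : Fin d) :
    L P d i (a • f) = a • L P d i f := by
  simp only [L, map_smul]
  exact deriv_const_smul a (hf i)

/-- The scalar fields `f` for which all `L i f` and `L i (L j f)` exist in `L²(Ω, P)`. -/
def D2 : Submodule ℂ (ScalarField P) where
  carrier := {f | f ∈ D1 P d ∧ ∀ j : Fin d, L P d j f ∈ D1 P d}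
  add_mem' := by
    rintro f g ⟨hf, hf'⟩ ⟨hg, hg'⟩
    refine ⟨Submodule.add_mem _ hf hg, fun j => ?_⟩
    rw [L_add P d hf hg]
    exact Submodule.add_mem _ (hf' j) (hg' j)
  zero_mem' := by
    refine ⟨Submodule.zero_mem _, fun j => ?_⟩
    have h : L P d j (0 : ScalarField P) = 0 := by simp [L]
    rw [h]
    exact Submodule.zero_mem _
  smul_mem' := by
    rintro a f ⟨hf, hf'⟩
    refine ⟨Submodule.smul_mem _ a hf, fun j => ?_⟩
    rw [L_smul P d hf]
    exact Submodule.smul_mem _ a (hf' j)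

/-- The mean-zero part of a space of scalar fields. -/
def meanZero (S : Submodule ℂ (ScalarField P)) : Submodule ℂ (ScalarField P) :=
  S ⊓ LinearMap.ker (mean P)

/-- The space `H¹` of mean-zero vector fields with once differentiable components. -/
def H1 : Submodule ℂ (VField P d) := vec (meanZero P (D1 P d)) d

/-- The space `H²` of mean-zero vector fields with twice differentiable components. -/
def H2 : Submodule ℂ (VField P d) := vec (meanZero P (D2 P d)) d

/-- The generalized gradient `∇ = (L 1, …, L d)`. -/
def grad (f : ScalarField P) : VField P d := WithLp.toLp 2 (fun i => L P d i f)

/-- The adjoint `∇*` of the gradient, the negative divergence. -/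
def gradAdj (ζ : VField P d) : ScalarField P := -∑ i, L P d i (ζ i)

/-- The number of components of the curl of a vector field on `ℝ²` and `ℝ³` (no curl operator is
used in other dimensions). -/
def curlDim : ℕ → ℕ
  | 2 => 1
  | 3 => 3
  | _ => 0

/-- The coefficients `ε k i j` in `(∇×ξ) k = ∑ i j, ε k i j L i (ξ j)`: for `d = 3` the
Levi-Civita symbol, for `d = 2` the curl is `L 1 (ξ 2) - L 2 (ξ 1)`. -/
def curlCoeff : (d : ℕ) → Fin (curlDim d) → Fin d → Fin d → ℂ
  | 2, _, i, j => (j : ℕ) - (i : ℕ)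
  | 3, (k : Fin 3), i, j =>
      ((k : ℕ) - (i : ℕ) : ℂ) * ((i : ℕ) - (j : ℕ) : ℂ) * ((j : ℕ) - (k : ℕ) : ℂ) / 2
  | _, _, _, _ => 0

/-- The generalized curl `∇×`. -/
def curl (ξ : VField P d) : VField P (curlDim d) :=
  WithLp.toLp 2 (fun k => ∑ i, ∑ j, curlCoeff d k i j • L P d i (ξ j))

/-- The adjoint `(∇×)*` of the generalized curl. -/
def curlAdj (η : VField P (curlDim d)) : VField P d :=
  WithLp.toLp 2 (fun j => -∑ k, ∑ i, curlCoeff d k i j • L P d i (η k))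

/-- The graph of `Γ = ∇ (∇*∇)⁻¹ ∇*`, with `∇*` defined on fields with differentiable
components and `(∇*∇)⁻¹` taking values in the mean-zero twice differentiable scalar fields. -/
def gammaGraph : Set (VField P d × VField P d) :=
  {p | p.1 ∈ vec (D1 P d) d ∧ ∃ φ ∈ meanZero P (D2 P d),
    gradAdj P d (grad P d φ) = gradAdj P d p.1 ∧ p.2 = grad P d φ}

/-- The graph of `Υ = (∇×)* (∇× (∇×)*)⁻¹ ∇×` (which for `d = 3` is `∇× (∇× ∇×)⁻¹ ∇×`); the inverse
takes values in the twice differentiable fields that are orthogonal to the kernel of `(∇×)*`. -/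
def upsilonGraph : Set (VField P d × VField P d) :=
  {p | p.1 ∈ vec (D1 P d) d ∧ ∃ A ∈ vec (meanZero P (D2 P d)) (curlDim d),
    (∀ B ∈ vec (D1 P d) (curlDim d), curlAdj P d B = 0 → ⟪B, A⟫_ℂ = 0) ∧
    curl P d (curlAdj P d A) = curl P d p.1 ∧ p.2 = curlAdj P d A}

/-- Weakly curl-free fields: `L i (ξ j) - L j (ξ i) = 0` tested against differentiable fields. -/
def CurlFree : Submodule ℂ (VField P d) where
  carrier := {ξ | ∀ i j : Fin d, ∀ f ∈ D1 P d, ⟪L P d i f, ξ j⟫_ℂ = ⟪L P d j f, ξ i⟫_ℂ}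
  add_mem' h h' i j f hf := by
    simp only [PiLp.add_apply, inner_add_right, h i j f hf, h' i j f hf]
  zero_mem' i j f hf := by simp
  smul_mem' a ξ h i j f hf := by
    simp only [PiLp.smul_apply, inner_smul_right, h i j f hf]

/-- Weakly divergence-free fields: `∑ i, L i (ζ i) = 0` tested against differentiable fields. -/
def DivFree : Submodule ℂ (VField P d) where
  carrier := {ζ | ∀ f ∈ D1 P d, ∑ i, ⟪L P d i f, ζ i⟫_ℂ = 0}
  add_mem' h h' f hf := by
    simp only [PiLp.add_apply, inner_add_right, Finset.sum_add_distrib, h f hf, h' f hf, add_zero]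
  zero_mem' f hf := by simp
  smul_mem' a ζ h f hf := by
    simp only [PiLp.smul_apply, inner_smul_right, ← Finset.mul_sum, h f hf, mul_zero]

/-- The mean-zero part of a space of vector fields; `fluct (CurlFree P d)` is the Hilbert space of
curl-free fluctuating fields, `fluct (DivFree P d)` that of divergence-free ones. -/
def fluct {P : Measure Ω} [IsProbabilityMeasure P] {d : ℕ} (V : Submodule ℂ (VField P d)) :
    Submodule ℂ (VField P d) :=
  V ⊓ vec (LinearMap.ker (mean P)) d

end Operators

/-! In three dimensions the coefficients give the usual curl matrix, and the curl is its own
adjoint; in two dimensions the curl is `[-L 2, L 1]`. -/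

section CurlChecks

variable {Ω : Type u} [MeasurableSpace Ω] (P : Measure Ω) [IsProbabilityMeasure P]

theorem curl_three [AddAction (Fin 3 → ℝ) Ω] [MeasurableConstVAdd (Fin 3 → ℝ) Ω]
    [VAddInvariantMeasure (Fin 3 → ℝ) Ω P] (ξ : VField P 3) :
    curl P 3 ξ = WithLp.toLp 2 ![-L P 3 2 (ξ 1) + L P 3 1 (ξ 2),
      L P 3 2 (ξ 0) - L P 3 0 (ξ 2), -L P 3 1 (ξ 0) + L P 3 0 (ξ 1)] := by
  ext1 k
  simp only [curl, Fin.sum_univ_three]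
  change Fin 3 at k
  fin_cases k <;> simp [curlCoeff] <;> norm_num <;> abel

theorem curlAdj_three [AddAction (Fin 3 → ℝ) Ω] [MeasurableConstVAdd (Fin 3 → ℝ) Ω]
    [VAddInvariantMeasure (Fin 3 → ℝ) Ω P] (ξ : VField P 3) :
    curlAdj P 3 ξ = curl P 3 ξ := by
  rw [curl_three]
  ext1 k
  have h : ∀ F : Fin (curlDim 3) → ScalarField P, ∑ k, F k = F (0 : Fin 3) + F (1 : Fin 3)
    + F (2 : Fin 3) := fun F => Fin.sum_univ_three (M := ScalarField P) F
  simp only [curlAdj, Fin.sum_univ_three, h]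
  fin_cases k <;> simp [curlCoeff] <;> norm_num <;> abel

theorem curl_two [AddAction (Fin 2 → ℝ) Ω] [MeasurableConstVAdd (Fin 2 → ℝ) Ω]
    [VAddInvariantMeasure (Fin 2 → ℝ) Ω P] (ξ : VField P 2) (k : Fin 1) :
    (curl P 2 ξ) k = -L P 2 1 (ξ 0) + L P 2 0 (ξ 1) := by
  simp [curl, curlCoeff, Fin.sum_univ_two]
  abel

end CurlChecks

/-! ### Resolutions of the identity and essential self-adjointness -/

section Spectral

/-- `Q` is the resolution of the identity of the bounded operator `T` with spectrum in `[0, 1]`: an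
increasing, strongly right-continuous family of orthogonal projections with `Q l = 0` for `l < 0`
and `Q l = 1` for `1 ≤ l`, such that `⟨T ψ, ψ⟩ = ∫ l d⟨Q l ψ, ψ⟩` for all `ψ`. -/
structure IsResolutionOfIdentity {K : Type u} [NormedAddCommGroup K] [InnerProductSpace ℂ K]
    [CompleteSpace K] (T : K →L[ℂ] K) (Q : ℝ → K →L[ℂ] K) : Prop where
  proj : ∀ l, IsStarProjection (Q l)
  mono : ∀ l l', l ≤ l' → Q l * Q l' = Q l
  right_continuous : ∀ l ψ, ContinuousWithinAt (fun l' => Q l' ψ) (Set.Ici l) l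
  eq_zero : ∀ l < 0, Q l = 0
  eq_one : ∀ l, 1 ≤ l → Q l = 1
  integral : ∀ ψ, ∃ ν : Measure ℝ, IsFiniteMeasure ν ∧
    (∀ l, (ν.real (Set.Iic l) : ℂ) = ⟪ψ, Q l ψ⟫_ℂ) ∧
    ⟪ψ, T ψ⟫_ℂ = ((∫ l, l ∂ν : ℝ) : ℂ)

/-- The bounded operator `A` with domain `S` is essentially self-adjoint on the Hilbert space
completion (that is, the closure) of `S`: it maps this closure into itself and the closure of `A`,
defined on `S`, is self-adjoint there. -/
def EssSelfAdjointOn {K : Type u} [NormedAddCommGroup K] [InnerProductSpace ℂ K]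
    [CompleteSpace K] (S : Submodule ℂ K) (A : K →L[ℂ] K) : Prop :=
  ∃ hA : ∀ x ∈ S.topologicalClosure, A x ∈ S.topologicalClosure,
    IsSelfAdjoint (LinearMap.toPMap ((A : K →ₗ[ℂ] K).restrict hA)
      (S.comap S.topologicalClosure.subtype)).closure

/-- The spectrum of `T` is contained in `[0, 1]`. -/
def SpectrumInUnit {K : Type u} [NormedAddCommGroup K] [InnerProductSpace ℂ K]
    (T : K →L[ℂ] K) : Prop :=
  spectrum ℂ T ⊆ Complex.ofReal '' Set.Icc 0 1

end Spectral

/-! ### The effective parameter problem -/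

section Effective

variable {Ω : Type u} [MeasurableSpace Ω] {P : Measure Ω} [IsProbabilityMeasure P] {d : ℕ}
variable {c : Ω → Fin 2} (hc : Measurable c)

/-- `U` has mean `U0`, satisfies the weak equation `V`, and `a U` satisfies the weak equation `W`.
With `V` curl-free, `W` divergence-free and `a = σ` this is Maxwell's system for the electric field
`E` with mean `E0`; with `V` divergence-free, `W` curl-free and `a = ρ` it is the system for the
current `J` with mean `J0`. -/
structure IsField (V W : Submodule ℂ (VField P d)) (a : Fin 2 → ℂ) (U0 : Fin d → ℂ)
    (U : VField P d) : Prop where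
  mem : U ∈ V
  flux : medium hc a U ∈ W
  mean : meanV P U = U0

/-- A solution of `IsField` (the solution, when it exists uniquely). -/
def theField (V W : Submodule ℂ (VField P d)) (a : Fin 2 → ℂ) (U0 : Fin d → ℂ) : VField P d :=
  Classical.epsilon (IsField hc V W a U0)

/-- The effective matrix: its `j`-th column is the mean of `a U` for the solution `U` with mean
the `j`-th standard basis vector. -/
def effMatrix (V W : Submodule ℂ (VField P d)) (a : Fin 2 → ℂ) : Matrix (Fin d) (Fin d) ℂ :=
  Matrix.of fun k j => mean P (medium hc a (theField hc V W a (Pi.single j 1)) k)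

/-- The component `(k, j)` above, `a* e_j · e_k`, written with the index order `j k`. -/
def effComp (V W : Submodule ℂ (VField P d)) (a : Fin 2 → ℂ) (j k : Fin d) : ℂ :=
  effMatrix hc V W a k j

/-- The values of the coefficients in the two components, when the contrast between component `i`
and the other component is `h` and the coefficient of the other component is `b`. -/
def withContrast (i : Fin 2) (b h : ℂ) : Fin 2 → ℂ := fun i' => if i' = i then b * h else b

/-- The contrast parameter `1 / (1 - a i / a i')`, where `i' = 1 - i` is the other component. For
`a = σ` it is `s` if `i = 0` and `t` if `i = 1`; for `a = ρ = 1 / σ` it is `t` if `i = 0` and `s`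
if `i = 1`. -/
def contrast (a : Fin 2 → ℂ) (i : Fin 2) : ℂ := 1 / (1 - a i / a (1 - i))

/-- The contrast `a 0 / a 1` is off `(-∞, 0]` (in particular `a 0` and `a 1` are nonzero). -/
def Admissible (a : Fin 2 → ℂ) : Prop := a 0 / a 1 ∈ Complex.slitPlane

/-- Coercivity, well-posedness and analyticity of the effective parameters. -/
structure FieldClaims (V W : Submodule ℂ (VField P d)) : Prop where
  /-- The form `⟨a ξ · ζ⟩` is coercive. -/
  coercive : ∀ a, Admissible a → ∃ κ : ℝ, 0 < κ ∧ ∀ ξ ∈ fluct V,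
    κ * ‖ξ‖ ^ 2 ≤ ‖⟪ξ, medium hc a ξ⟫_ℂ‖
  /-- The fields exist uniquely. -/
  exists_unique : ∀ a, Admissible a → ∀ U0, ∃! U, IsField hc V W a U0 U
  /-- The effective matrix maps the mean field to the mean flux. -/
  effective : ∀ a, Admissible a → ∀ U0 U, IsField hc V W a U0 U →
    (effMatrix hc V W a).mulVec U0 = meanV P (medium hc a U)
  /-- The components of the effective matrix are analytic in either contrast. -/
  analytic : ∀ i : Fin 2, ∀ b : ℂ, b ≠ 0 → ∀ j k : Fin d,
    AnalyticOnNhd ℂ (fun h => effComp hc V W (withContrast i b h) j k) Complex.slitPlane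

/-- The constant field equal to the `j`-th standard basis vector. -/
def basisV (P : Measure Ω) [IsProbabilityMeasure P] (j : Fin d) : VField P d :=
  constV P (Pi.single j 1)

/-- The operator `χ i Λ χ i`. -/
def compression (Λ : VField P d →L[ℂ] VField P d) (i : Fin 2) : VField P d →L[ℂ] VField P d :=
  chi hc i * Λ * chi hc i

/-- The function `l ↦ ⟨Q l χ i e_j · e_k⟩`. -/
def spectralFun (Q : ℝ → VField P d →L[ℂ] VField P d) (i : Fin 2) (j k : Fin d) (l : ℝ) : ℂ :=
  ⟪basisV P k, Q l (chi hc i (basisV P j))⟫_ℂ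

end Effective

section Claims

variable {Ω : Type u} [MeasurableSpace Ω] {P : Measure Ω} [IsProbabilityMeasure P] {d : ℕ}
variable [AddAction (Fin d → ℝ) Ω] [MeasurableConstVAdd (Fin d → ℝ) Ω]
variable [VAddInvariantMeasure (Fin d → ℝ) Ω P]
variable {c : Ω → Fin 2} (hc : Measurable c)

open scoped MeasureTheory.VectorMeasure in
/-- The spectral theory of the operators `χ i Λ χ i`, for the projection `Λ` onto `fluct V`
(`Λ = Γ` for the electric field, `Λ = Υ` for the current). -/
structure SpectralClaims (V W : Submodule ℂ (VField P d))
    (Λ : VField P d →L[ℂ] VField P d) : Prop where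
  /-- `χ i Λ χ i` is a positive bounded self-adjoint operator of norm at most one. -/
  self_adjoint : ∀ i, IsSelfAdjoint (compression hc Λ i) ∧ (compression hc Λ i).IsPositive ∧
    ‖compression hc Λ i‖ ≤ 1
  spectrum_subset : ∀ i, SpectrumInUnit (compression hc Λ i)
  /-- It is (essentially) self-adjoint on once and on twice differentiable fields. -/
  self_adjoint_on : ∀ i, EssSelfAdjointOn (vec (D1 P d) d) (compression hc Λ i) ∧
    EssSelfAdjointOn (vec (D2 P d) d) (compression hc Λ i)
  /-- If the `χ i` preserve the mean-zero space `H¹`, then so do the `χ i Λ χ i`, and these are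
  (essentially) self-adjoint with domain `H¹` and with domain `H²`. -/
  self_adjoint_mean_zero : (∀ i, ∀ ξ ∈ H1 P d, chi hc i ξ ∈ H1 P d) → ∀ i,
    (∀ ξ ∈ H1 P d, compression hc Λ i ξ ∈ H1 P d) ∧
    EssSelfAdjointOn (H1 P d) (compression hc Λ i) ∧
    EssSelfAdjointOn (H2 P d) (compression hc Λ i)
  /-- The resolvent representation `χ i U = s (s - χ i Λ χ i)⁻¹ χ i U0`. -/
  resolvent_rep : ∀ a, Admissible a → ∀ i, a i ≠ a (1 - i) → ∀ U0 U, IsField hc V W a U0 U →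
    contrast a i ∈ resolventSet ℂ (compression hc Λ i) ∧
    chi hc i U = contrast a i •
      resolvent (compression hc Λ i) (contrast a i) (chi hc i (constV P U0))
  /-- The resolution of the identity of `χ i Λ χ i` and the Stieltjes integral representations of
  the effective parameters. -/
  stieltjes : ∀ i, ∃ Q, IsResolutionOfIdentity (compression hc Λ i) Q ∧
    (∀ Q', IsResolutionOfIdentity (compression hc Λ i) Q' → Q' = Q) ∧
    (∀ l, Commute (Q l) (chi hc i)) ∧
    ∃ μ : Fin d → Fin d → SignedMeasure ℝ,
      (∀ j k l, ((μ j k (Set.Iic l) : ℝ) : ℂ) = spectralFun hc Q i j k l) ∧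
      (∀ k B, 0 ≤ μ k k B) ∧
      (∀ s : ℂ, s ∉ Complex.ofReal '' Set.Icc 0 1 → ∀ j k,
        ⟪basisV P k, resolvent (compression hc Λ i) s (chi hc i (basisV P j))⟫_ℂ =
          ∫ᵛ l in Set.Icc (0 : ℝ) 1, (s - (l : ℂ))⁻¹ ∂<•(μ j k)) ∧
      (∀ a, Admissible a → a i ≠ a (1 - i) → ∀ j k,
        effComp hc V W a j k / a (1 - i) = (if j = k then 1 else 0) -
          ∫ᵛ l in Set.Icc (0 : ℝ) 1, (contrast a i - (l : ℂ))⁻¹ ∂<•(μ j k))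

end Claims

/-! ### Potentials -/

section Potentials

variable {Ω : Type u} [MeasurableSpace Ω] (P : Measure Ω) [IsProbabilityMeasure P]
variable (d : ℕ) [AddAction (Fin d → ℝ) Ω] [MeasurableConstVAdd (Fin d → ℝ) Ω]
variable [VAddInvariantMeasure (Fin d → ℝ) Ω P]

/-- Potentials of stationary gradient fields, normalized to vanish at the origin: random functions
`φ(x, ·) ∈ L²(Ω, P)` with stationary increments, `φ(x + y) = φ(x) + T x φ(y)`, that are mean square
differentiable. A stationary field `f` gives the potential `T x f - f`, with gradient
`(L 1 f, …, L d f)`; a constant vector `E0` gives the potential `E0 · x`. -/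
def Potential : Submodule ℂ ((Fin d → ℝ) → ScalarField P) where
  carrier := {φ | (∀ x y, φ (x + y) = φ x + translate P d x (φ y)) ∧
    ∀ i : Fin d, DifferentiableAt ℝ (fun t : ℝ => φ (Pi.single i t)) 0}
  add_mem' := by
    rintro φ ψ ⟨h1, h2⟩ ⟨h3, h4⟩
    refine ⟨fun x y => ?_, fun i => DifferentiableAt.fun_add (h2 i) (h4 i)⟩
    simp only [Pi.add_apply, h1, h3, map_add]
    abel
  zero_mem' := by
    refine ⟨fun x y => ?_, fun i => ?_⟩
    · simp only [Pi.zero_apply, map_zero, add_zero]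
    · exact differentiableAt_const _
  smul_mem' := by
    rintro a φ ⟨h1, h2⟩
    refine ⟨fun x y => ?_, fun i => DifferentiableAt.fun_const_smul (h2 i) a⟩
    simp only [Pi.smul_apply, h1, map_smul, smul_add]

/-- The gradient at the origin of a potential, a stationary vector field. -/
def potGrad : Potential P d →ₗ[ℂ] VField P d where
  toFun φ := WithLp.toLp 2 (fun i => deriv (fun t : ℝ => φ.1 (Pi.single i t)) 0)
  map_add' φ ψ := by
    ext1 i
    exact deriv_fun_add (φ.2.2 i) (ψ.2.2 i)
  map_smul' a φ := by
    ext1 i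
    exact deriv_fun_const_smul a (φ.2.2 i)

theorem translate_const (x : Fin d → ℝ) (b : ℂ) :
    translate P d x (Lp.const 2 P b) = Lp.const 2 P b := by
  rfl

/-- The potential `E0 · x` of the constant field `E0`. -/
def linPot (E0 : Fin d → ℂ) : Potential P d :=
  ⟨fun x => (∑ i, (x i : ℂ) * E0 i) • Lp.const 2 P (1 : ℂ), by
    refine ⟨fun x y => ?_, fun i => ?_⟩
    · rw [map_smul, translate_const, ← add_smul, ← Finset.sum_add_distrib]
      simp only [Pi.add_apply, Complex.ofReal_add, add_mul]
    · refine DifferentiableAt.smul_const ?_ _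
      refine DifferentiableAt.fun_sum fun j _ => ?_
      refine DifferentiableAt.mul_const ?_ _
      by_cases h : j = i
      · subst h
        simp only [Pi.single_eq_same]
        exact Complex.ofRealCLM.differentiableAt
      · simp only [Pi.single_eq_of_ne h]
        exact differentiableAt_const _⟩

/-- The potentials whose gradient has mean zero, with the norm `‖∇φ‖`: the completion of the
mean-zero stationary potentials in the norm `⟨|∇f|²⟩^(1/2)`. -/
def potFluct : Submodule ℂ (Potential P d) :=
  (vec (LinearMap.ker (mean P)) d).comap (potGrad P d)

variable {P d}
variable {c : Ω → Fin 2} (hc : Measurable c)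

/-- The form `⟨χ i ∇f · ∇g⟩`. -/
def dirichlet (i : Fin 2) (f g : Potential P d) : ℂ :=
  ⟪potGrad P d g, chi hc i (potGrad P d f)⟫_ℂ

/-- `K` is the Hilbert space completion, through `ι`, of the space `S` of potentials with the inner
product `⟨χ i ∇f · ∇g⟩` (potentials with `χ i ∇f = 0` being identified with zero). -/
structure IsDirichletCompletion (i : Fin 2) (S : Submodule ℂ (Potential P d))
    {K : Type u} [NormedAddCommGroup K] [InnerProductSpace ℂ K] (ι : S →ₗ[ℂ] K) : Prop where
  inner_eq : ∀ f g : S, ⟪ι g, ι f⟫_ℂ = dirichlet hc i (f : Potential P d) (g : Potential P d)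
  dense : DenseRange ι

/-- The Sobolev space theory of the operator `M = (∇*∇)⁻¹ [∇* χ i ∇]` on potentials. -/
structure SobolevClaims (Γ : VField P d →L[ℂ] VField P d) (i : Fin 2)
    (M : Module.End ℂ (Potential P d)) : Prop where
  /-- `M f` is the unique weak solution `g` of `∇*∇ g = ∇* χ i ∇ f`. -/
  weak_solution : ∀ f g, M f = g ↔ g ∈ potFluct P d ∧ ∀ ψ ∈ D1 P d,
    ⟪grad P d ψ, potGrad P d g⟫_ℂ = ⟪grad P d ψ, chi hc i (potGrad P d f)⟫_ℂ
  grad_pow : ∀ (n : ℕ) (f : Potential P d),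
    potGrad P d ((M ^ n) f) = ((Γ * chi hc i) ^ n : VField P d →L[ℂ] VField P d) (potGrad P d f)
  symmetric : ∀ f g, dirichlet hc i (M f) g = dirichlet hc i f (M g)
  positive : ∀ f, 0 ≤ (dirichlet hc i (M f) f).re ∧ (dirichlet hc i (M f) f).im = 0
  bounded : ∀ f, (dirichlet hc i (M f) (M f)).re ≤ (dirichlet hc i f f).re
  /-- The gradient is a bijection from mean-zero potentials onto mean-zero curl-free fields,
  isometric for the norm `‖∇f‖`, also between the domains of `M` and `χ i Γ χ i`. -/
  domains : Set.BijOn (potGrad P d) (potFluct P d) (fluct (CurlFree P d)) ∧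
    Set.BijOn (potGrad P d) {f | f ∈ potFluct P d ∧ chi hc i (potGrad P d f) ≠ 0}
      {ξ | ξ ∈ fluct (CurlFree P d) ∧ chi hc i ξ ≠ 0}
  /-- The ranges of `M` and of `χ i Γ χ i` on these domains correspond bijectively under `χ i ∇`,
  isometrically for the norm `⟨χ i ∇g · ∇g⟩^(1/2)`. -/
  ranges : (∀ f, compression hc Γ i (potGrad P d f) = chi hc i (potGrad P d (M f))) ∧
    (∀ f, ((‖compression hc Γ i (potGrad P d f)‖ ^ 2 : ℝ) : ℂ) = dirichlet hc i (M f) (M f)) ∧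
    Set.BijOn (fun g => chi hc i (potGrad P d g))
      (M '' {f | f ∈ potFluct P d ∧ chi hc i (potGrad P d f) ≠ 0})
      (compression hc Γ i '' {ξ | ξ ∈ fluct (CurlFree P d) ∧ chi hc i ξ ≠ 0})
  /-- The resolvent representation `φ = (s - M)⁻¹ M φ₀` with `E = E0 + ∇φ` and `φ₀ = E0 · x`. -/
  resolvent_rep : ∀ a, Admissible a → a i ≠ a (1 - i) → ∀ E0 E,
    IsField hc (CurlFree P d) (DivFree P d) a E0 E →
    contrast a i ∈ resolventSet ℂ M ∧
    ∃ φ ∈ potFluct P d, E = constV P E0 + potGrad P d φ ∧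
      φ = resolvent M (contrast a i) (M (linPot P d E0))
  /-- On the completion of any space of potentials containing the mean-zero ones, with inner product
  `⟨χ i ∇f · ∇g⟩`, `M` extends to a positive bounded self-adjoint operator with spectrum in
  `[0, 1]`; its resolution of the identity and its spectral measures are related to those of
  `χ i Γ χ i` and represent the effective conductivity. -/
  completion : ∀ S : Submodule ℂ (Potential P d), potFluct P d ≤ S →
    ∀ (K : Type u) [NormedAddCommGroup K] [InnerProductSpace ℂ K] [CompleteSpace K]
      (ι : S →ₗ[ℂ] K), IsDirichletCompletion hc i S ι →
    ∃ M' : K →L[ℂ] K, (∀ f g : S, (g : Potential P d) = M f → M' (ι f) = ι g) ∧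
      IsSelfAdjoint M' ∧ M'.IsPositive ∧ ‖M'‖ ≤ 1 ∧ SpectrumInUnit M' ∧
      ∃ Q' : ℝ → K →L[ℂ] K, IsResolutionOfIdentity M' Q' ∧
        (∀ Q'', IsResolutionOfIdentity M' Q'' → Q'' = Q') ∧
        ∀ Q, IsResolutionOfIdentity (compression hc Γ i) Q →
          (∃ X : K →ₗᵢ[ℂ] VField P d, (∀ f : S, X (ι f) = chi hc i (potGrad P d f)) ∧
            ∀ l (f : S), X (Q' l (ι f)) = chi hc i (Q l (potGrad P d f))) ∧
          ∀ (j : Fin d) (φ : S), (φ : Potential P d) = linPot P d (Pi.single j 1) →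
            ∃ ν : Measure ℝ, IsFiniteMeasure ν ∧
              (∀ l, (ν.real (Set.Iic l) : ℂ) = ⟪ι φ, Q' l (ι φ)⟫_ℂ) ∧
              (∀ μ : SignedMeasure ℝ,
                (∀ l, ((μ (Set.Iic l) : ℝ) : ℂ) = spectralFun hc Q i j j l) →
                ∀ B, MeasurableSet B → μ B = ν.real B) ∧
              ∀ a, Admissible a → a i ≠ a (1 - i) →
                effComp hc (CurlFree P d) (DivFree P d) a j j / a (1 - i) =
                  1 - ∫ l in Set.Icc (0 : ℝ) 1, (contrast a i - (l : ℂ))⁻¹ ∂ν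

end Potentials

end TwoComponent

end

open MeasureTheory Filter Topology
open scoped ENNReal InnerProductSpace

noncomputable section

set_option linter.unusedSectionVars false

namespace TwoComponent

universe u

/-! ### The resolution of the identity of a positive contraction. -/

section SpectralTheorem

open scoped CompactlySupported

variable {K : Type u} [NormedAddCommGroup K] [InnerProductSpace ℂ K] [CompleteSpace K]
variable {T : K →L[ℂ] K}

/-! Everything rests on one orthogonal decomposition of `VField P d` into mean-zero curl-free fields
and divergence-free fields. Gradients are curl-free, and a mean-zero curl-free field orthogonal to
all gradients is also divergence-free. After averaging along the group, the components of such a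
field are killed by the Laplacian `∑ L j L j`, hence by every `L j`; so they are
translation-invariant, constant by ergodicity, and zero (`eq_zero_of_mem_CurlFree_of_mem_DivFree`,
`fluct_CurlFree_eq_closure`, `mem_CurlFree_iff`). Therefore `Γ` and `Υ` are taken to be the
orthogonal projections onto `fluct (CurlFree P d)` and `fluct (DivFree P d)`; their differential
formulas hold for mollified fields and pass to the closure of the graphs.

With `z = 1 - a i / a (1 - i)` the medium is `a (1 - i)` times `1 - z χ i`, and both field problems
become the single equation `U = U0 + z Λ χ i U` (`isField_iff`). Multiplication by `χ i` gives `(1 -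
z χ i Λ χ i) χ i U = χ i U0`. The operator `χ i Λ χ i` is a positive contraction, so its spectrum
lies in `[0, 1]`, while `1 / z` avoids `[0, 1]` because the ratio of the coefficients avoids `(-∞,
0]`. This invertibility gives existence, uniqueness, analyticity and the resolvent representation.
The Stieltjes formulas follow from the spectral theorem for positive contractions, built here from
the continuous functional calculus and the Riesz representation theorem. The measures are real
because all operators commute with complex conjugation and the resolution of the identity is unique
(`IsResolutionOfIdentity.unique`).

For potentials, the gradient is a bijection onto the curl-free fields (`potGrad_injective`,
`potGrad_mem_CurlFree`, `exists_potGrad_eq`) and carries `M` to `Γ χ i`. On a Dirichlet completion,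
`χ i ∇` extends to an isometry into `VField P d` that intertwines `M` with `χ i Γ χ i`, so the
spectral statements are pulled back along it (`IsResolutionOfIdentity.pullback`,
`potential_completion`). -/

theorem spectrum_real_subset_Icc (hT : T.IsPositive) (h1 : ‖T‖ ≤ 1) :
    spectrum ℝ T ⊆ Set.Icc 0 1 := by
  intro x hx
  refine ⟨spectrum_nonneg_of_nonneg ((ContinuousLinearMap.nonneg_iff_isPositive T).2 hT) hx, ?_⟩
  have h := spectrum.norm_le_norm_mul_of_mem hx
  have h2 : ‖(1 : K →L[ℂ] K)‖ ≤ 1 := ContinuousLinearMap.norm_id_le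
  calc x ≤ ‖x‖ := Real.le_norm_self x
    _ ≤ ‖T‖ * ‖(1 : K →L[ℂ] K)‖ := h
    _ ≤ 1 := mul_le_one₀ h1 (norm_nonneg _) h2

theorem spectrumInUnit_of_isPositive (hT : T.IsPositive) (h1 : ‖T‖ ≤ 1) : SpectrumInUnit T := by
  intro z hz
  have hsa : IsSelfAdjoint T := hT.isSelfAdjoint
  have hz' : z = z.re := hsa.mem_spectrum_eq_re hz
  refine ⟨z.re, spectrum_real_subset_Icc hT h1 ?_, hz'.symm⟩
  rw [← spectrum.algebraMap_mem_iff ℂ]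
  simpa using hz' ▸ hz

/-- The spectral measure of a vector, on the spectrum of a positive contraction. -/
theorem exists_spectralMeasure (hT : T.IsPositive) (h1 : ‖T‖ ≤ 1) (ψ : K) :
    ∃ ν : Measure ℝ, IsFiniteMeasure ν ∧ ν (Set.Icc 0 1)ᶜ = 0 ∧
      ∀ f : ℝ → ℝ, ContinuousOn f (Set.Icc 0 1) →
        ⟪ψ, cfc f T ψ⟫_ℂ = ((∫ l, f l ∂ν : ℝ) : ℂ) := by
  have hsa : IsSelfAdjoint T := hT.isSelfAdjoint
  have hsp := spectrum_real_subset_Icc hT h1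
  let I : Type := Set.Icc (0 : ℝ) 1
  -- A function on the compact interval is extended to `ℝ` by constants, so that `cfc` applies to
  -- it; nothing changes on the spectrum.
  let e : (I → ℝ) → ℝ → ℝ := fun f x => f (Set.projIcc 0 1 zero_le_one x)
  have he : ∀ f : C_c(I, ℝ), ContinuousOn (e f) (spectrum ℝ T) := fun f =>
    (f.continuous.comp continuous_projIcc).continuousOn
  let Λ₀ : C_c(I, ℝ) →ₗ[ℝ] ℝ :=
    { toFun := fun f => (⟪ψ, cfc (e f) T ψ⟫_ℂ).re
      map_add' := fun f g => by
        have : e (f + g : C_c(I, ℝ)) = fun x => e f x + e g x := rfl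
        rw [this, cfc_add T _ _ (he f) (he g)]
        simp
      map_smul' := fun a f => by
        have : e (a • f : C_c(I, ℝ)) = fun x => a • e f x := rfl
        rw [this, cfc_smul a _ T (he f)]
        simp [inner_smul_right_eq_smul] }
  let Λ : C_c(I, ℝ) →ₚ[ℝ] ℝ := PositiveLinearMap.mk₀ Λ₀ (by
    intro f hf
    have h0 : 0 ≤ cfc (e f) T := cfc_nonneg fun x _ => hf _
    exact ((Complex.le_def.1
      (((ContinuousLinearMap.nonneg_iff_isPositive _).1 h0).inner_nonneg_right ψ)).1 :))
  let ν₀ := RealRMK.rieszMeasure Λ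
  have hfin : IsFiniteMeasure ν₀ := inferInstance
  have hemb : MeasurableEmbedding (Subtype.val : I → ℝ) :=
    MeasurableEmbedding.subtype_coe measurableSet_Icc
  refine ⟨ν₀.map Subtype.val, inferInstance, ?_, fun f hf => ?_⟩
  · rw [hemb.map_apply]
    have : (Subtype.val : I → ℝ) ⁻¹' (Set.Icc (0 : ℝ) 1)ᶜ = ∅ := by
      ext x
      simp
    rw [this, measure_empty]
  · rw [hemb.integral_map]
    let g : C_c(I, ℝ) := CompactlySupportedContinuousMap.continuousMapEquiv
      ⟨fun x : I => f x, continuousOn_iff_continuous_domRestrict.1 hf⟩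
    have h := RealRMK.integral_rieszMeasure Λ g
    have h3 : cfc (e g) T = cfc f T := cfc_congr fun x hx => by
      change f (Set.projIcc 0 1 zero_le_one x) = f x
      rw [Set.projIcc_of_mem zero_le_one (hsp hx)]
    have h2 : Λ g = (⟪ψ, cfc f T ψ⟫_ℂ).re := by
      rw [← h3]; rfl
    have h4 : IsSelfAdjoint (cfc f T) := cfc_predicate f T
    have h5 : (⟪ψ, cfc f T ψ⟫_ℂ).im = 0 := by
      have := h4.isSymmetric.im_inner_self_apply ψ
      rw [← inner_conj_symm]
      simpa using this
    have h6 : ∫ x : I, f x ∂ν₀ = (⟪ψ, cfc f T ψ⟫_ℂ).re := by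
      rw [← h2, ← h]; rfl
    rw [h6]
    exact Complex.ext (by simp) (by simpa using h5)

theorem inner_apply_of_isSelfAdjoint {A : K →L[ℂ] K} (hA : IsSelfAdjoint A) (x y : K) :
    ⟪x, A y⟫_ℂ = ⟪A x, y⟫_ℂ :=
  (hA.isSymmetric.apply_clm x y).symm

theorem inner_apply_of_isStarProjection {A : K →L[ℂ] K} (hA : IsStarProjection A) (x : K) :
    ⟪x, A x⟫_ℂ = ((‖A x‖ ^ 2 : ℝ) : ℂ) := by
  have h : A x = A (A x) := by
    conv_lhs => rw [← hA.isIdempotentElem.eq]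
    rfl
  rw [h, inner_apply_of_isSelfAdjoint hA.isSelfAdjoint, ← h, inner_self_eq_norm_sq_to_K]
  norm_cast

theorem isSelfAdjoint_of_inner {A : K →L[ℂ] K} (h : ∀ x y, ⟪A x, y⟫_ℂ = ⟪x, A y⟫_ℂ) :
    IsSelfAdjoint A :=
  ContinuousLinearMap.isSelfAdjoint_iff_isSymmetric.2 h

/-- Since `f(T)` is self-adjoint, `⟨ψ, f(T)² ψ⟩ = ‖f(T) ψ‖²`, and `f(T)²` is the calculus of `f²`.
This turns convergence in `L²(ν)` into strong convergence of operators. -/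
theorem norm_cfc_apply_sq {ψ : K} {ν : Measure ℝ}
    (hν : ∀ f : ℝ → ℝ, ContinuousOn f (Set.Icc 0 1) →
      ⟪ψ, cfc f T ψ⟫_ℂ = ((∫ l, f l ∂ν : ℝ) : ℂ)) {f : ℝ → ℝ} (hf : Continuous f) :
    ‖cfc f T ψ‖ ^ 2 = ∫ l, f l * f l ∂ν := by
  have h4 : IsSelfAdjoint (cfc f T) := cfc_predicate f T
  have h := hν (fun l => f l * f l) (hf.mul hf).continuousOn
  rw [cfc_mul f f T hf.continuousOn hf.continuousOn, mul_apply_eq_comp,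
    inner_apply_of_isSelfAdjoint h4, inner_self_eq_norm_sq_to_K] at h
  exact Complex.ofReal_injective (by rw [← h]; norm_cast)

/-- Bounded pointwise convergence to zero implies strong convergence in the functional calculus. -/
theorem tendsto_cfc_apply_zero (hT : T.IsPositive) (h1 : ‖T‖ ≤ 1) (ψ : K) {ι : Type*}
    {F : Filter ι} [F.IsCountablyGenerated] {f : ι → ℝ → ℝ} (hf : ∀ i, Continuous (f i))
    {B : ℝ} (hB : ∀ i x, |f i x| ≤ B) (hlim : ∀ x, Tendsto (fun i => f i x) F (𝓝 0)) :
    Tendsto (fun i => cfc (f i) T ψ) F (𝓝 0) := by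
  obtain ⟨ν, hν, -, hint⟩ := exists_spectralMeasure hT h1 ψ
  have h2 : Tendsto (fun i => ∫ l, f i l * f i l ∂ν) F (𝓝 (∫ _, (0 : ℝ) ∂ν)) := by
    refine tendsto_integral_filter_of_dominated_convergence (fun _ => B * B)
      (Eventually.of_forall fun i => ((hf i).mul (hf i)).aestronglyMeasurable)
      (Eventually.of_forall fun i => ae_of_all _ fun x => ?_) (integrable_const _)
      (ae_of_all _ fun x => by simpa using (hlim x).mul (hlim x))
    rw [norm_mul]
    exact mul_le_mul (hB i x) (hB i x) (abs_nonneg _) ((abs_nonneg _).trans (hB i x))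
  rw [integral_zero] at h2
  rw [tendsto_zero_iff_norm_tendsto_zero]
  have h3 : Tendsto (fun i => √(‖cfc (f i) T ψ‖ ^ 2)) F (𝓝 (√0)) := by
    refine (Real.continuous_sqrt.tendsto 0).comp ?_
    simpa only [norm_cfc_apply_sq hint (hf _)] using h2
  simpa using h3

/-- Continuous functions decreasing to the indicator function of `(-∞, l]`. -/
def stepApprox (l : ℝ) (n : ℕ) (x : ℝ) : ℝ := max 0 (min 1 (1 - n * (x - l)))

theorem continuous_stepApprox (l : ℝ) (n : ℕ) : Continuous (stepApprox l n) := by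
  unfold stepApprox
  fun_prop

theorem stepApprox_nonneg (l : ℝ) (n : ℕ) (x : ℝ) : 0 ≤ stepApprox l n x := le_max_left _ _

theorem stepApprox_le_one (l : ℝ) (n : ℕ) (x : ℝ) : stepApprox l n x ≤ 1 :=
  max_le zero_le_one (min_le_left _ _)

theorem stepApprox_of_le {l x : ℝ} (h : x ≤ l) (n : ℕ) : stepApprox l n x = 1 := by
  have h2 : (n : ℝ) * (x - l) ≤ 0 := mul_nonpos_of_nonneg_of_nonpos n.cast_nonneg (by linarith)
  rw [stepApprox, min_eq_left (by linarith), max_eq_right zero_le_one]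

theorem eventually_stepApprox (l x : ℝ) :
    ∀ᶠ n in atTop, stepApprox l n x = (Set.Iic l).indicator 1 x := by
  by_cases h : x ≤ l
  · exact Eventually.of_forall fun n => by
      rw [stepApprox_of_le h, Set.indicator_of_mem (by exact h), Pi.one_apply]
  · rw [Set.indicator_of_notMem (by exact h)]
    have hpos : 0 < x - l := by linarith [not_le.1 h]
    filter_upwards [(tendsto_natCast_atTop_atTop (R := ℝ)).eventually_ge_atTop (1 / (x - l))]
      with n hn
    have : 1 ≤ n * (x - l) := (div_le_iff₀ hpos).1 hn
    rw [stepApprox, max_eq_left]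
    exact (min_le_right _ _).trans (by linarith)

theorem tendsto_stepApprox (l x : ℝ) :
    Tendsto (fun n => stepApprox l n x) atTop (𝓝 ((Set.Iic l).indicator 1 x)) :=
  tendsto_const_nhds.congr' ((eventually_stepApprox l x).mono fun _ h => h.symm)

/-- The indicator of `(-∞, l]` is not continuous, so the projection is obtained as a strong limit of
continuous functions of `T`. Differences of two approximants are bounded by `1` and tend pointwise
to zero as both indices grow; indexing by pairs makes this precisely the Cauchy property. -/
theorem exists_strongLimit_stepApprox (hT : T.IsPositive) (h1 : ‖T‖ ≤ 1) (l : ℝ) :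
    ∃ Q : K →L[ℂ] K, ∀ ψ, Tendsto (fun n => cfc (stepApprox l n) T ψ) atTop (𝓝 (Q ψ)) := by
  have h : ∀ ψ, ∃ x, Tendsto (fun n => cfc (stepApprox l n) T ψ) atTop (𝓝 x) := by
    intro ψ
    refine cauchySeq_tendsto_of_complete (cauchySeq_iff_tendsto_dist_atTop_0.2 ?_)
    have h2 := tendsto_cfc_apply_zero hT h1 ψ (F := (atTop : Filter (ℕ × ℕ)))
      (f := fun n x => stepApprox l n.1 x - stepApprox l n.2 x) (B := 1)
      (fun n => (continuous_stepApprox l _).sub (continuous_stepApprox l _))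
      (fun n x => abs_sub_le_iff.2
        ⟨by linarith [stepApprox_le_one l n.1 x, stepApprox_nonneg l n.2 x],
          by linarith [stepApprox_le_one l n.2 x, stepApprox_nonneg l n.1 x]⟩)
      (fun x => by
        rw [← sub_self ((Set.Iic l).indicator 1 x)]
        rw [← prod_atTop_atTop_eq]
        exact ((tendsto_stepApprox l x).comp tendsto_fst).sub
          ((tendsto_stepApprox l x).comp tendsto_snd))
    refine (tendsto_zero_iff_norm_tendsto_zero.1 h2).congr fun n => ?_
    rw [cfc_sub _ _ T (continuous_stepApprox l _).continuousOn
      (continuous_stepApprox l _).continuousOn, dist_eq_norm]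
    rfl
  choose q hq using h
  exact ⟨continuousLinearMapOfTendsto (fun n => cfc (stepApprox l n) T) (tendsto_pi_nhds.2 hq), hq⟩

/-- Strong limits are compatible with products once the left factors are uniformly bounded. -/
theorem tendsto_apply_apply {A B : ℕ → K →L[ℂ] K} {a b : K →L[ℂ] K} (hA : ∀ n, ‖A n‖ ≤ 1)
    (ha : ∀ ψ, Tendsto (fun n => A n ψ) atTop (𝓝 (a ψ)))
    (hb : ∀ ψ, Tendsto (fun n => B n ψ) atTop (𝓝 (b ψ))) (ψ : K) :
    Tendsto (fun n => A n (B n ψ)) atTop (𝓝 (a (b ψ))) := by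
  have h0 : Tendsto (fun n => A n (B n ψ - b ψ)) atTop (𝓝 0) := by
    refine squeeze_zero_norm (fun n => ?_) (tendsto_iff_norm_sub_tendsto_zero.1 (hb ψ))
    exact ((A n).le_of_opNorm_le (hA n) _).trans_eq (one_mul _)
  simpa using h0.add (ha (b ψ))

/-- Self-adjointness, products and commutation pass from the continuous approximants to their strong
limits; right continuity comes instead from the spectral measures. The statement keeps the
commutation with everything that commutes with `T`, on which uniqueness depends, and the integral
formula for the full calculus, from which the resolvent is computed. -/
theorem exists_isResolutionOfIdentity (hT : T.IsPositive) (h1 : ‖T‖ ≤ 1) :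
    ∃ Q, IsResolutionOfIdentity T Q ∧
      (∀ B, Commute T B → ∀ l, Commute (Q l) B) ∧
      ∀ ψ, ∃ ν : Measure ℝ, IsFiniteMeasure ν ∧ ν (Set.Icc 0 1)ᶜ = 0 ∧
        (∀ l, (ν.real (Set.Iic l) : ℂ) = ⟪ψ, Q l ψ⟫_ℂ) ∧
        ∀ f : ℝ → ℝ, ContinuousOn f (Set.Icc 0 1) →
          ⟪ψ, cfc f T ψ⟫_ℂ = ((∫ l, f l ∂ν : ℝ) : ℂ) := by
  choose Q hQ using exists_strongLimit_stepApprox hT h1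
  have hsa : IsSelfAdjoint T := hT.isSelfAdjoint
  have hmeas : ∀ ψ, ∃ ν : Measure ℝ, IsFiniteMeasure ν ∧ ν (Set.Icc 0 1)ᶜ = 0 ∧
        (∀ l, (ν.real (Set.Iic l) : ℂ) = ⟪ψ, Q l ψ⟫_ℂ) ∧
        ∀ f : ℝ → ℝ, ContinuousOn f (Set.Icc 0 1) →
          ⟪ψ, cfc f T ψ⟫_ℂ = ((∫ l, f l ∂ν : ℝ) : ℂ) := by
    intro ψ
    obtain ⟨ν, hν, h0, hint⟩ := exists_spectralMeasure hT h1 ψ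
    refine ⟨ν, hν, h0, fun l => ?_, hint⟩
    have h2 : Tendsto (fun n => ∫ x, stepApprox l n x ∂ν) atTop (𝓝 (ν.real (Set.Iic l))) := by
      rw [← integral_indicator_one measurableSet_Iic]
      refine tendsto_integral_of_dominated_convergence (fun _ => 1)
        (fun n => (continuous_stepApprox l n).aestronglyMeasurable) (integrable_const _)
        (fun n => ae_of_all _ fun x => ?_) (ae_of_all _ fun x => tendsto_stepApprox l x)
      rw [Real.norm_of_nonneg (stepApprox_nonneg l n x)]
      exact stepApprox_le_one l n x
    refine tendsto_nhds_unique ((Complex.continuous_ofReal.tendsto _).comp h2) ?_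
    refine ((tendsto_const_nhds (x := ψ)).inner (𝕜 := ℂ) (hQ l ψ)).congr fun n => ?_
    exact hint _ (continuous_stepApprox l n).continuousOn
  have hsaQ : ∀ l, IsSelfAdjoint (Q l) := fun l => isSelfAdjoint_of_inner fun x y => by
    refine tendsto_nhds_unique ((hQ l x).inner (𝕜 := ℂ) tendsto_const_nhds)
      (((tendsto_const_nhds (x := x)).inner (𝕜 := ℂ) (hQ l y)).congr fun n => ?_)
    exact inner_apply_of_isSelfAdjoint (cfc_predicate _ T) _ _
  have hnorm : ∀ l n, ‖cfc (stepApprox l n) T‖ ≤ 1 := fun l n =>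
    norm_cfc_le zero_le_one fun x _ => by
      rw [Real.norm_of_nonneg (stepApprox_nonneg l n x)]
      exact stepApprox_le_one l n x
  -- For `l ≤ l'` the product of the two limiting indicators is the smaller one, so `φ_l φ_l' - φ_l`
  -- tends boundedly to zero. The case `l = l'` is idempotence.
  have hmono : ∀ l l', l ≤ l' → Q l * Q l' = Q l := by
    intro l l' hl
    ext ψ
    have h2 := tendsto_apply_apply (hnorm l) (hQ l) (hQ l') ψ
    refine tendsto_nhds_unique h2 ?_
    have h3 := tendsto_cfc_apply_zero hT h1 ψ (F := (atTop : Filter ℕ))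
      (f := fun n x => stepApprox l n x * stepApprox l' n x - stepApprox l n x) (B := 1)
      (fun n => ((continuous_stepApprox l _).mul (continuous_stepApprox l' _)).sub
        (continuous_stepApprox l _))
      (fun n x => by
        have a1 := stepApprox_le_one l n x
        have a2 := stepApprox_nonneg l n x
        have b1 := stepApprox_le_one l' n x
        have b2 := stepApprox_nonneg l' n x
        rw [abs_le]
        constructor <;> nlinarith)
      (fun x => by
        have h5 := ((tendsto_stepApprox l x).mul (tendsto_stepApprox l' x)).sub
          (tendsto_stepApprox l x)
        convert h5 using 2
        by_cases hx : x ≤ l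
        · rw [Set.indicator_of_mem (by exact hx), Set.indicator_of_mem (by exact hx.trans hl)]
          simp
        · rw [Set.indicator_of_notMem (by exact hx)]
          simp)
    have h4 := h3.add (hQ l ψ)
    rw [zero_add] at h4
    refine h4.congr fun n => ?_
    rw [cfc_sub (fun x => stepApprox l n x * stepApprox l' n x) _ T
      ((continuous_stepApprox l _).mul (continuous_stepApprox l' _)).continuousOn
      (continuous_stepApprox l _).continuousOn, cfc_mul _ _ T
      (continuous_stepApprox l _).continuousOn (continuous_stepApprox l' _).continuousOn]
    simp
  have hproj : ∀ l, IsStarProjection (Q l) := fun l => ⟨hmono l l le_rfl, hsaQ l⟩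
  have hnsq : ∀ l ψ, ⟪ψ, Q l ψ⟫_ℂ = ((‖Q l ψ‖ ^ 2 : ℝ) : ℂ) := fun l =>
    inner_apply_of_isStarProjection (hproj l)
  refine ⟨Q, ⟨hproj, hmono, ?_, ?_, ?_, ?_⟩, ?_, hmeas⟩
  -- Continuity of `ν` from above, together with `‖Q r ψ - Q l ψ‖² = ν (-∞, r] - ν (-∞, l]`, which
  -- holds because `Q r - Q l` is again a projection.
  · intro l ψ
    obtain ⟨ν, hν, h0, hIic, hint⟩ := hmeas ψ
    rw [← continuousWithinAt_Ioi_iff_Ici]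
    have h2 : Tendsto (ν ∘ Set.Iic) (𝓝[>] l) (𝓝 (ν (⋂ r, ⋂ (_ : r > l), Set.Iic r))) :=
      tendsto_measure_biInter_gt (fun _ _ => measurableSet_Iic.nullMeasurableSet)
        (fun _ _ _ h => Set.Iic_subset_Iic.2 h) ⟨l + 1, by simp, measure_ne_top _ _⟩
    have h3 : (⋂ r, ⋂ (_ : r > l), Set.Iic r) = Set.Iic l := by
      ext x
      simp only [Set.mem_iInter, Set.mem_Iic]
      exact ⟨fun h => le_of_forall_gt_imp_ge_of_dense h, fun h r hr => h.trans hr.le⟩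
    rw [h3] at h2
    have h4 : Tendsto (fun r => ν.real (Set.Iic r) - ν.real (Set.Iic l)) (𝓝[>] l) (𝓝 0) := by
      rw [← sub_self (ν.real (Set.Iic l))]
      exact ((ENNReal.tendsto_toReal (measure_ne_top ν _)).comp h2).sub_const _
    have h5 : ∀ r ∈ Set.Ioi l, ‖Q r ψ - Q l ψ‖ ^ 2 = ν.real (Set.Iic r) - ν.real (Set.Iic l) := by
      intro r hr
      have e1 : Q l * Q r = Q l := hmono l r (le_of_lt hr)
      have e2 : Q r * Q l = Q l := by
        have := congrArg star e1
        rwa [star_mul, (hsaQ l).star_eq, (hsaQ r).star_eq] at this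
      have hp : IsStarProjection (Q r - Q l) := by
        refine ⟨?_, (hsaQ r).sub (hsaQ l)⟩
        change (Q r - Q l) * (Q r - Q l) = Q r - Q l
        rw [mul_sub, sub_mul, sub_mul, e1, e2, (hproj r).isIdempotentElem.eq,
          (hproj l).isIdempotentElem.eq]
        abel
      have e3 := inner_apply_of_isStarProjection hp ψ
      rw [sub_apply, inner_sub_right, ← hIic, ← hIic] at e3
      exact_mod_cast e3.symm
    have h6 : Tendsto (fun r => √(‖Q r ψ - Q l ψ‖ ^ 2)) (𝓝[>] l) (𝓝 (√0)) := by
      refine (Real.continuous_sqrt.tendsto 0).comp (h4.congr' ?_)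
      filter_upwards [self_mem_nhdsWithin] with r hr using (h5 r hr).symm
    refine tendsto_iff_norm_sub_tendsto_zero.2 ?_
    simpa using h6
  · intro l hl
    ext ψ
    obtain ⟨ν, hν, h0, hIic, hint⟩ := hmeas ψ
    have h2 : ν (Set.Iic l) = 0 := by
      have hsub : Set.Iic l ⊆ (Set.Icc (0 : ℝ) 1)ᶜ := by
        intro x hx h
        exact absurd h.1 (not_le.2 (lt_of_le_of_lt hx hl))
      exact measure_mono_null hsub h0
    have h3 := hIic l
    rw [measureReal_def, h2, hnsq] at h3
    have h4 : ‖Q l ψ‖ ^ 2 = 0 := by exact_mod_cast h3.symm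
    simpa using h4
  · intro l hl
    ext ψ
    have h2 : ∀ n, cfc (stepApprox l n) T ψ = ψ := fun n => by
      have : cfc (stepApprox l n) T = cfc (fun _ => (1 : ℝ)) T := cfc_congr fun x hx =>
        stepApprox_of_le ((spectrum_real_subset_Icc hT h1 hx).2.trans hl) n
      rw [this, cfc_const_one ℝ T]
      rfl
    exact tendsto_nhds_unique (hQ l ψ) (by simp only [h2]; exact tendsto_const_nhds)
  · intro ψ
    obtain ⟨ν, hν, h0, hIic, hint⟩ := hmeas ψ
    refine ⟨ν, hν, hIic, ?_⟩
    have := hint id continuousOn_id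
    rwa [cfc_id ℝ T] at this
  · intro B hB l
    ext ψ
    refine tendsto_nhds_unique (hQ l (B ψ)) (((B.continuous.tendsto _).comp (hQ l ψ)).congr
      fun n => ?_)
    exact (DFunLike.congr_fun (hB.cfc_real (stepApprox l n)).eq ψ).symm

end SpectralTheorem

/-! ### Uniqueness of the resolution of the identity and the resolvent as a Stieltjes integral. -/

section SpectralUniqueness

variable {K : Type u} [NormedAddCommGroup K] [InnerProductSpace ℂ K] [CompleteSpace K]
variable {T : K →L[ℂ] K} {Q : ℝ → K →L[ℂ] K}

/-- A distribution function that vanishes to the left of `0` and is constant from `1` on leaves no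
mass outside the interval. An atom at `0` remains possible, hence the strict inequality in `h0` and
the countable union for `Iio 0`. -/
theorem measure_compl_Icc_eq_zero {ν : Measure ℝ} [IsFiniteMeasure ν]
    (h0 : ∀ l < 0, ν.real (Set.Iic l) = 0)
    (h1 : ∀ l, 1 ≤ l → ν.real (Set.Iic l) = ν.real (Set.Iic 1)) : ν (Set.Icc 0 1)ᶜ = 0 := by
  have a0 : ν (Set.Iio 0) = 0 := by
    have : Set.Iio (0 : ℝ) ⊆ ⋃ n : ℕ, Set.Iic (-(1 / ((n : ℝ) + 1))) := by
      intro x hx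
      obtain ⟨n, hn⟩ := exists_nat_one_div_lt (K := ℝ) (neg_pos.2 (show x < 0 from hx))
      exact Set.mem_iUnion.2 ⟨n, by rw [Set.mem_Iic]; linarith⟩
    refine measure_mono_null this (measure_iUnion_null fun n => ?_)
    have := h0 (-(1 / ((n : ℝ) + 1))) (neg_neg_of_pos (by positivity))
    exact (measureReal_eq_zero_iff).1 this
  have a1 : ν (Set.Iic 1)ᶜ = 0 := by
    have e : ν (Set.Iic 1) = ν Set.univ := by
      refine tendsto_nhds_unique (tendsto_const_nhds.congr' ?_) (tendsto_measure_Iic_atTop ν)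
      filter_upwards [eventually_ge_atTop 1] with l hl
      exact ((ENNReal.toReal_eq_toReal_iff' (measure_ne_top _ _) (measure_ne_top _ _)).1
        (h1 l hl)).symm
    rw [measure_compl measurableSet_Iic (measure_ne_top _ _), e, tsub_self]
  refine measure_mono_null ?_ (measure_union_null a0 a1)
  intro x hx
  by_cases h : x < 0
  · exact Or.inl h
  · exact Or.inr fun h' => hx ⟨not_lt.1 h, h'⟩

theorem integrable_id_of_compl_Icc {ν : Measure ℝ} [IsFiniteMeasure ν]
    (h : ν (Set.Icc 0 1)ᶜ = 0) : Integrable (fun x : ℝ => x) ν := by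
  refine Integrable.of_bound measurable_id.aestronglyMeasurable 1 ?_
  have : ∀ᵐ x ∂ν, x ∈ Set.Icc (0 : ℝ) 1 := h
  filter_upwards [this] with x hx
  rw [Real.norm_of_nonneg hx.1]
  exact hx.2

theorem measure_ext_of_Iic_real {ν ν' : Measure ℝ} [IsFiniteMeasure ν] [IsFiniteMeasure ν']
    (h : ∀ l, ν.real (Set.Iic l) = ν'.real (Set.Iic l)) : ν = ν' :=
  Measure.ext_of_Iic _ _ fun l =>
    (ENNReal.toReal_eq_toReal_iff' (measure_ne_top _ _) (measure_ne_top _ _)).1 (h l)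

namespace IsResolutionOfIdentity

theorem real_Iic (hQ : IsResolutionOfIdentity T Q) {ψ : K} {ν : Measure ℝ}
    (hν : ∀ l, (ν.real (Set.Iic l) : ℂ) = ⟪ψ, Q l ψ⟫_ℂ) (l : ℝ) :
    ν.real (Set.Iic l) = ‖Q l ψ‖ ^ 2 := by
  have := hν l
  rw [inner_apply_of_isStarProjection (hQ.proj l)] at this
  exact_mod_cast this

theorem compl_Icc (hQ : IsResolutionOfIdentity T Q) {ψ : K} {ν : Measure ℝ} [IsFiniteMeasure ν]
    (hν : ∀ l, (ν.real (Set.Iic l) : ℂ) = ⟪ψ, Q l ψ⟫_ℂ) : ν (Set.Icc 0 1)ᶜ = 0 :=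
  measure_compl_Icc_eq_zero (fun l hl => by rw [hQ.real_Iic hν, hQ.eq_zero l hl]; simp)
    (fun l hl => by rw [hQ.real_Iic hν, hQ.real_Iic hν, hQ.eq_one l hl, hQ.eq_one 1 le_rfl])

theorem real_univ (hQ : IsResolutionOfIdentity T Q) {ψ : K} {ν : Measure ℝ} [IsFiniteMeasure ν]
    (hν : ∀ l, (ν.real (Set.Iic l) : ℂ) = ⟪ψ, Q l ψ⟫_ℂ) : ν.real Set.univ = ‖ψ‖ ^ 2 := by
  have h := hQ.real_Iic hν 1
  rw [hQ.eq_one 1 le_rfl, one_apply_eq_self] at h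
  rw [← h]
  refine measureReal_congr ?_
  have : ∀ᵐ x ∂ν, x ∈ Set.Icc (0 : ℝ) 1 := hQ.compl_Icc hν
  filter_upwards [this] with x hx
  exact propext ⟨fun _ => hx.2, fun _ => trivial⟩

/-- The spectral measure of a vector in the range of `Q l` has all its mass on `(-∞, l]`. -/
theorem inner_le (hQ : IsResolutionOfIdentity T Q) {l : ℝ} {φ : K} (hφ : Q l φ = φ) :
    (⟪φ, T φ⟫_ℂ).re ≤ l * ‖φ‖ ^ 2 := by
  obtain ⟨ν, hν, hIic, hint⟩ := hQ.integral φ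
  rw [hint, Complex.ofReal_re]
  have hu := hQ.real_univ hIic
  have hl := hQ.real_Iic hIic l
  rw [hφ, ← hu] at hl
  have h0 : ν (Set.Iic l)ᶜ = 0 := by
    rw [measure_compl measurableSet_Iic (measure_ne_top _ _), tsub_eq_zero_iff_le]
    exact ((ENNReal.toReal_eq_toReal_iff' (measure_ne_top _ _) (measure_ne_top _ _)).1 hl).ge
  have h1 : ∀ᵐ x ∂ν, x ∈ Set.Iic l := h0
  calc ∫ x, x ∂ν ≤ ∫ _, l ∂ν :=
        integral_mono_ae (integrable_id_of_compl_Icc (hQ.compl_Icc hIic)) (integrable_const _) h1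
    _ = l * ‖φ‖ ^ 2 := by rw [integral_const, hu, smul_eq_mul, mul_comm]

/-- Here the spectral measure lives on `(l, ∞)` and is nonzero. The strictness, against `inner_le`,
is what separates the range of one resolution from the kernel of another. -/
theorem lt_inner (hQ : IsResolutionOfIdentity T Q) {l : ℝ} {φ : K} (hφ : Q l φ = 0)
    (hne : φ ≠ 0) : l * ‖φ‖ ^ 2 < (⟪φ, T φ⟫_ℂ).re := by
  obtain ⟨ν, hν, hIic, hint⟩ := hQ.integral φ
  rw [hint, Complex.ofReal_re]
  have hu := hQ.real_univ hIic
  have hl := hQ.real_Iic hIic l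
  have h0 : ν (Set.Iic l) = 0 := by
    rw [hφ] at hl
    exact (measureReal_eq_zero_iff).1 (by simpa using hl)
  have h1 : ∀ᵐ x ∂ν, l < x := by
    have : ∀ᵐ x ∂ν, x ∈ (Set.Iic l)ᶜ := by
      change ν (Set.Iic l)ᶜᶜ = 0
      rwa [compl_compl]
    exact this.mono fun x hx => not_le.1 hx
  have hid := integrable_id_of_compl_Icc (hQ.compl_Icc hIic)
  have h2 : 0 < ∫ x, (x - l) ∂ν := by
    rw [integral_pos_iff_support_of_nonneg_ae (h1.mono fun x hx => sub_nonneg.2 hx.le)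
      (hid.sub (integrable_const _))]
    have : ν (Function.support fun x => x - l) = ν Set.univ := measure_congr
      (h1.mono fun x hx => propext ⟨fun _ => trivial, fun _ => sub_ne_zero.2 hx.ne'⟩)
    rw [this]
    have h3 : ν.real Set.univ ≠ 0 := by
      rw [hu]
      simpa using hne
    exact pos_iff_ne_zero.2 fun h => h3 (by rw [measureReal_def, h]; rfl)
  rw [integral_sub hid (integrable_const _), integral_const, hu, smul_eq_mul] at h2
  linarith

/-- The definition ties `T` to `Q` only through the quadratic form. For a vector in the range of `Q
l` and one in its kernel, all cross terms of `Q m` vanish, so spectral measures, and with them the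
form of `T`, add up. Testing with the multiples `1` and `I` of the second vector removes the
off-diagonal term. -/
theorem inner_apply_eq_zero (hQ : IsResolutionOfIdentity T Q) {l : ℝ} {φ₁ φ₂ : K}
    (h₁ : Q l φ₁ = φ₁) (h₂ : Q l φ₂ = 0) : ⟪φ₁, T φ₂⟫_ℂ = 0 := by
  have key : ∀ z : ℂ, ⟪φ₁ + z • φ₂, T (φ₁ + z • φ₂)⟫_ℂ = ⟪φ₁, T φ₁⟫_ℂ + ⟪z • φ₂, T (z • φ₂)⟫_ℂ := by
    intro z
    have h₃ : Q l (z • φ₂) = 0 := by rw [map_smul, h₂, smul_zero]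
    generalize z • φ₂ = φ at h₃
    obtain ⟨ν, hν, hI, hint⟩ := hQ.integral (φ₁ + φ)
    obtain ⟨ν₁, hν₁, hI₁, hint₁⟩ := hQ.integral φ₁
    obtain ⟨ν₂, hν₂, hI₂, hint₂⟩ := hQ.integral φ
    have hcross : ∀ m, ⟪φ₁, Q m φ⟫_ℂ = 0 := by
      intro m
      rcases le_total m l with hm | hm
      · have : Q m φ = 0 := by
          rw [← hQ.mono m l hm, mul_apply_eq_comp, h₃, map_zero]
        rw [this, inner_zero_right]
      · have e : Q m φ₁ = φ₁ := by
          have e2 : Q m * Q l = Q l := by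
            have := congrArg star (hQ.mono l m hm)
            rwa [star_mul, (hQ.proj l).isSelfAdjoint.star_eq,
              (hQ.proj m).isSelfAdjoint.star_eq] at this
          rw [← h₁, ← mul_apply_eq_comp, e2]
        rw [inner_apply_of_isSelfAdjoint (hQ.proj m).isSelfAdjoint, e, ← h₁,
          ← inner_apply_of_isSelfAdjoint (hQ.proj l).isSelfAdjoint, h₃, inner_zero_right]
    have hcross' : ∀ m, ⟪φ, Q m φ₁⟫_ℂ = 0 := by
      intro m
      rw [inner_apply_of_isSelfAdjoint (hQ.proj m).isSelfAdjoint, ← inner_conj_symm, hcross,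
        map_zero]
    have hsum : ν = ν₁ + ν₂ := by
      refine measure_ext_of_Iic_real fun m => ?_
      rw [measureReal_add_apply]
      have : (ν.real (Set.Iic m) : ℂ) = ν₁.real (Set.Iic m) + ν₂.real (Set.Iic m) := by
        rw [hI, hI₁, hI₂, map_add, inner_add_left, inner_add_right, inner_add_right, hcross,
          hcross', add_zero, zero_add]
      exact_mod_cast this
    rw [hint, hint₁, hint₂, hsum, integral_add_measure
      (integrable_id_of_compl_Icc (hQ.compl_Icc hI₁))
      (integrable_id_of_compl_Icc (hQ.compl_Icc hI₂)), Complex.ofReal_add]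
  have k1 := key 1
  have k2 := key Complex.I
  simp only [map_add, map_smul, inner_add_left, inner_add_right, inner_smul_left,
    inner_smul_right, one_smul, Complex.conj_I] at k1 k2
  have e1 : ⟪φ₁, T φ₂⟫_ℂ + ⟪φ₂, T φ₁⟫_ℂ = 0 := by linear_combination k1
  have e2 : Complex.I * (⟪φ₁, T φ₂⟫_ℂ - ⟪φ₂, T φ₁⟫_ℂ) = 0 := by linear_combination k2
  rcases mul_eq_zero.1 e2 with h | h
  · exact absurd h Complex.I_ne_zero
  · linear_combination (e1 + h) / 2

/-- By `inner_apply_eq_zero` the range of `Q l` is invariant under `T`, that is `Q T Q = T Q`;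
taking adjoints gives `Q T Q = Q T`. -/
theorem commute (hQ : IsResolutionOfIdentity T Q) (hT : IsSelfAdjoint T) (l : ℝ) :
    Commute T (Q l) := by
  have hi : ∀ x, Q l (Q l x) = Q l x := fun x =>
    DFunLike.congr_fun (hQ.proj l).isIdempotentElem.eq x
  have h : Q l * T * Q l = T * Q l := by
    ext y
    refine ext_inner_left ℂ fun x => ?_
    have h0 : ⟪Q l y, T (x - Q l x)⟫_ℂ = 0 :=
      hQ.inner_apply_eq_zero (hi y) (by rw [map_sub, hi, sub_self])
    rw [inner_apply_of_isSelfAdjoint hT, ← inner_conj_symm, map_eq_zero, inner_sub_left,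
      sub_eq_zero] at h0
    simp only [mul_apply_eq_comp]
    rw [inner_apply_of_isSelfAdjoint (hQ.proj l).isSelfAdjoint, ← h0]
  have h' := congrArg star h
  rw [star_mul, star_mul, star_mul, hT.star_eq, (hQ.proj l).isSelfAdjoint.star_eq, ← mul_assoc,
    h] at h'
  exact h'

/-- Any resolution commutes with `T`, hence with the one constructed by functional calculus. For
commuting resolutions a nonzero vector in the range of one projection and the kernel of the other at
the same `l` would contradict `inner_le` and `lt_inner`; so each projection is dominated by the
other. -/
theorem unique (hQ : IsResolutionOfIdentity T Q) (hT : T.IsPositive) (h1 : ‖T‖ ≤ 1)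
    {Q' : ℝ → K →L[ℂ] K} (hQ' : IsResolutionOfIdentity T Q') : Q' = Q := by
  have aux : ∀ {Q Q' : ℝ → K →L[ℂ] K}, IsResolutionOfIdentity T Q → IsResolutionOfIdentity T Q' →
      ∀ l, Commute (Q l) (Q' l) → Q l * Q' l = Q l := by
    intro Q Q' hQ hQ' l hc
    ext x
    by_contra hne
    have e1 : Q l (Q l x - Q' l (Q l x)) = Q l x - Q' l (Q l x) := by
      have i1 := DFunLike.congr_fun (hQ.proj l).isIdempotentElem.eq x
      have i2 := DFunLike.congr_fun hc.eq (Q l x)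
      simp only [mul_apply_eq_comp] at i1 i2
      rw [map_sub, i2, i1]
    have e2 : Q' l (Q l x - Q' l (Q l x)) = 0 := by
      have i1 := DFunLike.congr_fun (hQ'.proj l).isIdempotentElem.eq (Q l x)
      simp only [mul_apply_eq_comp] at i1
      rw [map_sub, i1, sub_self]
    have e3 : Q l x - Q' l (Q l x) ≠ 0 := by
      intro h
      apply hne
      rw [hc.eq, mul_apply_eq_comp]
      exact (sub_eq_zero.1 h).symm
    exact absurd (hQ.inner_le e1) (not_le.2 (hQ'.lt_inner e2 e3))
  obtain ⟨P, hP, hcomm, -⟩ := exists_isResolutionOfIdentity hT h1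
  have main : ∀ {Q : ℝ → K →L[ℂ] K}, IsResolutionOfIdentity T Q → Q = P := by
    intro Q hQ
    funext l
    have hc : Commute (P l) (Q l) := hcomm _ (hQ.commute hT.isSelfAdjoint l) l
    rw [← aux hQ hP l hc.symm, hc.symm.eq, aux hP hQ l hc]
  rw [main hQ, main hQ']

theorem commute_of_commute (hQ : IsResolutionOfIdentity T Q) (hT : T.IsPositive) (h1 : ‖T‖ ≤ 1)
    {B : K →L[ℂ] K} (hB : Commute T B) (l : ℝ) : Commute (Q l) B := by
  obtain ⟨P, hP, hcomm, -⟩ := exists_isResolutionOfIdentity hT h1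
  rw [hP.unique hT h1 hQ]
  exact hcomm B hB l

theorem notMem_range_re_im {s : ℂ} (hs : s ∉ Complex.ofReal '' Set.Icc 0 1) {l : ℝ}
    (hl : l ∈ Set.Icc (0 : ℝ) 1) : s - l ≠ 0 := fun h =>
  hs ⟨l, hl, (sub_eq_zero.1 h).symm⟩

/-- The spectral measure is tied to the real functional calculus, so `(s - l)⁻¹` is split into its
real and imaginary parts `g` and `g'`, and `g(T) + i g'(T)` is checked to be the inverse of `s - T`.
-/
theorem inner_resolvent (hT : T.IsPositive) (h1 : ‖T‖ ≤ 1) {s : ℂ}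
    (hs : s ∉ Complex.ofReal '' Set.Icc 0 1) {ψ : K} {ν : Measure ℝ} [IsFiniteMeasure ν]
    (hν : ν (Set.Icc 0 1)ᶜ = 0)
    (hint : ∀ f : ℝ → ℝ, ContinuousOn f (Set.Icc 0 1) →
      ⟪ψ, cfc f T ψ⟫_ℂ = ((∫ l, f l ∂ν : ℝ) : ℂ)) :
    ⟪ψ, resolvent T s ψ⟫_ℂ = ∫ l in Set.Icc (0 : ℝ) 1, (s - (l : ℂ))⁻¹ ∂ν := by
  have hsa : IsSelfAdjoint T := hT.isSelfAdjoint
  have hsub := spectrum_real_subset_Icc hT h1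
  let g : ℝ → ℝ := fun l => ((s - (l : ℂ))⁻¹).re
  let g' : ℝ → ℝ := fun l => ((s - (l : ℂ))⁻¹).im
  have hc : ContinuousOn (fun l : ℝ => (s - (l : ℂ))⁻¹) (Set.Icc 0 1) :=
    ContinuousOn.inv₀ (by fun_prop) fun l hl => notMem_range_re_im hs hl
  have hg : ContinuousOn g (Set.Icc 0 1) := Complex.continuous_re.comp_continuousOn hc
  have hg' : ContinuousOn g' (Set.Icc 0 1) := Complex.continuous_im.comp_continuousOn hc
  have hid : ContinuousOn (fun x : ℝ => x) (spectrum ℝ T) := continuousOn_id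
  have hmulT : ∀ f : ℝ → ℝ, ContinuousOn f (Set.Icc 0 1) →
      T * cfc f T = cfc (fun x => x * f x) T := by
    intro f hf
    rw [cfc_mul _ _ T hid (hf.mono hsub), cfc_id' ℝ T]
  -- The real and imaginary parts of `(s - l) (g + i g') = 1`.
  have hk : ∀ l ∈ Set.Icc (0 : ℝ) 1, (s.re - l) * g l - s.im * g' l = 1 ∧
      (s.re - l) * g' l + s.im * g l = 0 := by
    intro l hl
    have h := mul_inv_cancel₀ (notMem_range_re_im hs hl)
    have hr := congrArg Complex.re h
    have hi := congrArg Complex.im h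
    simp only [Complex.mul_re, Complex.mul_im, Complex.sub_re, Complex.sub_im, Complex.ofReal_re,
      Complex.ofReal_im, Complex.one_re, Complex.one_im, sub_zero] at hr hi
    exact ⟨hr, hi⟩
  have hlin : ∀ (a b : ℝ) (f f' : ℝ → ℝ), ContinuousOn f (Set.Icc 0 1) →
      ContinuousOn f' (Set.Icc 0 1) →
      cfc (fun x => (a - x) * f x + b * f' x) T = a • cfc f T - T * cfc f T + b • cfc f' T := by
    intro a b f f' hf hf'
    have e : (fun x => (a - x) * f x + b * f' x) =
        fun x => (a * f x - x * f x) + b * f' x := by funext x; ring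
    have c1 := hf.mono hsub
    have c2 := hf'.mono hsub
    rw [hmulT f hf, e, cfc_add T (fun x => a * f x - x * f x) (fun x => b * f' x)
      ((continuousOn_const.mul c1).sub (hid.mul c1)) (continuousOn_const.mul c2),
      cfc_sub (fun x => a * f x) (fun x => x * f x) T (continuousOn_const.mul c1) (hid.mul c1),
      cfc_const_mul _ _ T c1, cfc_const_mul _ _ T c2]
  have r1 : s.re • cfc g T - T * cfc g T + (-s.im) • cfc g' T = 1 := by
    rw [← hlin _ _ _ _ hg hg', ← cfc_const_one ℝ T]
    refine cfc_congr fun x hx => ?_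
    have := (hk x (hsub hx)).1
    linarith
  have r2 : s.re • cfc g' T - T * cfc g' T + s.im • cfc g T = 0 := by
    rw [← hlin _ _ _ _ hg' hg, ← cfc_const_zero ℝ T]
    exact cfc_congr fun x hx => (hk x (hsub hx)).2
  have hR : (algebraMap ℂ (K →L[ℂ] K) s - T) * (cfc g T + Complex.I • cfc g' T) = 1 := by
    have es : algebraMap ℂ (K →L[ℂ] K) s = (s.re : ℂ) • 1 + (s.im : ℂ) • Complex.I • 1 := by
      rw [Algebra.algebraMap_eq_smul_one, smul_smul, ← add_smul, Complex.re_add_im]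
    have e : (algebraMap ℂ (K →L[ℂ] K) s - T) * (cfc g T + Complex.I • cfc g' T) =
        (s.re • cfc g T - T * cfc g T + (-s.im) • cfc g' T) +
          Complex.I • (s.re • cfc g' T - T * cfc g' T + s.im • cfc g T) := by
      rw [es]
      simp only [sub_mul, add_mul, mul_add, smul_mul_assoc, mul_smul_comm, one_mul, neg_smul,
        smul_add, smul_sub, smul_smul, ← Complex.coe_smul]
      match_scalars <;> ring_nf
      simp [Complex.I_sq]
      ring
    rw [e, r1, r2, smul_zero, add_zero]
  -- Invertibility is already known from the spectrum, so the right inverse `hR` is the inverse.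
  have hunit : IsUnit (algebraMap ℂ (K →L[ℂ] K) s - T) := by
    by_contra hn
    exact hs (spectrumInUnit_of_isPositive hT h1 hn)
  have hres : resolvent T s = cfc g T + Complex.I • cfc g' T := by
    rw [resolvent, ← mul_one (Ring.inverse _), ← hR, ← mul_assoc, Ring.inverse_mul_cancel _ hunit,
      one_mul]
  have hrestr : ν.restrict (Set.Icc 0 1) = ν := Measure.restrict_eq_self_of_ae_mem hν
  have hI : Integrable (fun l : ℝ => (s - (l : ℂ))⁻¹) ν := by
    rw [← hrestr]
    exact hc.integrableOn_compact isCompact_Icc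
  rw [hres, hrestr, add_apply, inner_add_right, smul_apply, inner_smul_right, hint g hg,
    hint g' hg']
  rw [mul_comm]
  exact integral_re_add_im (𝕜 := ℂ) hI

theorem exists_measure (hQ : IsResolutionOfIdentity T Q) (hT : T.IsPositive) (h1 : ‖T‖ ≤ 1)
    (ψ : K) : ∃ ν : Measure ℝ, IsFiniteMeasure ν ∧
      (∀ l, (ν.real (Set.Iic l) : ℂ) = ⟪ψ, Q l ψ⟫_ℂ) ∧
      ∀ s : ℂ, s ∉ Complex.ofReal '' Set.Icc 0 1 →
        ⟪ψ, resolvent T s ψ⟫_ℂ = ∫ l in Set.Icc (0 : ℝ) 1, (s - (l : ℂ))⁻¹ ∂ν := by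
  obtain ⟨P, hP, -, hm⟩ := exists_isResolutionOfIdentity hT h1
  rw [hP.unique hT h1 hQ]
  obtain ⟨ν, hν, h0, hI, hint⟩ := hm ψ
  exact ⟨ν, hν, hI, fun s hs => inner_resolvent hT h1 hs h0 hint⟩

end IsResolutionOfIdentity

end SpectralUniqueness

/-! ### Signed spectral measures, essential self-adjointness, and transport along an isometry. -/

section SpectralApplications

variable {K : Type u} [NormedAddCommGroup K] [InnerProductSpace ℂ K] [CompleteSpace K]
variable {T : K →L[ℂ] K} {Q : ℝ → K →L[ℂ] K}

namespace IsResolutionOfIdentity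

/-- The resolution of the identity of a real operator is real. -/
theorem conj_apply (hQ : IsResolutionOfIdentity T Q) (hT : T.IsPositive) (h1 : ‖T‖ ≤ 1)
    (J : K →L⋆[ℂ] K) (hJJ : ∀ x, J (J x) = x) (hJ : ∀ x y, ⟪J x, J y⟫_ℂ = ⟪y, x⟫_ℂ)
    (hTJ : ∀ x, J (T x) = T (J x)) (l : ℝ) (x : K) : J (Q l x) = Q l (J x) := by
  let P : ℝ → K →L[ℂ] K := fun l => J.comp ((Q l).comp J)
  have hP : ∀ l x, P l x = J (Q l (J x)) := fun _ _ => rfl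
  have hJ' : ∀ x y, ⟪x, J y⟫_ℂ = ⟪y, J x⟫_ℂ := fun x y => by
    rw [← hJJ x, hJ, hJJ]
  -- Conjugating `Q` by the antiunitary involution `J` gives another resolution of the identity of
  -- the same operator; uniqueness then says that it is `Q`.
  have hres : IsResolutionOfIdentity T P := by
    refine ⟨fun l => ⟨?_, isSelfAdjoint_of_inner fun x y => ?_⟩, fun l l' h => ?_, fun l ψ => ?_,
      fun l hl => ?_, fun l hl => ?_, fun ψ => ?_⟩
    · ext x
      simp only [mul_apply_eq_comp, hP, hJJ]
      rw [← mul_apply_eq_comp, (hQ.proj l).isIdempotentElem.eq]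
    · rw [hP, hP, hJ', ← inner_conj_symm, hJ', inner_conj_symm,
        inner_apply_of_isSelfAdjoint (hQ.proj l).isSelfAdjoint]
    · ext x
      simp only [mul_apply_eq_comp, hP, hJJ]
      rw [← mul_apply_eq_comp, hQ.mono l l' h]
    · exact J.continuous.continuousAt.comp_continuousWithinAt (hQ.right_continuous l (J ψ))
    · ext x
      simp [hP, hQ.eq_zero l hl]
    · ext x
      simp [hP, hQ.eq_one l hl, hJJ]
    · obtain ⟨ν, hν, hI, hint⟩ := hQ.integral (J ψ)
      refine ⟨ν, hν, fun l => ?_, ?_⟩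
      · rw [hI, hP, hJ', inner_apply_of_isSelfAdjoint (hQ.proj l).isSelfAdjoint]
      · rw [← hint, ← hTJ, hJ, inner_apply_of_isSelfAdjoint hT.isSelfAdjoint]
  have h := DFunLike.congr_fun (congrFun (hQ.unique hT h1 hres) l) (J x)
  rw [hP, hJJ] at h
  exact h

/-- This is why the off-diagonal spectral measures of the medium are signed and not merely complex:
the vectors `χ i e_j` are real. -/
theorem inner_im_eq_zero (hQ : IsResolutionOfIdentity T Q) (hT : T.IsPositive) (h1 : ‖T‖ ≤ 1)
    (J : K →L⋆[ℂ] K) (hJJ : ∀ x, J (J x) = x) (hJ : ∀ x y, ⟪J x, J y⟫_ℂ = ⟪y, x⟫_ℂ)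
    (hTJ : ∀ x, J (T x) = T (J x)) {x y : K} (hx : J x = x) (hy : J y = y) (l : ℝ) :
    (⟪y, Q l x⟫_ℂ).im = 0 := by
  have h := hJ y (Q l x)
  rw [hQ.conj_apply hT h1 J hJJ hJ hTJ, hx, hy, ← inner_conj_symm (Q l x)] at h
  exact Complex.conj_eq_iff_im.1 h.symm

open scoped MeasureTheory.VectorMeasure in
-- Polarization: `μ` is the spectral measure of `(x + y) / 2` minus that of `(x - y) / 2`. For `x =
-- y` the second one is zero, so `μ` is positive.
theorem exists_signedMeasure (hQ : IsResolutionOfIdentity T Q) (hT : T.IsPositive) (h1 : ‖T‖ ≤ 1)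
    {x y : K} (hreal : ∀ l, (⟪y, Q l x⟫_ℂ).im = 0) :
    ∃ μ : SignedMeasure ℝ, (∀ l, ((μ (Set.Iic l) : ℝ) : ℂ) = ⟪y, Q l x⟫_ℂ) ∧
      (x = y → ∀ B, 0 ≤ μ B) ∧
      ∀ s : ℂ, s ∉ Complex.ofReal '' Set.Icc 0 1 →
        ⟪y, resolvent T s x⟫_ℂ = ∫ᵛ l in Set.Icc (0 : ℝ) 1, (s - (l : ℂ))⁻¹ ∂<•μ := by
  obtain ⟨ν₁, hν₁, hI₁, hs₁⟩ := hQ.exists_measure hT h1 ((1 / 2 : ℂ) • (x + y))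
  obtain ⟨ν₂, hν₂, hI₂, hs₂⟩ := hQ.exists_measure hT h1 ((1 / 2 : ℂ) • (x - y))
  obtain ⟨ν₃, hν₃, hI₃, hs₃⟩ := hQ.exists_measure hT h1 ((1 / 2 : ℂ) • (x + Complex.I • y))
  obtain ⟨ν₄, hν₄, hI₄, hs₄⟩ := hQ.exists_measure hT h1 ((1 / 2 : ℂ) • (x - Complex.I • y))
  have hsymm : ∀ l, ⟪x, Q l y⟫_ℂ = ⟪y, Q l x⟫_ℂ := fun l => by
    rw [inner_apply_of_isSelfAdjoint (hQ.proj l).isSelfAdjoint, ← inner_conj_symm]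
    exact Complex.conj_eq_iff_im.2 (hreal l)
  have pol : ∀ A : K →L[ℂ] K, ⟪(1 / 2 : ℂ) • (x + y), A ((1 / 2 : ℂ) • (x + y))⟫_ℂ -
      ⟪(1 / 2 : ℂ) • (x - y), A ((1 / 2 : ℂ) • (x - y))⟫_ℂ =
      (⟪x, A y⟫_ℂ + ⟪y, A x⟫_ℂ) / 2 := by
    intro A
    simp only [map_smul, map_add, map_sub, inner_smul_left, inner_smul_right, inner_add_left,
      inner_add_right, inner_sub_left, inner_sub_right]
    simp only [map_div₀, map_one, map_ofNat]
    ring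
  have pol' : ∀ A : K →L[ℂ] K,
      ⟪(1 / 2 : ℂ) • (x + Complex.I • y), A ((1 / 2 : ℂ) • (x + Complex.I • y))⟫_ℂ -
      ⟪(1 / 2 : ℂ) • (x - Complex.I • y), A ((1 / 2 : ℂ) • (x - Complex.I • y))⟫_ℂ =
      Complex.I * (⟪x, A y⟫_ℂ - ⟪y, A x⟫_ℂ) / 2 := by
    intro A
    simp only [map_smul, map_add, map_sub, inner_smul_left, inner_smul_right, inner_add_left,
      inner_add_right, inner_sub_left, inner_sub_right]
    simp only [map_div₀, map_one, map_ofNat, Complex.conj_I]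
    ring
  -- Reality of the matrix elements makes the imaginary half of the polarization vanish. It is
  -- needed again for the resolvent, where it gives the symmetry `⟨x, R y⟩ = ⟨y, R x⟩`.
  have h34 : ν₃ = ν₄ := by
    refine measure_ext_of_Iic_real fun l => ?_
    have h := pol' (Q l)
    rw [← hI₃, ← hI₄, hsymm, sub_self, mul_zero, zero_div, sub_eq_zero] at h
    exact_mod_cast h
  have hI12 : ∀ l, ((ν₁.real (Set.Iic l) - ν₂.real (Set.Iic l) : ℝ) : ℂ) = ⟪y, Q l x⟫_ℂ := by
    intro l
    have h := pol (Q l)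
    rw [← hI₁, ← hI₂, hsymm] at h
    rw [Complex.ofReal_sub, h]
    ring
  refine ⟨ν₁.toSignedMeasure - ν₂.toSignedMeasure, fun l => ?_, ?_, fun s hs => ?_⟩
  · rw [← hI12, Measure.toSignedMeasure_sub_apply measurableSet_Iic]
  · rintro rfl B
    by_cases hB : MeasurableSet B
    · rw [Measure.toSignedMeasure_sub_apply hB]
      have h := hQ.real_univ hI₂
      rw [sub_self, smul_zero, norm_zero] at h
      have h2 : ν₂.real B ≤ 0 := (measureReal_mono (Set.subset_univ B)).trans (by simpa using h.le)
      linarith [measureReal_nonneg (μ := ν₁) (s := B)]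
    · rw [VectorMeasure.not_measurable _ hB]
  · have hc : ContinuousOn (fun l : ℝ => (s - (l : ℂ))⁻¹) (Set.Icc 0 1) :=
      ContinuousOn.inv₀ (by fun_prop) fun l hl => notMem_range_re_im hs hl
    have hint : ∀ (ν : Measure ℝ) [IsFiniteMeasure ν],
        VectorMeasure.Integrable (ν.toSignedMeasure.restrict (Set.Icc 0 1))
          (fun l : ℝ => (s - (l : ℂ))⁻¹) := by
      intro ν _
      rw [VectorMeasure.restrict_toSignedMeasure measurableSet_Icc, VectorMeasure.Integrable,
        Measure.variation_toSignedMeasure]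
      exact hc.integrableOn_compact isCompact_Icc
    have hrs : (ν₁.toSignedMeasure - ν₂.toSignedMeasure).restrict (Set.Icc 0 1) =
        ν₁.toSignedMeasure.restrict (Set.Icc 0 1) - ν₂.toSignedMeasure.restrict (Set.Icc 0 1) := by
      ext B hB
      simp [VectorMeasure.restrict_apply, hB]
    rw [hrs, VectorMeasure.integral_sub_vectorMeasure (hint ν₁) (hint ν₂)]
    rw [VectorMeasure.setIntegral_toSignedMeasure measurableSet_Icc,
      VectorMeasure.setIntegral_toSignedMeasure measurableSet_Icc, ← hs₁ s hs, ← hs₂ s hs, pol]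
    have h := pol' (resolvent T s)
    rw [hs₃ s hs, hs₄ s hs, h34, sub_self] at h
    have h2 : ⟪x, resolvent T s y⟫_ℂ - ⟪y, resolvent T s x⟫_ℂ = 0 := by
      have h3 : Complex.I * (⟪x, resolvent T s y⟫_ℂ - ⟪y, resolvent T s x⟫_ℂ) = 0 := by
        linear_combination -2 * h
      exact (mul_eq_zero.1 h3).resolve_left Complex.I_ne_zero
    linear_combination -h2 / 2

end IsResolutionOfIdentity

/-- A bounded self-adjoint operator which maps `S` into its closure is essentially self-adjoint
on `S`. -/
theorem essSelfAdjointOn_of_isSelfAdjoint {S : Submodule ℂ K} {A : K →L[ℂ] K}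
    (hA : IsSelfAdjoint A) (hS : ∀ x ∈ S, A x ∈ S.topologicalClosure) : EssSelfAdjointOn S A := by
  have hA' : ∀ x ∈ S.topologicalClosure, A x ∈ S.topologicalClosure := by
    intro x hx
    have : A x ∈ closure (S.topologicalClosure : Set K) :=
      map_mem_closure A.continuous hx fun y hy => hS y hy
    rwa [S.isClosed_topologicalClosure.closure_eq] at this
  refine ⟨hA', ?_⟩
  set E := S.topologicalClosure with hE
  have : CompleteSpace E := S.isClosed_topologicalClosure.completeSpace_coe
  let B : E →L[ℂ] E := (A.comp E.subtypeL).codRestrict E fun x => hA' x x.2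
  have hB : B.adjoint = B := by
    refine ContinuousLinearMap.isSelfAdjoint_iff'.1 (isSelfAdjoint_of_inner fun x y => ?_)
    exact (inner_apply_of_isSelfAdjoint hA (x : K) (y : K)).symm
  let p : Submodule ℂ E := S.comap E.subtype
  have hp : Dense (p : Set E) := by
    intro x
    rw [closure_subtype]
    have : Subtype.val '' (p : Set E) = (S : Set K) := by
      ext y
      exact ⟨by rintro ⟨z, hz, rfl⟩; exact hz, fun hy => ⟨⟨y, S.le_topologicalClosure hy⟩, hy, rfl⟩⟩
    rw [this]
    exact x.2
  -- Since `B` is continuous and `p` is dense in `E`, the closure of the graph over `p` is the graph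
  -- of `B` on all of `E`, where `B` is bounded and self-adjoint.
  have hgraph : ((B : E →ₗ[ℂ] E).toPMap p).graph.topologicalClosure =
      ((B : E →ₗ[ℂ] E).toPMap ⊤).graph := by
    apply SetLike.coe_injective
    rw [Submodule.topologicalClosure_coe]
    have e1 : (((B : E →ₗ[ℂ] E).toPMap ⊤).graph : Set (E × E)) = {z | z.2 = B z.1} := by
      ext z
      simp only [SetLike.mem_coe, LinearPMap.mem_graph_iff, Set.mem_ofPred_eq]
      exact ⟨by rintro ⟨y, h1, h2⟩; rw [← h1, ← h2]; rfl,
        fun h => ⟨⟨z.1, trivial⟩, rfl, h.symm⟩⟩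
    have e2 : (((B : E →ₗ[ℂ] E).toPMap p).graph : Set (E × E)) = (fun x => (x, B x)) '' p := by
      ext z
      simp only [SetLike.mem_coe, LinearPMap.mem_graph_iff, Set.mem_image]
      exact ⟨by rintro ⟨y, h1, h2⟩; exact ⟨y, y.2, Prod.ext h1 h2⟩,
        by rintro ⟨y, hy, rfl⟩; exact ⟨⟨y, hy⟩, rfl, rfl⟩⟩
    rw [e1, e2]
    apply subset_antisymm
    · refine closure_minimal ?_ (isClosed_eq continuous_snd (B.continuous.comp continuous_fst))
      rintro _ ⟨x, -, rfl⟩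
      rfl
    · intro z hz
      have : z = (fun x => (x, B x)) z.1 := Prod.ext rfl hz
      rw [this]
      exact map_mem_closure (f := fun x => (x, B x)) (by fun_prop) (hp z.1)
        (fun x hx => ⟨x, hx, rfl⟩)
  have hcl : ((B : E →ₗ[ℂ] E).toPMap p).closure = (B : E →ₗ[ℂ] E).toPMap ⊤ := by
    have h : ((B : E →ₗ[ℂ] E).toPMap p).IsClosable := ⟨_, hgraph⟩
    exact LinearPMap.eq_of_eq_graph (h.graph_closure_eq_closure_graph.symm.trans hgraph)
  change IsSelfAdjoint ((B : E →ₗ[ℂ] E).toPMap p).closure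
  rw [hcl, LinearPMap.isSelfAdjoint_def,
    ContinuousLinearMap.toPMap_adjoint_eq_adjoint_toPMap_of_dense B (by simp), hB]

theorem norm_le_one_of_isStarProjection {A : K →L[ℂ] K} (hA : IsStarProjection A) : ‖A‖ ≤ 1 := by
  refine A.opNorm_le_bound zero_le_one fun x => ?_
  have h := inner_apply_of_isStarProjection hA x
  have h2 : ‖A x‖ ^ 2 ≤ ‖x‖ * ‖A x‖ := by
    have h3 := norm_inner_le_norm (𝕜 := ℂ) x (A x)
    rw [h, Complex.norm_real, Real.norm_of_nonneg (by positivity)] at h3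
    exact h3
  rw [one_mul]
  by_contra hc
  have hlt := not_le.1 hc
  nlinarith [norm_nonneg x, norm_nonneg (A x)]

section Transport

variable {H : Type u} [NormedAddCommGroup H] [InnerProductSpace ℂ H] [CompleteSpace H]

/-- A positive contraction pulled back along an isometry. -/
def pullback (X : K →ₗᵢ[ℂ] H) (A : H →L[ℂ] H) : K →L[ℂ] K :=
  X.toContinuousLinearMap.adjoint ∘L A ∘L X.toContinuousLinearMap

theorem inner_pullback (X : K →ₗᵢ[ℂ] H) (A : H →L[ℂ] H) (x y : K) :
    ⟪x, pullback X A y⟫_ℂ = ⟪X x, A (X y)⟫_ℂ :=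
  ContinuousLinearMap.adjoint_inner_right X.toContinuousLinearMap x (A (X y))

theorem pullback_isSelfAdjoint (X : K →ₗᵢ[ℂ] H) {A : H →L[ℂ] H} (hA : IsSelfAdjoint A) :
    IsSelfAdjoint (pullback X A) := isSelfAdjoint_of_inner fun x y => by
  rw [← inner_conj_symm, inner_pullback, inner_pullback, inner_conj_symm,
    inner_apply_of_isSelfAdjoint hA]

theorem pullback_isPositive (X : K →ₗᵢ[ℂ] H) {A : H →L[ℂ] H} (hA : A.IsPositive) :
    (pullback X A).IsPositive := by
  have hsa := pullback_isSelfAdjoint X hA.isSelfAdjoint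
  refine ⟨hsa.isSymmetric, fun x => ?_⟩
  rw [ContinuousLinearMap.reApplyInnerSelf_apply,
    ← inner_apply_of_isSelfAdjoint hsa, inner_pullback]
  exact (Complex.le_def.1 (hA.inner_nonneg_right (X x))).1

theorem norm_pullback_le (X : K →ₗᵢ[ℂ] H) {A : H →L[ℂ] H} (hA : ‖A‖ ≤ 1) :
    ‖pullback X A‖ ≤ 1 := by
  refine ContinuousLinearMap.opNorm_le_bound _ zero_le_one fun x => ?_
  have h1 : ‖X.toContinuousLinearMap.adjoint‖ ≤ 1 := by
    rw [LinearIsometryEquiv.norm_map]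
    exact X.norm_toContinuousLinearMap_le
  calc ‖pullback X A x‖ ≤ 1 * ‖A (X x)‖ := ContinuousLinearMap.le_of_opNorm_le _ h1 _
    _ ≤ 1 * (1 * ‖X x‖) := by gcongr; exact A.le_of_opNorm_le hA _
    _ = 1 * ‖x‖ := by rw [X.norm_map, one_mul]

/-- The adjoint of an isometry inverts it on its range, so on an invariant range the pullback is a
genuine conjugate of `A`, not just a compression. -/
theorem apply_pullback (X : K →ₗᵢ[ℂ] H) {A : H →L[ℂ] H} (hA : ∀ x, A (X x) ∈ Set.range X)
    (x : K) : X (pullback X A x) = A (X x) := by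
  obtain ⟨y, hy⟩ := hA x
  have : pullback X A x = y := by
    refine ext_inner_left ℂ fun z => ?_
    rw [inner_pullback, ← hy, X.inner_map_map]
  rw [this, hy]

theorem IsResolutionOfIdentity.pullback {A : H →L[ℂ] H} {Q : ℝ → H →L[ℂ] H}
    (hQ : IsResolutionOfIdentity A Q) (hA : A.IsPositive) (h1 : ‖A‖ ≤ 1) (X : K →ₗᵢ[ℂ] H)
    (hX : ∀ x, A (X x) ∈ Set.range X) :
    IsResolutionOfIdentity (pullback X A) (fun l => TwoComponent.pullback X (Q l)) ∧
      ∀ l x, Q l (X x) ∈ Set.range X := by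
  have hXX : ∀ x, X.toContinuousLinearMap.adjoint (X x) = x := fun x =>
    ext_inner_left ℂ fun z => by
      rw [ContinuousLinearMap.adjoint_inner_right]
      exact X.inner_map_map z x
  -- `R = X X*` is the projection onto the range of `X`. Invariance of this range under the
  -- self-adjoint `A` means that `R` commutes with `A`, hence with every `Q l`, so the range is
  -- invariant under `Q l` too.
  let R : H →L[ℂ] H := X.toContinuousLinearMap ∘L X.toContinuousLinearMap.adjoint
  have hR : IsSelfAdjoint R := isSelfAdjoint_of_inner fun x y =>
    (ContinuousLinearMap.adjoint_inner_right X.toContinuousLinearMap _ y).symm.trans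
      (ContinuousLinearMap.adjoint_inner_left X.toContinuousLinearMap _ x)
  have e1 : R * A * R = A * R := by
    ext x
    obtain ⟨y, hy⟩ := hX (X.toContinuousLinearMap.adjoint x)
    change X (X.toContinuousLinearMap.adjoint (A (X (X.toContinuousLinearMap.adjoint x)))) =
      A (X (X.toContinuousLinearMap.adjoint x))
    rw [← hy, hXX]
  have hc : Commute A R := by
    have h := congrArg star e1
    rw [star_mul, star_mul, star_mul, hR.star_eq, hA.isSelfAdjoint.star_eq, ← mul_assoc, e1] at h
    exact h
  have hQR : ∀ l x, Q l (X x) ∈ Set.range X := by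
    intro l x
    have h := DFunLike.congr_fun (hQ.commute_of_commute hA h1 hc l).eq (X x)
    have e : R (X x) = X x := congrArg X (hXX x)
    rw [mul_apply_eq_comp, mul_apply_eq_comp, e] at h
    exact ⟨_, h.symm⟩
  have hap : ∀ l x, X (TwoComponent.pullback X (Q l) x) = Q l (X x) := fun l x =>
    apply_pullback X (hQR l) x
  refine ⟨⟨fun l => ⟨?_, pullback_isSelfAdjoint X (hQ.proj l).isSelfAdjoint⟩, fun l l' h => ?_,
    fun l ψ => ?_, fun l hl => ?_, fun l hl => ?_, fun ψ => ?_⟩, hQR⟩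
  · ext x
    refine X.injective ?_
    rw [mul_apply_eq_comp, hap, hap, ← mul_apply_eq_comp, (hQ.proj l).isIdempotentElem.eq]
  · ext x
    refine X.injective ?_
    rw [mul_apply_eq_comp, hap, hap, hap, ← mul_apply_eq_comp, hQ.mono l l' h]
  · exact X.toContinuousLinearMap.adjoint.continuous.continuousAt.comp_continuousWithinAt
      (hQ.right_continuous l (X ψ))
  · ext x
    refine X.injective ?_
    rw [hap, hQ.eq_zero l hl]
    simp
  · ext x
    refine X.injective ?_
    rw [hap, hQ.eq_one l hl]
    rfl
  · obtain ⟨ν, hν, hI, hint⟩ := hQ.integral (X ψ)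
    exact ⟨ν, hν, fun l => by rw [inner_pullback]; exact hI l, by rw [inner_pullback]; exact hint⟩

end Transport

end SpectralApplications

open scoped Convolution

/-! ### The translation group, its generators, and ergodicity. -/

section Translations

variable {Ω : Type u} [MeasurableSpace Ω] {P : Measure Ω} [IsProbabilityMeasure P]
variable {d : ℕ} [AddAction (Fin d → ℝ) Ω] [MeasurableConstVAdd (Fin d → ℝ) Ω]

section Invariant

variable [VAddInvariantMeasure (Fin d → ℝ) Ω P]

theorem compMeasurePreserving_congr {g g' : Ω → Ω} (h : g = g') (hg : MeasurePreserving g P P)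
    (hg' : MeasurePreserving g' P P) (f : ScalarField P) :
    Lp.compMeasurePreserving g hg f = Lp.compMeasurePreserving g' hg' f := by
  subst h
  rfl

theorem translate_add (x y : Fin d → ℝ) (f : ScalarField P) :
    translate P d (x + y) f = translate P d x (translate P d y f) := by
  have h := Lp.compMeasurePreserving_comp_apply (p := 2) (E := ℂ) f
    (measurePreserving_vadd (-y) P) (measurePreserving_vadd (-x) P)
  refine (compMeasurePreserving_congr ?_ _ _ f).trans h
  funext ω
  simp [vadd_vadd, add_comm]

theorem translate_zero (f : ScalarField P) : translate P d 0 f = f := by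
  refine (compMeasurePreserving_congr ?_ _ (.id P) f).trans (Lp.compMeasurePreserving_id_apply f)
  funext ω
  simp

theorem translate_neg_translate (x : Fin d → ℝ) (f : ScalarField P) :
    translate P d (-x) (translate P d x f) = f := by
  rw [← translate_add, neg_add_cancel, translate_zero]

theorem translate_comm (x y : Fin d → ℝ) (f : ScalarField P) :
    translate P d x (translate P d y f) = translate P d y (translate P d x f) := by
  rw [← translate_add, add_comm, translate_add]

theorem inner_translate_left (x : Fin d → ℝ) (f g : ScalarField P) :
    ⟪translate P d x f, g⟫_ℂ = ⟪f, translate P d (-x) g⟫_ℂ := by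
  rw [← (translate P d (-x)).inner_map_map, translate_neg_translate]

theorem mean_eq_inner (f : ScalarField P) : mean P f = ⟪Lp.const 2 P (1 : ℂ), f⟫_ℂ := by
  rw [L2.inner_def]
  refine integral_congr_ae ?_
  filter_upwards [Lp.coeFn_const (p := 2) (μ := P) (1 : ℂ)] with ω h
  rw [h]
  simp

theorem const_eq_smul (a : ℂ) : (Lp.const 2 P a : ScalarField P) = a • Lp.const 2 P 1 := by
  have h := (Lp.constₗ (p := 2) P ℂ (E := ℂ)).map_smul a 1
  simpa using h

theorem mean_const (a : ℂ) : mean P (Lp.const 2 P a) = a := by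
  have : mean P (Lp.const 2 P a) = ∫ _, a ∂P :=
    integral_congr_ae (Lp.coeFn_const (p := 2) (μ := P) a)
  rw [this]
  simp

/-- Operators commuting with all translations. -/
def Stationary (d : ℕ) [AddAction (Fin d → ℝ) Ω] [MeasurableConstVAdd (Fin d → ℝ) Ω]
    [VAddInvariantMeasure (Fin d → ℝ) Ω P] (B : ScalarField P →L[ℂ] ScalarField P) : Prop :=
  ∀ x f, B (translate P d x f) = translate P d x (B f)

theorem stationary_translate (x : Fin d → ℝ) :
    Stationary d (translate P d x).toContinuousLinearMap := fun y f => translate_comm x y f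

theorem Stationary.adjoint {B : ScalarField P →L[ℂ] ScalarField P} (hB : Stationary d B) :
    Stationary d B.adjoint := by
  intro x f
  refine ext_inner_left ℂ fun g => ?_
  have h := inner_translate_left (-x) g (B.adjoint f)
  rw [neg_neg] at h
  rw [← h, ContinuousLinearMap.adjoint_inner_right, ContinuousLinearMap.adjoint_inner_right, hB,
    inner_translate_left, neg_neg]

theorem hasDerivAt_translate {f : ScalarField P} (hf : f ∈ D1 P d) (i : Fin d) :
    HasDerivAt (fun t : ℝ => translate P d (Pi.single i t) f) (L P d i f) 0 :=
  (hf i).hasDerivAt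

theorem hasDerivAt_translate_at {f : ScalarField P} (hf : f ∈ D1 P d) (i : Fin d) (s : ℝ) :
    HasDerivAt (fun t : ℝ => translate P d (Pi.single i t) f)
      (translate P d (Pi.single i s) (L P d i f)) s := by
  have h := hasDerivAt_translate hf i
  have h2 : HasDerivAt (fun t : ℝ => translate P d (Pi.single i (t - s)) f) (L P d i f) s :=
    HasDerivAt.comp_sub_const s s (by rwa [sub_self])
  have h3 := ((translate P d (Pi.single i s)).toContinuousLinearMap.restrictScalars
    ℝ).hasFDerivAt.comp_hasDerivAt s h2
  refine h3.congr_of_eventuallyEq (Eventually.of_forall fun t => ?_)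
  change translate P d (Pi.single i t) f = translate P d (Pi.single i s) (translate P d _ f)
  rw [← translate_add, ← Pi.single_add, add_sub_cancel]

theorem Stationary.hasDerivAt {B : ScalarField P →L[ℂ] ScalarField P} (hB : Stationary d B)
    {f : ScalarField P} (hf : f ∈ D1 P d) (i : Fin d) :
    HasDerivAt (fun t : ℝ => translate P d (Pi.single i t) (B f)) (B (L P d i f)) 0 := by
  have h3 := (B.restrictScalars ℝ).hasFDerivAt.comp_hasDerivAt 0 (hasDerivAt_translate hf i)
  refine h3.congr_of_eventuallyEq (Eventually.of_forall fun t => ?_)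
  exact (hB _ _).symm

theorem Stationary.mem_D1 {B : ScalarField P →L[ℂ] ScalarField P} (hB : Stationary d B)
    {f : ScalarField P} (hf : f ∈ D1 P d) : B f ∈ D1 P d :=
  fun i => (hB.hasDerivAt hf i).differentiableAt

theorem Stationary.L_apply {B : ScalarField P →L[ℂ] ScalarField P} (hB : Stationary d B)
    {f : ScalarField P} (hf : f ∈ D1 P d) (i : Fin d) : L P d i (B f) = B (L P d i f) :=
  (hB.hasDerivAt hf i).deriv

/-- The function `⟨T_t f, T_t g⟩` is constant because translations are isometric; its derivative at
`0` is the claim. -/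
theorem inner_L {f g : ScalarField P} (hf : f ∈ D1 P d) (hg : g ∈ D1 P d) (i : Fin d) :
    ⟪L P d i f, g⟫_ℂ = -⟪f, L P d i g⟫_ℂ := by
  have h := (hasDerivAt_translate hf i).inner ℂ (hasDerivAt_translate hg i)
  simp only [Pi.single_zero, translate_zero, LinearIsometry.inner_map_map] at h
  have h2 := h.unique (hasDerivAt_const 0 _)
  linear_combination h2

theorem L_zero (i : Fin d) : L P d i (0 : ScalarField P) = 0 := by simp [L]

theorem L_neg {f : ScalarField P} (hf : f ∈ D1 P d) (i : Fin d) :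
    L P d i (-f) = -L P d i f := by
  rw [← neg_one_smul ℂ f, L_smul P d hf, neg_one_smul]

theorem L_sub {f g : ScalarField P} (hf : f ∈ D1 P d) (hg : g ∈ D1 P d) (i : Fin d) :
    L P d i (f - g) = L P d i f - L P d i g := by
  rw [sub_eq_add_neg, L_add P d hf (neg_mem hg), L_neg hg, sub_eq_add_neg]

theorem L_sum {ι : Type*} (s : Finset ι) {f : ι → ScalarField P} (hf : ∀ k, f k ∈ D1 P d)
    (i : Fin d) : L P d i (∑ k ∈ s, f k) = ∑ k ∈ s, L P d i (f k) := by
  classical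
  induction s using Finset.induction_on with
  | empty => simp [L_zero]
  | insert a s ha ih =>
    rw [Finset.sum_insert ha, Finset.sum_insert ha, L_add P d (hf a) (sum_mem fun k _ => hf k), ih]

theorem const_mem_D1 (a : ℂ) : (Lp.const 2 P a : ScalarField P) ∈ D1 P d := fun i => by
  simp only [translate_const]
  exact differentiableAt_const _

theorem L_const (a : ℂ) (i : Fin d) : L P d i (Lp.const 2 P a : ScalarField P) = 0 := by
  simp only [L, translate_const]
  exact deriv_const _ _

theorem mean_translate (x : Fin d → ℝ) (f : ScalarField P) :
    mean P (translate P d x f) = mean P f := by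
  rw [mean_eq_inner, mean_eq_inner, ← inner_conj_symm, inner_translate_left, translate_const,
    inner_conj_symm]

theorem mean_L {f : ScalarField P} (hf : f ∈ D1 P d) (i : Fin d) : mean P (L P d i f) = 0 := by
  rw [mean_eq_inner, ← neg_eq_zero, ← inner_L (const_mem_D1 1) hf, L_const, inner_zero_left]

/-- Along each axis the orbit has derivative `T_s (L i f) = 0`, and any `x` is reached by moving
along the axes one after another. -/
theorem translate_eq_self_of_L_eq_zero {f : ScalarField P} (hf : f ∈ D1 P d)
    (h : ∀ i, L P d i f = 0) (x : Fin d → ℝ) : translate P d x f = f := by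
  have h1 : ∀ (i : Fin d) (t : ℝ), translate P d (Pi.single i t) f = f := by
    intro i t
    have hd : ∀ s, HasDerivAt (fun t : ℝ => translate P d (Pi.single i t) f) 0 s := fun s => by
      have := hasDerivAt_translate_at hf i s
      rwa [h i, map_zero] at this
    have := is_const_of_deriv_eq_zero (fun s => (hd s).differentiableAt) (fun s => (hd s).deriv) t 0
    rwa [Pi.single_zero, translate_zero] at this
  rw [← Finset.univ_sum_single x]
  generalize (Finset.univ : Finset (Fin d)) = s
  induction s using Finset.induction_on with
  | empty => rw [Finset.sum_empty, translate_zero]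
  | insert a s ha ih => rw [Finset.sum_insert ha, translate_add, ih, h1]

end Invariant

section Ergodic

variable [ErgodicVAdd (Fin d → ℝ) Ω P]

/-- Preimages of measurable sets under an invariant `f` are almost invariant, so by ergodicity they
are null or conull; since measurable sets of `ℂ` are countably separated, `f` is almost everywhere
constant. -/
theorem exists_eq_const {f : ScalarField P} (h : ∀ x, translate P d x f = f) :
    f = Lp.const 2 P (mean P f) := by
  have hc : ∃ c, (f : Ω → ℂ) =ᵐ[P] Function.const Ω c := by
    refine exists_eventuallyEq_const_of_forall_separating MeasurableSet fun U hU => ?_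
    have hm : MeasurableSet ((f : Ω → ℂ) ⁻¹' U) := (Lp.stronglyMeasurable f).measurable hU
    refine eventuallyConst_set.1 (aeconst_of_forall_preimage_vadd_ae_eq (Fin d → ℝ) (μ := P)
      hm.nullMeasurableSet (fun g => ?_))
    have h1 := Lp.coeFn_compMeasurePreserving f (measurePreserving_vadd (-(-g)) P)
    have h2 : Lp.compMeasurePreserving _ (measurePreserving_vadd (-(-g)) P) f = f := h (-g)
    rw [h2, neg_neg] at h1
    filter_upwards [h1] with ω hω
    apply propext
    change f (g +ᵥ ω) ∈ U ↔ f ω ∈ U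
    rw [hω]
    rfl
  obtain ⟨c, hc⟩ := hc
  have h2 : f = Lp.const 2 P c := Lp.ext (hc.trans (Lp.coeFn_const (p := 2) (μ := P) c).symm)
  rw [h2, mean_const]

end Ergodic

end Translations

open scoped Convolution

/-! ### Smooth vectors and mollification along the group. -/

section Mollification

variable {Ω : Type u} [MeasurableSpace Ω] {P : Measure Ω} [IsProbabilityMeasure P]
variable {d : ℕ} [AddAction (Fin d → ℝ) Ω] [MeasurableConstVAdd (Fin d → ℝ) Ω]
variable [VAddInvariantMeasure (Fin d → ℝ) Ω P]

variable (P d) in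
/-- The smooth vectors of the translation group. -/
def smooth : Submodule ℂ (ScalarField P) where
  carrier := {f | ContDiff ℝ ((⊤ : ℕ∞) : WithTop ℕ∞) fun x : Fin d → ℝ => translate P d x f}
  add_mem' h h' := by
    simp only [Set.mem_ofPred_eq, map_add]
    exact ContDiff.add h h'
  zero_mem' := by
    simp only [Set.mem_ofPred_eq, map_zero]
    exact contDiff_const
  smul_mem' a f h := by
    simp only [Set.mem_ofPred_eq, map_smul]
    exact ContDiff.const_smul a h

theorem hasDerivAt_single (i : Fin d) (t : ℝ) :
    HasDerivAt (fun t : ℝ => (Pi.single i t : Fin d → ℝ)) (Pi.single i 1) t := by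
  have h := (ContinuousLinearMap.single ℝ (fun _ : Fin d => ℝ) i).hasDerivAt (x := t)
  simpa using h

theorem smooth.hasDerivAt {f : ScalarField P} (hf : f ∈ smooth P d) (i : Fin d) :
    HasDerivAt (fun t : ℝ => translate P d (Pi.single i t) f)
      (fderiv ℝ (fun x : Fin d → ℝ => translate P d x f) 0 (Pi.single i 1)) 0 := by
  have hf' : ContDiff ℝ ((⊤ : ℕ∞) : WithTop ℕ∞) fun x : Fin d → ℝ => translate P d x f := hf
  have h1 := (hf'.differentiable (by simp)).differentiableAt (x := 0) |>.hasFDerivAt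
  have h2 := hasDerivAt_single i (0 : ℝ)
  refine HasFDerivAt.comp_hasDerivAt (0 : ℝ) (l := fun x : Fin d → ℝ => translate P d x f)
    (f := fun t : ℝ => (Pi.single i t : Fin d → ℝ)) ?_ h2
  rwa [Pi.single_zero]

theorem smooth.mem_D1 {f : ScalarField P} (hf : f ∈ smooth P d) : f ∈ D1 P d :=
  fun i => (smooth.hasDerivAt hf i).differentiableAt

/-- By the group law the orbit of `L i f` is the `i`-th partial derivative of the orbit of `f`.
Smoothness of `L i f` and commutation of the generators thus become calculus on `ℝ^d`. -/
theorem smooth.translate_L {f : ScalarField P} (hf : f ∈ smooth P d) (i : Fin d)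
    (x : Fin d → ℝ) : translate P d x (L P d i f) =
      fderiv ℝ (fun x : Fin d → ℝ => translate P d x f) x (Pi.single i 1) := by
  have hf' : ContDiff ℝ ((⊤ : ℕ∞) : WithTop ℕ∞) fun x : Fin d → ℝ => translate P d x f := hf
  have h1 := ((hf'.differentiable (by simp)).differentiableAt (x := x)).hasFDerivAt
  have h2 : HasDerivAt (fun t : ℝ => x + (Pi.single i t : Fin d → ℝ)) (Pi.single i 1) 0 :=
    (hasDerivAt_single i (0 : ℝ)).const_add x
  have h3 : HasDerivAt (fun t : ℝ => translate P d (x + Pi.single i t) f)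
      (fderiv ℝ (fun x : Fin d → ℝ => translate P d x f) x (Pi.single i 1)) 0 := by
    refine HasFDerivAt.comp_hasDerivAt (0 : ℝ)
      (l := fun x : Fin d → ℝ => translate P d x f)
      (f := fun t : ℝ => x + (Pi.single i t : Fin d → ℝ)) ?_ h2
    rwa [Pi.single_zero, add_zero]
  have h4 := ((translate P d x).toContinuousLinearMap.restrictScalars
    ℝ).hasFDerivAt.comp_hasDerivAt (0 : ℝ) (hasDerivAt_translate (smooth.mem_D1 hf) i)
  refine HasDerivAt.unique (h4.congr_of_eventuallyEq (Eventually.of_forall fun t => ?_)) h3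
  exact translate_add _ _ _

theorem smooth.L_mem {f : ScalarField P} (hf : f ∈ smooth P d) (i : Fin d) :
    L P d i f ∈ smooth P d := by
  have hf' : ContDiff ℝ ((⊤ : ℕ∞) : WithTop ℕ∞) fun x : Fin d → ℝ => translate P d x f := hf
  change ContDiff ℝ ((⊤ : ℕ∞) : WithTop ℕ∞) fun x : Fin d → ℝ => translate P d x (L P d i f)
  simp only [smooth.translate_L hf]
  exact (hf'.fderiv_right (by simp)).clm_apply contDiff_const

theorem smooth.mem_D2 {f : ScalarField P} (hf : f ∈ smooth P d) : f ∈ D2 P d :=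
  ⟨smooth.mem_D1 hf, fun j => smooth.mem_D1 (smooth.L_mem hf j)⟩

theorem smooth.L_comm {f : ScalarField P} (hf : f ∈ smooth P d) (i j : Fin d) :
    L P d i (L P d j f) = L P d j (L P d i f) := by
  have hf' : ContDiff ℝ ((⊤ : ℕ∞) : WithTop ℕ∞) fun x : Fin d → ℝ => translate P d x f := hf
  have hs : IsSymmSndFDerivAt ℝ (fun x : Fin d → ℝ => translate P d x f) 0 :=
    hf'.contDiffAt.isSymmSndFDerivAt (by
      simp only [minSmoothness_of_isRCLikeNormedField]
      exact WithTop.coe_le_coe.2 (le_top : (2 : ℕ∞) ≤ ⊤))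
  have key : ∀ i j, L P d i (L P d j f) =
      fderiv ℝ (fderiv ℝ fun x : Fin d → ℝ => translate P d x f) 0 (Pi.single i 1)
        (Pi.single j 1) := by
    intro i j
    have h := smooth.translate_L (smooth.L_mem hf j) i 0
    rw [translate_zero] at h
    simp only [smooth.translate_L hf] at h
    rw [h]
    have hd : DifferentiableAt ℝ (fderiv ℝ fun x : Fin d → ℝ => translate P d x f) 0 :=
      ((hf'.fderiv_right (m := 1) (by norm_cast)).differentiable one_ne_zero).differentiableAt
    rw [fderiv_clm_apply hd (differentiableAt_const _)]
    simp
  rw [key, key]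
  exact hs _ _

/-- Averaging over translations with a bump function. -/
def mollify
    (hT : ∀ f : ScalarField P, Continuous (fun x : Fin d → ℝ => translate P d x f))
    (φ : ContDiffBump (0 : Fin d → ℝ)) : ScalarField P →L[ℂ] ScalarField P :=
  LinearMap.mkContinuous
    { toFun := fun f => ∫ t, φ.normed volume t • translate P d (-t) f
      map_add' := fun f g => by
        have hi : ∀ f, Integrable (fun t => φ.normed volume t • translate P d (-t) f) := fun f =>
          (φ.continuous_normed.smul ((hT f).comp continuous_neg)).integrable_of_hasCompactSupport
            φ.hasCompactSupport_normed.smul_right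
        rw [← integral_add (hi f) (hi g)]
        simp only [map_add, smul_add]
      map_smul' := fun a f => by
        simp only [map_smul, RingHom.id_apply]
        rw [← integral_smul]
        simp only [smul_comm a] } 1 fun f => by
    refine (norm_integral_le_integral_norm _).trans ?_
    simp only [norm_smul, LinearIsometry.norm_map, Real.norm_of_nonneg (φ.nonneg_normed _)]
    change ∫ t, φ.normed volume t * ‖f‖ ≤ _
    rw [integral_mul_const, φ.integral_normed]

theorem mollify_apply
    (hT : ∀ f : ScalarField P, Continuous (fun x : Fin d → ℝ => translate P d x f))
    (φ : ContDiffBump (0 : Fin d → ℝ)) (f : ScalarField P) :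
    mollify hT φ f = ∫ t, φ.normed volume t • translate P d (-t) f := rfl

theorem translate_integral
    (hT : ∀ f : ScalarField P, Continuous (fun x : Fin d → ℝ => translate P d x f))
    (x : Fin d → ℝ) (φ : ContDiffBump (0 : Fin d → ℝ))
    (f : ScalarField P) : translate P d x (mollify hT φ f) =
      ∫ t, φ.normed volume t • translate P d x (translate P d (-t) f) := by
  have hi : Integrable (fun t => φ.normed volume t • translate P d (-t) f) :=
    (φ.continuous_normed.smul ((hT f).comp continuous_neg)).integrable_of_hasCompactSupport
      φ.hasCompactSupport_normed.smul_right
  have h := ((translate P d x).toContinuousLinearMap.restrictScalars ℝ).integral_comp_comm hi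
  refine h.symm.trans (integral_congr_ae (ae_of_all _ fun t => ?_))
  exact ((translate P d x).toContinuousLinearMap.restrictScalars ℝ).map_smul _ _

theorem stationary_mollify
    (hT : ∀ f : ScalarField P, Continuous (fun x : Fin d → ℝ => translate P d x f))
    (φ : ContDiffBump (0 : Fin d → ℝ)) :
    Stationary d (mollify hT φ) := fun x f => by
  rw [translate_integral, mollify_apply]
  simp only [translate_comm x]

/-- The orbit of the mollified field is the convolution of the bump function with the orbit of `f`,
so it inherits the smoothness of the bump. -/
theorem mollify_mem_smooth
    (hT : ∀ f : ScalarField P, Continuous (fun x : Fin d → ℝ => translate P d x f))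
    (φ : ContDiffBump (0 : Fin d → ℝ)) (f : ScalarField P) :
    mollify hT φ f ∈ smooth P d := by
  change ContDiff ℝ ((⊤ : ℕ∞) : WithTop ℕ∞)
    fun x : Fin d → ℝ => translate P d x (mollify hT φ f)
  have h := (φ.hasCompactSupport_normed (μ := volume)).contDiff_convolution_left (n := ⊤)
    (ContinuousLinearMap.lsmul ℝ ℝ) φ.contDiff_normed ((hT f).locallyIntegrable (μ := volume))
  refine (congrArg _ ?_).mp h
  funext x
  rw [translate_integral]
  refine integral_congr_ae (ae_of_all _ fun t => ?_)
  simp only [ContinuousLinearMap.lsmul_apply]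
  rw [← translate_add, sub_eq_add_neg]

/-- Regularization for the whole file: these operators respect the weak equations, since they
commute with translations, and turn them into strong ones, since their values are smooth. -/
theorem exists_mollifier
    (hT : ∀ f : ScalarField P, Continuous (fun x : Fin d → ℝ => translate P d x f)) :
    ∃ J : ℕ → ScalarField P →L[ℂ] ScalarField P, (∀ n, Stationary d (J n)) ∧
      (∀ n f, J n f ∈ smooth P d) ∧ ∀ f, Tendsto (fun n => J n f) atTop (𝓝 f) := by
  let φ : ℕ → ContDiffBump (0 : Fin d → ℝ) := fun n =>
    ⟨1 / ((n : ℝ) + 1) / 2, 1 / ((n : ℝ) + 1), by positivity, half_lt_self (by positivity)⟩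
  refine ⟨fun n => mollify hT (φ n), fun n => stationary_mollify hT _,
    fun n f => mollify_mem_smooth hT _ f, fun f => ?_⟩
  have h := ContDiffBump.convolution_tendsto_right_of_continuous (φ := φ) (μ := volume)
    tendsto_one_div_add_atTop_nhds_zero_nat (hT f) 0
  rw [translate_zero] at h
  refine h.congr fun n => ?_
  rw [mollify_apply]
  refine integral_congr_ae (ae_of_all _ fun t => ?_)
  simp only [ContinuousLinearMap.lsmul_apply, zero_sub]

end Mollification

/-! ### Orthogonal projections with prescribed range. -/

section Projections

variable {K : Type u} [NormedAddCommGroup K] [InnerProductSpace ℂ K] [CompleteSpace K]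

theorem exists_isStarProjection {S : Submodule ℂ K} (hS : IsClosed (S : Set K)) :
    ∃ A : K →L[ℂ] K, IsStarProjection A ∧ Set.range A = S := by
  have : CompleteSpace S := hS.completeSpace_coe
  refine ⟨S.starProjection, isStarProjection_starProjection, ?_⟩
  ext x
  exact ⟨by rintro ⟨y, rfl⟩; exact S.starProjection_apply_mem y,
    fun hx => ⟨x, Submodule.starProjection_eq_self_iff.2 hx⟩⟩

variable {S : Submodule ℂ K} {A : K →L[ℂ] K}

theorem apply_mem_of_range_eq (hr : Set.range A = S) (x : K) : A x ∈ S :=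
  SetLike.mem_coe.1 (hr ▸ Set.mem_range_self x)

theorem apply_eq_self_of_mem (hA : IsStarProjection A) (hr : Set.range A = S) {x : K}
    (hx : x ∈ S) : A x = x := by
  obtain ⟨y, rfl⟩ : x ∈ Set.range A := hr ▸ hx
  exact DFunLike.congr_fun hA.isIdempotentElem.eq y

theorem inner_sub_apply_eq_zero (hA : IsStarProjection A) (hr : Set.range A = S) {u : K}
    (hu : u ∈ S) (x : K) : ⟪u, x - A x⟫_ℂ = 0 := by
  rw [inner_sub_right, inner_apply_of_isSelfAdjoint hA.isSelfAdjoint,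
    apply_eq_self_of_mem hA hr hu, sub_self]

theorem apply_eq_zero_iff (hA : IsStarProjection A) (hr : Set.range A = S) {x : K} :
    A x = 0 ↔ ∀ u ∈ S, ⟪u, x⟫_ℂ = 0 := by
  constructor
  · intro h u hu
    have := inner_sub_apply_eq_zero hA hr hu x
    rwa [h, sub_zero] at this
  · intro h
    have h1 := h _ (apply_mem_of_range_eq hr x)
    rw [← inner_apply_of_isSelfAdjoint hA.isSelfAdjoint,
      inner_apply_of_isStarProjection hA] at h1
    have h2 : ‖A x‖ ^ 2 = 0 := by exact_mod_cast h1
    simpa using h2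

theorem apply_eq_of_inner (hA : IsStarProjection A) (hr : Set.range A = S) {x y : K} (hy : y ∈ S)
    (h : ∀ u ∈ S, ⟪u, x - y⟫_ℂ = 0) : A x = y := by
  have := (apply_eq_zero_iff hA hr).2 h
  rwa [map_sub, apply_eq_self_of_mem hA hr hy, sub_eq_zero] at this

end Projections

/-! ### Componentwise operations on vector fields. -/

section VectorFields

variable {Ω : Type u} [MeasurableSpace Ω] {P : Measure Ω} [IsProbabilityMeasure P] {m : ℕ}

/-- An operator on scalar fields acting on the components of a vector field. -/
def componentwise (m : ℕ) (B : ScalarField P →L[ℂ] ScalarField P) : VField P m →L[ℂ] VField P m :=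
  (PiLp.continuousLinearEquiv 2 ℂ (fun _ : Fin m => ScalarField P)).symm.toContinuousLinearMap ∘L
    (ContinuousLinearMap.pi fun k => B ∘L ContinuousLinearMap.proj k) ∘L
    (PiLp.continuousLinearEquiv 2 ℂ (fun _ : Fin m => ScalarField P)).toContinuousLinearMap

theorem componentwise_apply (B : ScalarField P →L[ℂ] ScalarField P) (ξ : VField P m) (k : Fin m) :
    componentwise m B ξ k = B (ξ k) := rfl

theorem inner_vfield (ξ ζ : VField P m) : ⟪ξ, ζ⟫_ℂ = ∑ k, ⟪ξ k, ζ k⟫_ℂ := PiLp.inner_apply _ _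

theorem tendsto_vfield {ι : Type*} {F : Filter ι} {f : ι → VField P m} {ξ : VField P m}
    (h : ∀ k, Tendsto (fun i => f i k) F (𝓝 (ξ k))) : Tendsto f F (𝓝 ξ) :=
  ((PiLp.continuousLinearEquiv 2 ℂ (fun _ : Fin m => ScalarField P)).symm.continuous.tendsto
    _).comp (tendsto_pi_nhds.2 h)

theorem continuous_coord (k : Fin m) : Continuous fun ξ : VField P m => ξ k := by fun_prop

theorem hasDerivAt_vfield {f : ℝ → VField P m} {ξ : VField P m} {t : ℝ}
    (h : ∀ k, HasDerivAt (fun t => f t k) (ξ k) t) : HasDerivAt f ξ t := by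
  have h1 := hasDerivAt_pi.2 h
  exact ((PiLp.continuousLinearEquiv 2 ℂ (fun _ : Fin m =>
    ScalarField P)).symm.toContinuousLinearMap.restrictScalars ℝ).hasFDerivAt.comp_hasDerivAt t h1

theorem HasDerivAt.coord {f : ℝ → VField P m} {ξ : VField P m} {t : ℝ}
    (h : HasDerivAt f ξ t) (k : Fin m) : HasDerivAt (fun t => f t k) (ξ k) t :=
  ((PiLp.proj 2 (fun _ : Fin m => ScalarField P) k (𝕜 := ℂ)).restrictScalars
    ℝ).hasFDerivAt.comp_hasDerivAt t h

theorem isClosed_vec {S : Submodule ℂ (ScalarField P)} (hS : IsClosed (S : Set (ScalarField P))) :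
    IsClosed (vec S m : Set (VField P m)) := by
  have : (vec S m : Set (VField P m)) = ⋂ k, (fun ξ : VField P m => ξ k) ⁻¹' S := by
    ext ξ
    simp only [Set.mem_iInter, Set.mem_preimage]
    rfl
  rw [this]
  exact isClosed_iInter fun k => hS.preimage (continuous_coord k)

theorem continuous_mean : Continuous (mean P) := by
  have : (mean P : ScalarField P → ℂ) = fun f => ⟪Lp.const 2 P (1 : ℂ), f⟫_ℂ :=
    funext mean_eq_inner
  rw [this]
  fun_prop

theorem isClosed_ker_mean : IsClosed (LinearMap.ker (mean P) : Set (ScalarField P)) :=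
  isClosed_singleton.preimage continuous_mean

theorem inner_constV_eq_zero {ξ : VField P m} (hξ : ξ ∈ vec (LinearMap.ker (mean P)) m)
    (a : Fin m → ℂ) : ⟪ξ, constV P a⟫_ℂ = 0 := by
  rw [inner_vfield]
  refine Finset.sum_eq_zero fun k _ => ?_
  have h : mean P (ξ k) = 0 := hξ k
  change ⟪ξ k, Lp.const 2 P (a k)⟫_ℂ = 0
  rw [const_eq_smul, inner_smul_right, ← inner_conj_symm, ← mean_eq_inner, h, map_zero, mul_zero]

theorem sub_constV_mem (ξ : VField P m) :
    ξ - constV P (meanV P ξ) ∈ vec (LinearMap.ker (mean P)) m := by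
  intro k
  change mean P (ξ k - Lp.const 2 P (mean P (ξ k))) = 0
  rw [map_sub, mean_const, sub_self]

theorem inner_basisV (ξ : VField P m) (k : Fin m) : ⟪basisV P k, ξ⟫_ℂ = mean P (ξ k) := by
  rw [inner_vfield, mean_eq_inner, Finset.sum_eq_single k]
  · simp [basisV, constV]
  · intro j _ hj
    simp [basisV, constV, hj]
  · simp

end VectorFields

/-! ### The orthogonal decomposition into curl-free and divergence-free fields. -/

section Hodge

variable {Ω : Type u} [MeasurableSpace Ω] {P : Measure Ω} [IsProbabilityMeasure P]
variable {d : ℕ} [AddAction (Fin d → ℝ) Ω] [MeasurableConstVAdd (Fin d → ℝ) Ω]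

section Invariant

variable [VAddInvariantMeasure (Fin d → ℝ) Ω P] {m : ℕ}

/-- Operators on vector fields commuting with all translations. -/
def StationaryV (d : ℕ) [AddAction (Fin d → ℝ) Ω] [MeasurableConstVAdd (Fin d → ℝ) Ω]
    [VAddInvariantMeasure (Fin d → ℝ) Ω P] (B : VField P m →L[ℂ] VField P m) : Prop :=
  ∀ (x : Fin d → ℝ) ξ, B (componentwise m (translate P d x).toContinuousLinearMap ξ) =
    componentwise m (translate P d x).toContinuousLinearMap (B ξ)

theorem StationaryV.hasDerivAt {B : VField P m →L[ℂ] VField P m} (hB : StationaryV d B)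
    {ξ : VField P m} (hξ : ξ ∈ vec (D1 P d) m) (i : Fin d) (k : Fin m) :
    HasDerivAt (fun t : ℝ => translate P d (Pi.single i t) (B ξ k))
      (B (WithLp.toLp 2 fun k => L P d i (ξ k)) k) 0 := by
  have h1 : HasDerivAt (fun t : ℝ => componentwise m
      (translate P d (Pi.single i t)).toContinuousLinearMap ξ)
      (WithLp.toLp 2 fun k => L P d i (ξ k)) 0 :=
    hasDerivAt_vfield fun k => hasDerivAt_translate (hξ k) i
  have h2 := (B.restrictScalars ℝ).hasFDerivAt.comp_hasDerivAt 0 h1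
  have h3 := HasDerivAt.coord h2 k
  refine h3.congr_of_eventuallyEq (Eventually.of_forall fun t => ?_)
  exact (congrArg (fun ζ : VField P m => ζ k) (hB (Pi.single i t) ξ)).symm

theorem StationaryV.mem_D1 {B : VField P m →L[ℂ] VField P m} (hB : StationaryV d B)
    {ξ : VField P m} (hξ : ξ ∈ vec (D1 P d) m) : B ξ ∈ vec (D1 P d) m :=
  fun k i => (hB.hasDerivAt hξ i k).differentiableAt

theorem StationaryV.mem_D2 {B : VField P m →L[ℂ] VField P m} (hB : StationaryV d B)
    {ξ : VField P m} (hξ : ξ ∈ vec (D2 P d) m) : B ξ ∈ vec (D2 P d) m := fun k => by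
  have h1 : ξ ∈ vec (D1 P d) m := fun k => (hξ k).1
  refine ⟨hB.mem_D1 h1 k, fun j => ?_⟩
  have h2 : L P d j (B ξ k) = B (WithLp.toLp 2 fun k => L P d j (ξ k)) k :=
    (hB.hasDerivAt h1 j k).deriv
  rw [h2]
  exact hB.mem_D1 (fun k => (hξ k).2 j) k

/-- The adjoint of a translation is the opposite translation and also preserves `S`, so translates
of vectors orthogonal to `S` stay orthogonal to `S`. Projections of this kind therefore preserve
differentiability. -/
theorem stationaryV_of_range {S : Submodule ℂ (VField P m)} {A : VField P m →L[ℂ] VField P m}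
    (hA : IsStarProjection A) (hr : Set.range A = S)
    (hS : ∀ (x : Fin d → ℝ), ∀ ξ ∈ S,
      componentwise m (translate P d x).toContinuousLinearMap ξ ∈ S) : StationaryV d A := by
  intro x ξ
  refine apply_eq_of_inner hA hr (hS x _ (apply_mem_of_range_eq hr ξ)) fun u hu => ?_
  have h := inner_sub_apply_eq_zero hA hr (hS (-x) u hu) ξ
  rw [← h, ← map_sub, inner_vfield, inner_vfield]
  refine Finset.sum_congr rfl fun k _ => ?_
  have h2 := inner_translate_left (-x) (u k) ((ξ - A ξ) k)
  rw [neg_neg] at h2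
  exact h2.symm

/-- The operator is moved onto the test function through its adjoint, which again commutes with
translations and so with the generators. -/
theorem Stationary.componentwise_mem_CurlFree {B : ScalarField P →L[ℂ] ScalarField P}
    (hB : Stationary d B) {ξ : VField P d} (hξ : ξ ∈ CurlFree P d) :
    componentwise d B ξ ∈ CurlFree P d := by
  intro i j f hf
  have h := hξ i j _ (hB.adjoint.mem_D1 hf)
  rw [hB.adjoint.L_apply hf, hB.adjoint.L_apply hf, ContinuousLinearMap.adjoint_inner_left,
    ContinuousLinearMap.adjoint_inner_left] at h
  exact h

theorem Stationary.componentwise_mem_DivFree {B : ScalarField P →L[ℂ] ScalarField P}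
    (hB : Stationary d B) {ξ : VField P d} (hξ : ξ ∈ DivFree P d) :
    componentwise d B ξ ∈ DivFree P d := by
  intro f hf
  have h := hξ _ (hB.adjoint.mem_D1 hf)
  simp only [hB.adjoint.L_apply hf, ContinuousLinearMap.adjoint_inner_left] at h
  exact h

theorem isClosed_CurlFree : IsClosed (CurlFree P d : Set (VField P d)) := by
  have : (CurlFree P d : Set (VField P d)) = ⋂ i, ⋂ j, ⋂ f ∈ D1 P d,
      {ξ | ⟪L P d i f, ξ j⟫_ℂ = ⟪L P d j f, ξ i⟫_ℂ} := by
    ext ξ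
    simp only [Set.mem_iInter]
    rfl
  rw [this]
  refine isClosed_iInter fun i => isClosed_iInter fun j => isClosed_biInter fun f _ =>
    isClosed_eq ?_ ?_ <;> fun_prop

theorem isClosed_DivFree : IsClosed (DivFree P d : Set (VField P d)) := by
  have : (DivFree P d : Set (VField P d)) = ⋂ f ∈ D1 P d, {ξ | ∑ i, ⟪L P d i f, ξ i⟫_ℂ = 0} := by
    ext ξ
    simp only [Set.mem_iInter]
    rfl
  rw [this]
  refine isClosed_biInter fun f _ => isClosed_eq ?_ ?_ <;> fun_prop

theorem isClosed_fluct {V : Submodule ℂ (VField P d)} (hV : IsClosed (V : Set (VField P d))) :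
    IsClosed (fluct V : Set (VField P d)) :=
  hV.inter (isClosed_vec isClosed_ker_mean)

theorem constV_mem_CurlFree (a : Fin d → ℂ) : constV P a ∈ CurlFree P d := by
  intro i j f hf
  change ⟪L P d i f, Lp.const 2 P (a j)⟫_ℂ = ⟪L P d j f, Lp.const 2 P (a i)⟫_ℂ
  rw [inner_L hf (const_mem_D1 _), inner_L hf (const_mem_D1 _), L_const, L_const]

theorem constV_mem_DivFree (a : Fin d → ℂ) : constV P a ∈ DivFree P d := by
  intro f hf
  refine Finset.sum_eq_zero fun i _ => ?_
  change ⟪L P d i f, Lp.const 2 P (a i)⟫_ℂ = 0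
  rw [inner_L hf (const_mem_D1 _), L_const, inner_zero_right, neg_zero]

theorem translate_mem_fluct_CurlFree (x : Fin d → ℝ) {ξ : VField P d}
    (hξ : ξ ∈ fluct (CurlFree P d)) :
    componentwise d (translate P d x).toContinuousLinearMap ξ ∈ fluct (CurlFree P d) :=
  ⟨(stationary_translate x).componentwise_mem_CurlFree hξ.1, fun k =>
    (mean_translate x (ξ k)).trans (hξ.2 k)⟩

theorem translate_mem_fluct_DivFree (x : Fin d → ℝ) {ξ : VField P d}
    (hξ : ξ ∈ fluct (DivFree P d)) :
    componentwise d (translate P d x).toContinuousLinearMap ξ ∈ fluct (DivFree P d) :=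
  ⟨(stationary_translate x).componentwise_mem_DivFree hξ.1, fun k =>
    (mean_translate x (ξ k)).trans (hξ.2 k)⟩

/-- Mixed second derivatives commute weakly. -/
theorem inner_L_L_comm
    (hT : ∀ f : ScalarField P, Continuous (fun x : Fin d → ℝ => translate P d x f))
    {f g : ScalarField P} (hf : f ∈ D1 P d) (hg : g ∈ D1 P d) (i j : Fin d) :
    ⟪L P d i g, L P d j f⟫_ℂ = ⟪L P d j g, L P d i f⟫_ℂ := by
  obtain ⟨J, hJ, hs, hlim⟩ := exists_mollifier hT
  -- For `f` in `D1` the second derivatives need not exist; those of `J n f` do, and they commute.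
  have h : ∀ n, ⟪L P d i g, J n (L P d j f)⟫_ℂ = ⟪L P d j g, J n (L P d i f)⟫_ℂ := by
    intro n
    rw [← (hJ n).L_apply hf, ← (hJ n).L_apply hf,
      inner_L hg (smooth.mem_D1 (smooth.L_mem (hs n f) j)),
      inner_L hg (smooth.mem_D1 (smooth.L_mem (hs n f) i)), smooth.L_comm (hs n f)]
  refine tendsto_nhds_unique ((tendsto_const_nhds (x := L P d i g)).inner (𝕜 := ℂ)
    (hlim (L P d j f))) ?_
  simp only [h]
  exact (tendsto_const_nhds (x := L P d j g)).inner (𝕜 := ℂ) (hlim (L P d i f))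

theorem grad_mem_fluct_CurlFree
    (hT : ∀ f : ScalarField P, Continuous (fun x : Fin d → ℝ => translate P d x f))
    {f : ScalarField P} (hf : f ∈ D1 P d) : grad P d f ∈ fluct (CurlFree P d) :=
  ⟨fun i j _ hg => inner_L_L_comm hT hf hg i j, fun k => mean_L hf k⟩

theorem mem_DivFree_of_grad {ζ : VField P d} (h : ∀ f ∈ D1 P d, ⟪grad P d f, ζ⟫_ℂ = 0) :
    ζ ∈ DivFree P d := fun f hf => by
  rw [← h f hf, inner_vfield]
  rfl

theorem inner_grad_eq_zero {ζ : VField P d} (h : ζ ∈ DivFree P d) {f : ScalarField P}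
    (hf : f ∈ D1 P d) : ⟪grad P d f, ζ⟫_ℂ = 0 := by
  rw [← h f hf, inner_vfield]
  rfl

variable (P d) in
/-- The gradients of mean-zero stationary fields. -/
def gradRange : Submodule ℂ (VField P d) where
  carrier := grad P d '' meanZero P (D1 P d)
  add_mem' := by
    rintro _ _ ⟨f, hf, rfl⟩ ⟨g, hg, rfl⟩
    refine ⟨f + g, add_mem hf hg, ?_⟩
    ext1 i
    exact L_add P d hf.1 hg.1 i
  zero_mem' := ⟨0, zero_mem _, by ext1 i; exact L_zero i⟩
  smul_mem' := by
    rintro a _ ⟨f, hf, rfl⟩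
    refine ⟨a • f, Submodule.smul_mem _ a hf, ?_⟩
    ext1 i
    exact L_smul P d hf.1 a i

theorem grad_mem_gradRange {f : ScalarField P} (hf : f ∈ D1 P d) :
    grad P d f ∈ gradRange P d := by
  refine ⟨f - Lp.const 2 P (mean P f), ⟨sub_mem hf (const_mem_D1 _), ?_⟩, ?_⟩
  · change mean P _ = 0
    rw [map_sub, mean_const, sub_self]
  · ext1 i
    change L P d i _ = L P d i f
    rw [L_sub hf (const_mem_D1 _), L_const, sub_zero]

/-- The difference `L i (ξ j) - L j (ξ i)` is itself an admissible test function; testing with it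
shows that its norm is zero. -/
theorem L_comm_of_mem_CurlFree {ξ : VField P d} (hs : ∀ k, ξ k ∈ smooth P d)
    (hξ : ξ ∈ CurlFree P d) (i j : Fin d) : L P d i (ξ j) = L P d j (ξ i) := by
  rw [← sub_eq_zero, ← inner_self_eq_zero (𝕜 := ℂ)]
  have hm : L P d i (ξ j) - L P d j (ξ i) ∈ smooth P d :=
    sub_mem (smooth.L_mem (hs j) i) (smooth.L_mem (hs i) j)
  have h := hξ i j _ (smooth.mem_D1 hm)
  rw [inner_L (smooth.mem_D1 hm) (smooth.mem_D1 (hs j)),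
    inner_L (smooth.mem_D1 hm) (smooth.mem_D1 (hs i))] at h
  rw [inner_sub_right]
  linear_combination -h

theorem sum_L_of_mem_DivFree {ξ : VField P d} (hs : ∀ k, ξ k ∈ smooth P d)
    (hξ : ξ ∈ DivFree P d) : ∑ i, L P d i (ξ i) = 0 := by
  rw [← inner_self_eq_zero (𝕜 := ℂ)]
  have hm : ∑ i, L P d i (ξ i) ∈ smooth P d := sum_mem fun i _ => smooth.L_mem (hs i) i
  have h := hξ _ (smooth.mem_D1 hm)
  simp only [inner_L (smooth.mem_D1 hm) (smooth.mem_D1 (hs _)), Finset.sum_neg_distrib,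
    neg_eq_zero] at h
  rwa [inner_sum]

end Invariant

section Ergodic

variable [ErgodicVAdd (Fin d → ℝ) Ω P]

/-- The field `B* 1` is invariant under translations, hence constant by ergodicity, so the mean of
`B f` is a multiple of the mean of `f`. -/
theorem Stationary.mean_apply_eq_zero {B : ScalarField P →L[ℂ] ScalarField P}
    (hB : Stationary d B) {f : ScalarField P} (hf : mean P f = 0) : mean P (B f) = 0 := by
  have h : ∀ x, translate P d x (B.adjoint (Lp.const 2 P 1)) = B.adjoint (Lp.const 2 P 1) :=
    fun x => by rw [← hB.adjoint, translate_const]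
  rw [mean_eq_inner, ← ContinuousLinearMap.adjoint_inner_left, exists_eq_const h, const_eq_smul,
    inner_smul_left, ← mean_eq_inner, hf, mul_zero]

/-- A field that is both curl-free and divergence-free is constant. -/
theorem eq_zero_of_mem_CurlFree_of_mem_DivFree
    (hT : ∀ f : ScalarField P, Continuous (fun x : Fin d → ℝ => translate P d x f))
    {ξ : VField P d} (hc : ξ ∈ fluct (CurlFree P d)) (hd : ξ ∈ DivFree P d) : ξ = 0 := by
  obtain ⟨J, hJ, hs, hlim⟩ := exists_mollifier hT
  have key : ∀ n i, J n (ξ i) = 0 := by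
    intro n i
    have hc' := L_comm_of_mem_CurlFree (ξ := componentwise d (J n) ξ) (fun k => hs n _)
      ((hJ n).componentwise_mem_CurlFree hc.1)
    have hd' := sum_L_of_mem_DivFree (ξ := componentwise d (J n) ξ) (fun k => hs n _)
      ((hJ n).componentwise_mem_DivFree hd)
    simp only [componentwise_apply] at hc' hd'
    -- Vanishing curl turns `L j L j ξ_i` into `L i L j ξ_j`, and summing over `j` produces the
    -- divergence. Pairing with `J n (ξ i)` then shows that its gradient vanishes.
    have hL : ∑ j, L P d j (L P d j (J n (ξ i))) = 0 := by
      have h1 : ∀ j, L P d j (L P d j (J n (ξ i))) = L P d i (L P d j (J n (ξ j))) := fun j => by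
        rw [hc' j i, smooth.L_comm (hs n _)]
      simp only [h1]
      rw [← L_sum _ (fun j => smooth.mem_D1 (smooth.L_mem (hs n (ξ j)) j)), hd', L_zero]
    have h2 : ∑ j, (‖L P d j (J n (ξ i))‖ ^ 2 : ℝ) = 0 := by
      have h3 := congrArg (fun g => ⟪J n (ξ i), g⟫_ℂ) hL
      simp only [inner_sum, inner_zero_right] at h3
      have h4 : ∀ j, ⟪J n (ξ i), L P d j (L P d j (J n (ξ i)))⟫_ℂ =
          -((‖L P d j (J n (ξ i))‖ ^ 2 : ℝ) : ℂ) := fun j => by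
        have h5 := inner_L (smooth.mem_D1 (hs n (ξ i)))
          (smooth.mem_D1 (smooth.L_mem (hs n (ξ i)) j)) j
        rw [inner_self_eq_norm_sq_to_K] at h5
        rw [← neg_eq_iff_eq_neg.2 h5.symm.symm]
        norm_cast
      simp only [h4, Finset.sum_neg_distrib, neg_eq_zero] at h3
      exact_mod_cast h3
    have h6 : ∀ j, L P d j (J n (ξ i)) = 0 := fun j => by
      have := (Finset.sum_eq_zero_iff_of_nonneg fun j _ => sq_nonneg _).1 h2 j (Finset.mem_univ j)
      simpa using this
    rw [exists_eq_const (translate_eq_self_of_L_eq_zero (smooth.mem_D1 (hs n (ξ i))) h6),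
      (hJ n).mean_apply_eq_zero (hc.2 i), map_zero]
  ext1 i
  refine tendsto_nhds_unique (hlim (ξ i)) ?_
  simp only [key]
  exact tendsto_const_nhds

/-- The remainder of a curl-free field after projection onto the closed span of the gradients is
still curl-free with mean zero, and orthogonality to the gradients makes it divergence-free; so it
is zero. -/
theorem fluct_CurlFree_eq_closure
    (hT : ∀ f : ScalarField P, Continuous (fun x : Fin d → ℝ => translate P d x f)) :
    fluct (CurlFree P d) = (gradRange P d).topologicalClosure := by
  apply le_antisymm
  · intro ξ hξ
    obtain ⟨A, hA, hr⟩ := exists_isStarProjection (gradRange P d).isClosed_topologicalClosure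
    have hle : (gradRange P d).topologicalClosure ≤ fluct (CurlFree P d) :=
      Submodule.topologicalClosure_minimal _ (by
        rintro _ ⟨f, hf, rfl⟩
        exact grad_mem_fluct_CurlFree hT hf.1) (isClosed_fluct isClosed_CurlFree)
    have h0 : ξ - A ξ = 0 := by
      refine eq_zero_of_mem_CurlFree_of_mem_DivFree hT
        (sub_mem hξ (hle (apply_mem_of_range_eq hr ξ))) (mem_DivFree_of_grad fun f hf => ?_)
      exact inner_sub_apply_eq_zero hA hr
        (Submodule.le_topologicalClosure _ (grad_mem_gradRange hf)) ξ
    rw [sub_eq_zero.1 h0]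
    exact apply_mem_of_range_eq hr ξ
  · exact Submodule.topologicalClosure_minimal _ (by
      rintro _ ⟨f, hf, rfl⟩
      exact grad_mem_fluct_CurlFree hT hf.1) (isClosed_fluct isClosed_CurlFree)

theorem inner_eq_zero_of_CurlFree_of_DivFree
    (hT : ∀ f : ScalarField P, Continuous (fun x : Fin d → ℝ => translate P d x f))
    {ξ ζ : VField P d} (hξ : ξ ∈ fluct (CurlFree P d)) (hζ : ζ ∈ DivFree P d) :
    ⟪ξ, ζ⟫_ℂ = 0 := by
  rw [fluct_CurlFree_eq_closure hT] at hξ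
  have hcl : IsClosed {ξ : VField P d | ⟪ξ, ζ⟫_ℂ = 0} := isClosed_eq (by fun_prop) (by fun_prop)
  refine closure_minimal (t := {ξ : VField P d | ⟪ξ, ζ⟫_ℂ = 0}) ?_ hcl hξ
  rintro _ ⟨f, hf, rfl⟩
  exact inner_grad_eq_zero hζ hf.1

theorem mem_DivFree_iff
    (hT : ∀ f : ScalarField P, Continuous (fun x : Fin d → ℝ => translate P d x f))
    {ζ : VField P d} : ζ ∈ DivFree P d ↔ ∀ u ∈ fluct (CurlFree P d), ⟪u, ζ⟫_ℂ = 0 :=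
  ⟨fun hζ _ hu => inner_eq_zero_of_CurlFree_of_DivFree hT hu hζ,
    fun h => mem_DivFree_of_grad fun _ hf => h _ (grad_mem_fluct_CurlFree hT hf)⟩

/-- For the converse, `η` is split into its curl-free fluctuating part, its mean and a remainder
`r`. The remainder is a mean-zero divergence-free field, so the hypothesis applied to `r` itself
gives `r = 0`. No curl operator enters, and the result holds in every dimension. -/
theorem mem_CurlFree_iff
    (hT : ∀ f : ScalarField P, Continuous (fun x : Fin d → ℝ => translate P d x f))
    {η : VField P d} : η ∈ CurlFree P d ↔ ∀ u ∈ fluct (DivFree P d), ⟪u, η⟫_ℂ = 0 := by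
  constructor
  · intro hη u hu
    have h1 : η - constV P (meanV P η) ∈ fluct (CurlFree P d) :=
      ⟨sub_mem hη (constV_mem_CurlFree _), sub_constV_mem η⟩
    have h2 := inner_eq_zero_of_CurlFree_of_DivFree hT h1 hu.1
    rw [← inner_conj_symm, map_eq_zero, inner_sub_right, inner_constV_eq_zero hu.2, sub_zero] at h2
    exact h2
  · intro h
    obtain ⟨A, hA, hr⟩ := exists_isStarProjection (isClosed_fluct (isClosed_CurlFree (P := P)
      (d := d)))
    set r := η - A η - constV P (meanV P η) with hrdef
    have hAη := apply_mem_of_range_eq hr η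
    have hr0 : r ∈ vec (LinearMap.ker (mean P)) d := by
      have : r = (η - constV P (meanV P η)) - A η := by rw [hrdef]; abel
      rw [this]
      exact sub_mem (sub_constV_mem η) hAη.2
    have horth : ∀ u ∈ fluct (CurlFree P d), ⟪u, r⟫_ℂ = 0 := fun u hu => by
      rw [hrdef, inner_sub_right, inner_sub_apply_eq_zero hA hr hu, inner_constV_eq_zero hu.2,
        sub_zero]
    have hrd : r ∈ fluct (DivFree P d) := ⟨(mem_DivFree_iff hT).2 horth, hr0⟩
    have h0 : r = 0 := by
      rw [← inner_self_eq_zero (𝕜 := ℂ)]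
      conv_lhs => rw [hrdef]
      rw [← hrdef, inner_sub_right, inner_sub_right, h r hrd, inner_constV_eq_zero hr0,
        ← inner_conj_symm, horth _ hAη]
      simp
    have : η = A η + constV P (meanV P η) := by
      rw [hrdef, sub_eq_zero, sub_eq_iff_eq_add'] at h0
      exact h0
    rw [this]
    exact add_mem hAη.1 (constV_mem_CurlFree _)

end Ergodic

end Hodge

/-! ### The characteristic functions, coercivity, and the compressed projections. -/

section Components

variable {Ω : Type u} [MeasurableSpace Ω] {P : Measure Ω} [IsProbabilityMeasure P] {m : ℕ}

theorem inner_indicatorOp {S : Set Ω} (hS : MeasurableSet S) (f g : ScalarField P) :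
    ⟪indicatorOp hS f, g⟫_ℂ = ⟪f, indicatorOp hS g⟫_ℂ := by
  rw [L2.inner_def, L2.inner_def]
  refine integral_congr_ae ?_
  filter_upwards [coeFn_indicatorFun hS f, coeFn_indicatorFun hS g] with ω h1 h2
  change inner ℂ (indicatorFun hS f ω) (g ω) = inner ℂ (f ω) (indicatorFun hS g ω)
  rw [h1, h2]
  by_cases h : ω ∈ S
  · rw [Set.indicator_of_mem h, Set.indicator_of_mem h]
  · rw [Set.indicator_of_notMem h, Set.indicator_of_notMem h, inner_zero_left, inner_zero_right]

theorem indicatorOp_idem {S : Set Ω} (hS : MeasurableSet S) (f : ScalarField P) :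
    indicatorOp hS (indicatorOp hS f) = indicatorOp hS f := by
  refine Lp.ext ?_
  filter_upwards [coeFn_indicatorFun hS (indicatorFun hS f), coeFn_indicatorFun hS f] with ω h1 h2
  change indicatorFun hS (indicatorFun hS f) ω = indicatorFun hS f ω
  rw [h1]
  by_cases h : ω ∈ S
  · rw [Set.indicator_of_mem h]
  · rw [Set.indicator_of_notMem h, h2, Set.indicator_of_notMem h]

theorem indicatorOp_add_compl {S S' : Set Ω} (hS : MeasurableSet S) (hS' : MeasurableSet S')
    (h : ∀ ω, ω ∈ S' ↔ ω ∉ S) (f : ScalarField P) :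
    indicatorOp hS f + indicatorOp hS' f = f := by
  refine Lp.ext ?_
  filter_upwards [coeFn_indicatorFun hS f, coeFn_indicatorFun hS' f,
    Lp.coeFn_add (indicatorFun hS f) (indicatorFun hS' f)] with ω h1 h2 h3
  change (indicatorFun hS f + indicatorFun hS' f : ScalarField P) ω = f ω
  rw [h3, Pi.add_apply, h1, h2]
  by_cases hω : ω ∈ S
  · rw [Set.indicator_of_mem hω, Set.indicator_of_notMem (by rwa [h, not_not]), add_zero]
  · rw [Set.indicator_of_notMem hω, Set.indicator_of_mem (by rwa [h]), zero_add]

variable {c : Ω → Fin 2} (hc : Measurable c)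

theorem isStarProjection_chi (i : Fin 2) : IsStarProjection (chi (P := P) (m := m) hc i) := by
  refine ⟨?_, isSelfAdjoint_of_inner fun x y => ?_⟩
  · refine ContinuousLinearMap.ext fun x => PiLp.ext fun k => ?_
    exact indicatorOp_idem (hc (measurableSet_singleton i)) (x k)
  · rw [inner_vfield, inner_vfield]
    exact Finset.sum_congr rfl fun k _ =>
      inner_indicatorOp (hc (measurableSet_singleton i)) _ _

theorem chi_add (i : Fin 2) :
    chi (P := P) (m := m) hc i + chi hc (1 - i) = 1 := by
  refine ContinuousLinearMap.ext fun x => PiLp.ext fun k => ?_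
  refine indicatorOp_add_compl (hc (measurableSet_singleton i))
    (hc (measurableSet_singleton (1 - i))) (fun ω => ?_) (x k)
  change c ω = 1 - i ↔ ¬ c ω = i
  generalize c ω = a
  revert a i
  decide

theorem chi_apply_apply (i : Fin 2) (ξ : VField P m) : chi hc i (chi hc i ξ) = chi hc i ξ :=
  PiLp.ext fun k => indicatorOp_idem (hc (measurableSet_singleton i)) (ξ k)

theorem chi_mul_chi_of_ne {i j : Fin 2} (h : i ≠ j) :
    chi (P := P) (m := m) hc i * chi hc j = 0 := by
  have hj : j = 1 - i := by
    revert i j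
    decide
  have h1 : chi (P := P) (m := m) hc j = 1 - chi hc i := by
    rw [hj, ← chi_add hc i]
    abel
  rw [h1, mul_sub, mul_one, (isStarProjection_chi hc i).isIdempotentElem.eq, sub_self]

theorem medium_mul_inv (σ : Fin 2 → ℂ) (hσ : ∀ i, σ i ≠ 0) :
    medium (P := P) (m := m) hc σ * medium hc (fun i => 1 / σ i) = 1 := by
  have key : ∀ {A : Type u} [Ring A] [Algebra ℂ A] {p q : A}, p * p = p → q * q = q → p * q = 0 →
      q * p = 0 → p + q = 1 →
      (σ 0 • p + σ 1 • q) * ((1 / σ 0) • p + (1 / σ 1) • q) = 1 := by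
    intro A _ _ p q e0 e1 e01 e10 h
    simp only [add_mul, mul_add, smul_mul_assoc, mul_smul_comm, e0, e1, e01, e10, smul_zero,
      smul_smul, add_zero, zero_add]
    rw [one_div_mul_cancel (hσ 0), one_div_mul_cancel (hσ 1), one_smul, one_smul, h]
  have h := chi_add (P := P) (m := m) hc 0
  rw [sub_zero] at h
  exact key (isStarProjection_chi (P := P) (m := m) hc 0).isIdempotentElem.eq
    (isStarProjection_chi (P := P) (m := m) hc 1).isIdempotentElem.eq
    (chi_mul_chi_of_ne (P := P) (m := m) hc (i := 0) (j := 1) (by decide))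
    (chi_mul_chi_of_ne (P := P) (m := m) hc (i := 1) (j := 0) (by decide)) h

theorem norm_sq_eq_chi (ξ : VField P m) : ‖chi hc 0 ξ‖ ^ 2 + ‖chi hc 1 ξ‖ ^ 2 = ‖ξ‖ ^ 2 := by
  have h0 := inner_apply_of_isStarProjection (isStarProjection_chi (P := P) (m := m) hc 0) ξ
  have h1 := inner_apply_of_isStarProjection (isStarProjection_chi (P := P) (m := m) hc 1) ξ
  have h := DFunLike.congr_fun (chi_add (P := P) (m := m) hc 0) ξ
  rw [sub_zero] at h
  have h2 : ⟪ξ, ξ⟫_ℂ = ((‖chi hc 0 ξ‖ ^ 2 + ‖chi hc 1 ξ‖ ^ 2 : ℝ) : ℂ) := by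
    rw [Complex.ofReal_add, ← h0, ← h1, ← inner_add_right]
    exact congrArg _ h.symm
  rw [inner_self_eq_norm_sq_to_K] at h2
  exact Complex.ofReal_injective (by rw [← h2]; norm_cast)

theorem Admissible.div_mem {a : Fin 2 → ℂ} (ha : Admissible a) (i : Fin 2) :
    a i / a (1 - i) ∈ Complex.slitPlane := by
  fin_cases i
  · exact ha
  · have h : a 1 / a 0 = (a 0 / a 1)⁻¹ := (inv_div _ _).symm
    change a 1 / a 0 ∈ _
    rw [h]
    have h0 : a 0 / a 1 ≠ 0 := Complex.slitPlane_ne_zero ha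
    have h1 := Complex.slitPlane_arg_ne_pi ha
    rw [Complex.mem_slitPlane_iff_arg]
    refine ⟨fun h2 => ?_, inv_ne_zero h0⟩
    rw [Complex.arg_inv, if_neg h1] at h2
    linarith [Complex.neg_pi_lt_arg (a 0 / a 1)]

theorem Admissible.ne_zero {a : Fin 2 → ℂ} (ha : Admissible a) (i : Fin 2) : a i ≠ 0 := fun h =>
  Complex.slitPlane_ne_zero (ha.div_mem i) (by rw [h, zero_div])

/-- Up to the factor `a (1 - i)`, which does not affect the weak equations, only the ratio of the
coefficients matters. -/
theorem medium_eq {a : Fin 2 → ℂ} {i : Fin 2} (ha : a (1 - i) ≠ 0) :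
    medium (P := P) (m := m) hc a =
      a (1 - i) • (1 - (1 - a i / a (1 - i)) • chi hc i) := by
  have h := chi_add (P := P) (m := m) hc i
  have h2 : medium (P := P) (m := m) hc a = a i • chi hc i + a (1 - i) • chi hc (1 - i) := by
    fin_cases i
    · rfl
    · exact add_comm _ _
  rw [h2, ← h, smul_sub, smul_add, smul_smul, mul_sub, mul_div_cancel₀ _ ha]
  module

/-- For `ξ ≠ 0` the quotient of the form by `‖ξ‖²` is a point `a 0 p + a 1 (1 - p)` of the segment
joining the two coefficients. Admissibility says that this segment misses the origin, and `κ` is its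
distance from the origin. -/
theorem coercive_medium {a : Fin 2 → ℂ} (ha : Admissible a) :
    ∃ κ : ℝ, 0 < κ ∧ ∀ ξ : VField P m, κ * ‖ξ‖ ^ 2 ≤ ‖⟪ξ, medium hc a ξ⟫_ℂ‖ := by
  obtain ⟨p, hp, hmin⟩ := isCompact_Icc.exists_isMinOn (Set.nonempty_Icc.2 zero_le_one)
    (f := fun p : ℝ => ‖a 0 * p + a 1 * (1 - p)‖) (s := Set.Icc (0 : ℝ) 1)
    (by fun_prop : Continuous fun p : ℝ => ‖a 0 * p + a 1 * (1 - p)‖).continuousOn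
  refine ⟨‖a 0 * p + a 1 * (1 - p)‖, norm_pos_iff.2 fun h0 => ?_, fun ξ => ?_⟩
  · have h1 : a 1 ≠ 0 := ha.ne_zero 1
    by_cases hp0 : p = 0
    · simp [hp0, h1] at h0
    -- A zero on the segment would make the ratio real and nonpositive.
    · have e : a 0 / a 1 = ((-(1 - p) / p : ℝ) : ℂ) := by
        have : (p : ℂ) ≠ 0 := by exact_mod_cast hp0
        push_cast
        rw [div_eq_div_iff h1 this]
        linear_combination h0
      have h2 := ha
      rw [Admissible, e, Complex.ofReal_mem_slitPlane] at h2
      have hp' : 0 < p := lt_of_le_of_ne hp.1 (Ne.symm hp0)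
      have := div_nonpos_of_nonpos_of_nonneg (show -(1 - p) ≤ 0 by linarith [hp.2]) hp'.le
      linarith
  · have e : ⟪ξ, medium hc a ξ⟫_ℂ =
        a 0 * (‖chi hc 0 ξ‖ ^ 2 : ℝ) + a 1 * (‖chi hc 1 ξ‖ ^ 2 : ℝ) := by
      rw [← inner_apply_of_isStarProjection (isStarProjection_chi (P := P) (m := m) hc 0) ξ,
        ← inner_apply_of_isStarProjection (isStarProjection_chi (P := P) (m := m) hc 1) ξ,
        ← inner_smul_right, ← inner_smul_right, ← inner_add_right]
      rfl
    have hs := norm_sq_eq_chi hc ξ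
    by_cases hξ : ξ = 0
    · simp [hξ]
    · have hpos : 0 < ‖ξ‖ ^ 2 := by positivity
      have hq : ‖chi hc 0 ξ‖ ^ 2 / ‖ξ‖ ^ 2 ∈ Set.Icc (0 : ℝ) 1 :=
        ⟨by positivity, (div_le_one hpos).2 (by nlinarith [sq_nonneg ‖chi hc 1 ξ‖])⟩
      have h := hmin hq
      simp only [Set.mem_ofPred_eq] at h
      have e2 : ⟪ξ, medium hc a ξ⟫_ℂ = (a 0 * (‖chi hc 0 ξ‖ ^ 2 / ‖ξ‖ ^ 2 : ℝ) +
          a 1 * (1 - (‖chi hc 0 ξ‖ ^ 2 / ‖ξ‖ ^ 2 : ℝ))) * (‖ξ‖ ^ 2 : ℝ) := by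
        rw [e, ← hs]
        have : ((‖chi hc 0 ξ‖ ^ 2 + ‖chi hc 1 ξ‖ ^ 2 : ℝ) : ℂ) ≠ 0 := by
          rw [hs]
          exact_mod_cast hpos.ne'
        push_cast at this ⊢
        field_simp
        ring
      rw [e2, norm_mul, Complex.norm_real, Real.norm_of_nonneg hpos.le]
      exact mul_le_mul_of_nonneg_right h hpos.le

section Compression

variable {d : ℕ} {Λ : VField P d →L[ℂ] VField P d}

theorem compression_apply (i : Fin 2) (ξ : VField P d) :
    compression hc Λ i ξ = chi hc i (Λ (chi hc i ξ)) := rfl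

theorem inner_compression (hΛ : IsStarProjection Λ) (i : Fin 2) (ξ : VField P d) :
    ⟪ξ, compression hc Λ i ξ⟫_ℂ = ((‖Λ (chi hc i ξ)‖ ^ 2 : ℝ) : ℂ) := by
  rw [compression_apply, inner_apply_of_isSelfAdjoint (isStarProjection_chi hc i).isSelfAdjoint,
    inner_apply_of_isStarProjection hΛ]

theorem isPositive_compression (hΛ : IsStarProjection Λ) (i : Fin 2) :
    (compression hc Λ i).IsPositive := by
  have hsa : IsSelfAdjoint (compression hc Λ i) := isSelfAdjoint_of_inner fun x y => by
    have hχ := (isStarProjection_chi (P := P) (m := d) hc i).isSelfAdjoint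
    rw [compression_apply, compression_apply, inner_apply_of_isSelfAdjoint hχ,
      inner_apply_of_isSelfAdjoint hΛ.isSelfAdjoint, inner_apply_of_isSelfAdjoint hχ]
  refine ⟨hsa.isSymmetric, fun x => ?_⟩
  rw [ContinuousLinearMap.reApplyInnerSelf_apply, ← inner_apply_of_isSelfAdjoint hsa,
    inner_compression hc hΛ]
  exact sq_nonneg ‖Λ (chi hc i x)‖

theorem norm_compression_le (hΛ : IsStarProjection Λ) (i : Fin 2) :
    ‖compression hc Λ i‖ ≤ 1 := by
  have h1 := norm_le_one_of_isStarProjection (isStarProjection_chi (P := P) (m := d) hc i)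
  have h2 := norm_le_one_of_isStarProjection hΛ
  calc ‖compression hc Λ i‖ ≤ ‖chi (P := P) (m := d) hc i * Λ‖ * ‖chi (P := P) (m := d) hc i‖ :=
        norm_mul_le _ _
    _ ≤ ‖chi (P := P) (m := d) hc i‖ * ‖Λ‖ * ‖chi (P := P) (m := d) hc i‖ := by
        gcongr; exact norm_mul_le _ _
    _ ≤ 1 * 1 * 1 := by gcongr
    _ = 1 := by norm_num

theorem commute_compression_chi (i : Fin 2) : Commute (compression hc Λ i) (chi hc i) := by
  have h := (isStarProjection_chi (P := P) (m := d) hc i).isIdempotentElem.eq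
  change chi hc i * Λ * chi hc i * chi hc i = chi hc i * (chi hc i * Λ * chi hc i)
  rw [mul_assoc, h, ← mul_assoc, ← mul_assoc, h]

/-- If `1 / (1 - h) = l` with `0 < l ≤ 1`, then `h = 1 - 1 / l ≤ 0`. The second alternative is the
homogeneous medium `h = 1`, where division gives the junk value `0`. -/
theorem one_div_notMem {h : ℂ} (hh : h ∈ Complex.slitPlane) :
    1 / (1 - h) ∉ Complex.ofReal '' Set.Icc 0 1 ∨ 1 - h = 0 := by
  by_cases hz : 1 - h = 0
  · exact Or.inr hz
  · refine Or.inl ?_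
    rintro ⟨l, hl, hle⟩
    have hl0 : l ≠ 0 := fun h0 => by
      rw [h0, Complex.ofReal_zero] at hle
      exact one_div_ne_zero hz hle.symm
    have e : h = ((1 - 1 / l : ℝ) : ℂ) := by
      push_cast
      rw [hle, one_div_one_div]
      ring
    rw [e, Complex.ofReal_mem_slitPlane] at hh
    have hpos : 0 < l := lt_of_le_of_ne hl.1 (Ne.symm hl0)
    have := one_le_one_div hpos hl.2
    linarith

/-- In this form the invertibility includes `h = 1`, where the contrast parameter is not defined;
this is needed for analyticity on the whole slit plane. -/
theorem isUnit_one_sub_smul {K : Type u} [NormedAddCommGroup K] [InnerProductSpace ℂ K]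
    [CompleteSpace K] {T : K →L[ℂ] K} (hT : T.IsPositive) (h1 : ‖T‖ ≤ 1) {h : ℂ}
    (hh : h ∈ Complex.slitPlane) : IsUnit (1 - (1 - h) • T) := by
  rcases one_div_notMem hh with hr | hz
  · by_cases hz : 1 - h = 0
    · rw [hz, zero_smul, sub_zero]
      exact isUnit_one
    · have hu : IsUnit (algebraMap ℂ (K →L[ℂ] K) (1 / (1 - h)) - T) := by
        by_contra hn
        exact hr (spectrumInUnit_of_isPositive hT h1 hn)
      have e : 1 - (1 - h) • T = (1 - h) • (algebraMap ℂ (K →L[ℂ] K) (1 / (1 - h)) - T) := by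
        rw [smul_sub, Algebra.algebraMap_eq_smul_one, smul_smul, mul_one_div_cancel hz, one_smul]
      rw [e]
      exact hu.smul (Units.mk0 (1 - h) hz)
  · rw [hz, zero_smul, sub_zero]
    exact isUnit_one

theorem inverse_one_sub_smul {K : Type u} [NormedAddCommGroup K] [InnerProductSpace ℂ K]
    [CompleteSpace K] {T : K →L[ℂ] K} (hT : T.IsPositive) (h1 : ‖T‖ ≤ 1) {h : ℂ}
    (hh : h ∈ Complex.slitPlane) (hne : 1 - h ≠ 0) :
    1 / (1 - h) ∈ resolventSet ℂ T ∧
    Ring.inverse (1 - (1 - h) • T) = (1 / (1 - h)) • resolvent T (1 / (1 - h)) := by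
  have hr := (one_div_notMem hh).resolve_right hne
  have hu : IsUnit (algebraMap ℂ (K →L[ℂ] K) (1 / (1 - h)) - T) := by
    by_contra hn
    exact hr (spectrumInUnit_of_isPositive hT h1 hn)
  refine ⟨hu, ?_⟩
  have e : 1 - (1 - h) • T = (1 - h) • (algebraMap ℂ (K →L[ℂ] K) (1 / (1 - h)) - T) := by
    rw [smul_sub, Algebra.algebraMap_eq_smul_one, smul_smul, mul_one_div_cancel hne, one_smul]
  have hinv := Ring.inverse_mul_cancel _ (isUnit_one_sub_smul hT h1 hh)
  have h2 : (1 - (1 - h) • T) * ((1 / (1 - h)) • resolvent T (1 / (1 - h))) = 1 := by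
    rw [e, smul_mul_smul_comm, mul_one_div_cancel hne, one_smul]
    exact Ring.mul_inverse_cancel _ hu
  calc Ring.inverse (1 - (1 - h) • T) = Ring.inverse (1 - (1 - h) • T) *
        ((1 - (1 - h) • T) * ((1 / (1 - h)) • resolvent T (1 / (1 - h)))) := by rw [h2, mul_one]
    _ = _ := by rw [← mul_assoc, hinv, one_mul]

end Compression

end Components

/-! ### The field equation as a linear equation for the compressed projection. -/

section FieldProblem

variable {Ω : Type u} [MeasurableSpace Ω] {P : Measure Ω} [IsProbabilityMeasure P] {d : ℕ}
variable {c : Ω → Fin 2} (hc : Measurable c)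

variable (P d) in
theorem constV_eq_sum (a : Fin d → ℂ) : constV P a = ∑ j, a j • basisV P j := by
  refine PiLp.ext fun k => ?_
  have h : (∑ j, a j • basisV P j) k = ∑ j, a j • basisV P j k := by simp
  rw [h, Finset.sum_eq_single k]
  · change Lp.const 2 P (a k) = a k • Lp.const 2 P ((Pi.single k 1 : Fin d → ℂ) k)
    rw [Pi.single_eq_same, ← const_eq_smul]
  · intro j _ hj
    change a j • Lp.const 2 P ((Pi.single j 1 : Fin d → ℂ) k) = 0
    rw [Pi.single_eq_of_ne hj.symm, map_zero, smul_zero]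
  · simp

/-- The data shared by the electric field and current problems: the projection `Λ` onto the
fluctuating fields in `V`, whose orthogonal complement is `W`. -/
structure IsFieldProjection (V W : Submodule ℂ (VField P d))
    (Λ : VField P d →L[ℂ] VField P d) : Prop where
  proj : IsStarProjection Λ
  range_eq : Set.range Λ = fluct V
  const_mem : ∀ a, constV P a ∈ V
  mem_iff : ∀ ζ, ζ ∈ W ↔ ∀ u ∈ fluct V, ⟪u, ζ⟫_ℂ = 0

variable {V W : Submodule ℂ (VField P d)} {Λ : VField P d →L[ℂ] VField P d}

theorem medium_apply_eq {a : Fin 2 → ℂ} {i : Fin 2} (ha : a (1 - i) ≠ 0) (ξ : VField P d) :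
    medium hc a ξ = a (1 - i) • (ξ - (1 - a i / a (1 - i)) • chi hc i ξ) := by
  rw [medium_eq hc ha]
  rfl

theorem meanV_eq_inner (ξ : VField P d) (k : Fin d) : meanV P ξ k = ⟪basisV P k, ξ⟫_ℂ :=
  (inner_basisV ξ k).symm

theorem meanV_eq_of_sub_mem {ξ : VField P d} {a : Fin d → ℂ}
    (h : ξ - constV P a ∈ vec (LinearMap.ker (mean P)) d) : meanV P ξ = a := by
  funext k
  have h1 : mean P (ξ k - Lp.const 2 P (a k)) = 0 := h k
  rw [map_sub, mean_const, sub_eq_zero] at h1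
  exact h1

namespace IsFieldProjection

theorem apply_constV (h : IsFieldProjection V W Λ) (a : Fin d → ℂ) : Λ (constV P a) = 0 :=
  (apply_eq_zero_iff h.proj h.range_eq).2 fun _ hu => inner_constV_eq_zero hu.2 a

/-- Membership in `V` together with the mean says that `Λ U = U - U0`. As `W` is the kernel of `Λ`,
the flux condition says that `Λ U = z Λ χ i U`. Comparing the two gives the equation. -/
theorem isField_iff (h : IsFieldProjection V W Λ) {a : Fin 2 → ℂ} {i : Fin 2}
    (ha : a (1 - i) ≠ 0) (U0 : Fin d → ℂ) (U : VField P d) :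
    IsField hc V W a U0 U ↔
      U = constV P U0 + (1 - a i / a (1 - i)) • Λ (chi hc i U) := by
  set z := 1 - a i / a (1 - i) with hz
  have hW : medium hc a U ∈ W ↔ Λ (U - z • chi hc i U) = 0 := by
    rw [medium_apply_eq hc ha, Submodule.smul_mem_iff _ ha, h.mem_iff,
      apply_eq_zero_iff h.proj h.range_eq]
  constructor
  · intro hU
    have h1 : U - constV P U0 ∈ fluct V := by
      refine ⟨sub_mem hU.mem (h.const_mem _), ?_⟩
      rw [← hU.mean]
      exact sub_constV_mem U
    have h2 := apply_eq_self_of_mem h.proj h.range_eq h1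
    rw [map_sub, h.apply_constV, sub_zero] at h2
    have h3 := hW.1 hU.flux
    rw [map_sub, map_smul, sub_eq_zero] at h3
    rw [← h3, h2]
    abel
  · intro hU
    have hm : z • Λ (chi hc i U) ∈ fluct V :=
      Submodule.smul_mem _ _ (apply_mem_of_range_eq h.range_eq _)
    refine ⟨?_, hW.2 ?_, meanV_eq_of_sub_mem ?_⟩
    · rw [hU]
      exact add_mem (h.const_mem _) hm.1
    · have h2 : Λ U = z • Λ (chi hc i U) := by
        conv_lhs => rw [hU]
        rw [map_add, h.apply_constV, zero_add, apply_eq_self_of_mem h.proj h.range_eq hm]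
      rw [map_sub, map_smul, h2, sub_self]
    · have : U - constV P U0 = z • Λ (chi hc i U) := by
        conv_lhs => rw [hU]
        abel
      rw [this]
      exact hm.2

theorem isUnit (h : IsFieldProjection V W Λ) {a : Fin 2 → ℂ} (ha : Admissible a) (i : Fin 2) :
    IsUnit (1 - (1 - a i / a (1 - i)) • compression hc Λ i) :=
  isUnit_one_sub_smul (isPositive_compression hc h.proj i) (norm_compression_le hc h.proj i)
    (ha.div_mem i)

/-- Multiplying the equation of `isField_iff` by `χ i` closes it in the unknown `χ i U` alone. -/
theorem chi_apply_of_isField (h : IsFieldProjection V W Λ) {a : Fin 2 → ℂ} (ha : Admissible a)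
    (i : Fin 2) {U0 : Fin d → ℂ} {U : VField P d} (hU : IsField hc V W a U0 U) :
    chi hc i U = Ring.inverse (1 - (1 - a i / a (1 - i)) • compression hc Λ i)
      (chi hc i (constV P U0)) := by
  have h1 := (h.isField_iff hc (ha.ne_zero (1 - i)) U0 U).1 hU
  set z := 1 - a i / a (1 - i) with hz
  have h2 : (1 - z • compression hc Λ i) (chi hc i U) = chi hc i (constV P U0) := by
    change chi hc i U - z • compression hc Λ i (chi hc i U) = _
    rw [compression_apply, chi_apply_apply, sub_eq_iff_eq_add]
    conv_lhs => rw [h1]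
    rw [map_add, map_smul]
  rw [← h2]
  exact (DFunLike.congr_fun (Ring.inverse_mul_cancel _ (h.isUnit hc ha i)) (chi hc i U)).symm

/-- The compressed equation is solved for `w`, which plays the role of `χ i U`, and the field is
then recovered as `U0 + z Λ w`. -/
theorem exists_isField (h : IsFieldProjection V W Λ) {a : Fin 2 → ℂ} (ha : Admissible a)
    (i : Fin 2) (U0 : Fin d → ℂ) : ∃ U, IsField hc V W a U0 U := by
  set z := 1 - a i / a (1 - i) with hz
  set w := Ring.inverse (1 - z • compression hc Λ i) (chi hc i (constV P U0)) with hw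
  have h1 : (1 - z • compression hc Λ i) w = chi hc i (constV P U0) :=
    DFunLike.congr_fun (Ring.mul_inverse_cancel _ (h.isUnit hc ha i)) _
  have h2 : w = chi hc i (constV P U0) + z • chi hc i (Λ (chi hc i w)) :=
    sub_eq_iff_eq_add.1 h1
  -- Both terms of `h2` are multiples of `χ i`, so `w` really is supported in component `i`.
  have h3 : chi hc i w = w := by
    conv_lhs => rw [h2]
    rw [map_add, map_smul, chi_apply_apply, chi_apply_apply, ← h2]
  refine ⟨constV P U0 + z • Λ w, (h.isField_iff hc (ha.ne_zero (1 - i)) U0 _).2 ?_⟩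
  have h4 : chi hc i (constV P U0 + z • Λ w) = w := by
    rw [map_add, map_smul]
    conv_rhs => rw [h2, h3]
  rw [h4]

theorem existsUnique (h : IsFieldProjection V W Λ) {a : Fin 2 → ℂ} (ha : Admissible a)
    (U0 : Fin d → ℂ) : ∃! U, IsField hc V W a U0 U := by
  obtain ⟨U, hU⟩ := h.exists_isField hc ha 0 U0
  refine ⟨U, hU, fun U' hU' => ?_⟩
  rw [(h.isField_iff hc (ha.ne_zero (1 - 0)) U0 U).1 hU,
    (h.isField_iff hc (ha.ne_zero (1 - 0)) U0 U').1 hU',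
    h.chi_apply_of_isField hc ha 0 hU, h.chi_apply_of_isField hc ha 0 hU']

theorem isField_theField (h : IsFieldProjection V W Λ) {a : Fin 2 → ℂ} (ha : Admissible a)
    (U0 : Fin d → ℂ) : IsField hc V W a U0 (theField hc V W a U0) :=
  Classical.epsilon_spec (h.existsUnique hc ha U0).exists

theorem meanV_medium (h : IsFieldProjection V W Λ) {a : Fin 2 → ℂ} (ha : Admissible a)
    (i : Fin 2) {U0 : Fin d → ℂ} {U : VField P d} (hU : IsField hc V W a U0 U) (k : Fin d) :
    meanV P (medium hc a U) k = a (1 - i) * (U0 k - (1 - a i / a (1 - i)) *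
      ⟪basisV P k, Ring.inverse (1 - (1 - a i / a (1 - i)) • compression hc Λ i)
        (chi hc i (constV P U0))⟫_ℂ) := by
  rw [meanV_eq_inner, medium_apply_eq hc (ha.ne_zero (1 - i)), inner_smul_right, inner_sub_right,
    inner_smul_right, h.chi_apply_of_isField hc ha i hU, ← meanV_eq_inner, hU.mean]

theorem effComp_eq (h : IsFieldProjection V W Λ) {a : Fin 2 → ℂ} (ha : Admissible a)
    (i : Fin 2) (j k : Fin d) :
    effComp hc V W a j k = a (1 - i) * ((if j = k then 1 else 0) - (1 - a i / a (1 - i)) *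
      ⟪basisV P k, Ring.inverse (1 - (1 - a i / a (1 - i)) • compression hc Λ i)
        (chi hc i (basisV P j))⟫_ℂ) := by
  have h1 := h.meanV_medium hc ha i (h.isField_theField hc ha (Pi.single j 1)) k
  refine h1.trans ?_
  rw [Pi.single_apply]
  simp only [eq_comm (a := k)]
  rfl

theorem fieldClaims (h : IsFieldProjection V W Λ) : FieldClaims hc V W where
  coercive a ha := by
    obtain ⟨κ, h0, h1⟩ := coercive_medium (P := P) (m := d) hc ha
    exact ⟨κ, h0, fun ξ _ => h1 ξ⟩
  exists_unique a ha := h.existsUnique hc ha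
  effective a ha U0 U hU := by
    funext k
    have h1 : ∀ j, effMatrix hc V W a k j = effComp hc V W a j k := fun _ => rfl
    rw [h.meanV_medium hc ha 0 hU, Matrix.mulVec_eq_sum, Finset.sum_apply, constV_eq_sum,
      map_sum, map_sum, inner_sum]
    simp only [Pi.smul_apply, Matrix.transpose_apply, h1, h.effComp_eq hc ha 0, map_smul,
      inner_smul_right, MulOpposite.smul_eq_mul_unop, MulOpposite.unop_op]
    generalize 1 - a 0 / a (1 - 0) = z
    generalize a (1 - 0) = b
    have h2 : U0 k = ∑ j, (if j = k then 1 else 0) * U0 j := by simp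
    rw [h2, Finset.mul_sum, ← Finset.sum_sub_distrib, Finset.mul_sum]
    exact Finset.sum_congr rfl fun j _ => by ring
  analytic i b hb j k := by
    intro h0 hh0
    have hw : ∀ z : ℂ, withContrast i b z i = b * z ∧ withContrast i b z (1 - i) = b := by
      intro z
      have : (1 - i) ≠ i := by
        revert i
        decide
      simp [withContrast, this]
    have hdiv : ∀ z : ℂ, withContrast i b z i / withContrast i b z (1 - i) = z := fun z => by
      rw [(hw z).1, (hw z).2, mul_div_cancel_left₀ _ hb]
    -- Admissibility is stated for the ratio of component `0` to component `1`; for `i = 1` the two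
    -- labels are exchanged.
    have hadm : ∀ z ∈ Complex.slitPlane, Admissible (withContrast i b z) := by
      intro z hz
      have h1 : ∀ a : Fin 2 → ℂ, a i / a (1 - i) ∈ Complex.slitPlane → Admissible a := by
        intro a ha
        fin_cases i
        · exact ha
        · have h3 : Admissible fun k => a (1 - k) := ha
          exact h3.div_mem 1
      exact h1 _ (by rwa [hdiv])
    have hu : IsUnit (1 - (1 - h0) • compression hc Λ i) := by
      have := h.isUnit hc (hadm h0 hh0) i
      rwa [hdiv] at this
    have hinv : AnalyticAt ℂ (fun z : ℂ =>
        Ring.inverse (1 - (1 - z) • compression hc Λ i)) h0 := by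
      obtain ⟨v, hv⟩ := hu
      have h1 := analyticAt_inverse (𝕜 := ℂ) v
      rw [hv] at h1
      refine h1.comp_of_eq (f := fun z : ℂ => 1 - (1 - z) • compression hc Λ i) ?_ rfl
      exact analyticAt_const.sub ((analyticAt_const.sub analyticAt_id).smul analyticAt_const)
    have hin : AnalyticAt ℂ (fun z : ℂ => ⟪basisV P k, Ring.inverse
        (1 - (1 - z) • compression hc Λ i) (chi hc i (basisV P j))⟫_ℂ) h0 := by
      have h1 := (((innerSL ℂ (basisV P k)).comp (ContinuousLinearMap.apply ℂ (VField P d)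
        (chi hc i (basisV P j)))).analyticAt _).comp hinv
      exact h1
    have hall : AnalyticAt ℂ (fun z : ℂ => b * ((if j = k then 1 else 0) - (1 - z) *
        ⟪basisV P k, Ring.inverse (1 - (1 - z) • compression hc Λ i)
          (chi hc i (basisV P j))⟫_ℂ)) h0 :=
      analyticAt_const.mul (analyticAt_const.sub
        ((analyticAt_const.sub analyticAt_id).mul hin))
    -- The closed formula for the effective components holds only on the slit plane, but this is
    -- open, so the two functions agree near `h0`.
    refine hall.congr ?_
    filter_upwards [Complex.isOpen_slitPlane.mem_nhds hh0] with z hz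
    rw [h.effComp_eq hc (hadm z hz) i, hdiv, (hw z).2]

end IsFieldProjection

end FieldProblem

/-! ### Complex conjugation, and the reality of the operators. -/

section Conjugation

variable {Ω : Type u} [MeasurableSpace Ω] {P : Measure Ω} [IsProbabilityMeasure P]

variable (P) in
/-- Complex conjugation of scalar fields. -/
def conjS : ScalarField P →L⋆[ℂ] ScalarField P :=
  LinearMap.mkContinuous
    { toFun := fun f => star f
      map_add' := fun f g => by
        refine Lp.ext ?_
        filter_upwards [Lp.coeFn_star (f + g), Lp.coeFn_star f, Lp.coeFn_star g,
          Lp.coeFn_add f g, Lp.coeFn_add (star f) (star g)] with ω h1 h2 h3 h4 h5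
        rw [h1, h5, Pi.add_apply, h2, h3, Pi.star_apply, h4, Pi.add_apply, star_add]
        rfl
      map_smul' := fun a f => by
        refine Lp.ext ?_
        filter_upwards [Lp.coeFn_star (a • f), Lp.coeFn_star f, Lp.coeFn_smul a f,
          Lp.coeFn_smul (star a) (star f)] with ω h1 h2 h3 h4
        change (star (a • f) : ScalarField P) ω = (star a • star f : ScalarField P) ω
        rw [h1, h4, Pi.smul_apply, h2, Pi.star_apply, h3, Pi.smul_apply, smul_eq_mul, star_mul',
          smul_eq_mul]
        rfl } 1 fun f => by
      rw [one_mul]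
      refine Lp.norm_le_norm_of_ae_le ?_
      filter_upwards [Lp.coeFn_star f] with ω h
      change ‖(star f : ScalarField P) ω‖ ≤ _
      rw [h, Pi.star_apply, norm_star]

theorem coeFn_conjS (f : ScalarField P) : (conjS P f : Ω → ℂ) =ᵐ[P] star f := Lp.coeFn_star f

theorem conjS_conjS (f : ScalarField P) : conjS P (conjS P f) = f := star_star f

theorem inner_conjS (f g : ScalarField P) : ⟪conjS P f, conjS P g⟫_ℂ = ⟪g, f⟫_ℂ := by
  rw [L2.inner_def, L2.inner_def]
  refine integral_congr_ae ?_
  filter_upwards [coeFn_conjS f, coeFn_conjS g] with ω h1 h2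
  rw [h1, h2, Pi.star_apply, Pi.star_apply, RCLike.inner_apply, RCLike.inner_apply, mul_comm]
  simp

theorem conjS_const (a : ℂ) : conjS P (Lp.const 2 P a) = Lp.const 2 P (star a) := by
  refine Lp.ext ?_
  filter_upwards [coeFn_conjS (Lp.const 2 P a), Lp.coeFn_const (p := 2) (μ := P) a,
    Lp.coeFn_const (p := 2) (μ := P) (star a)] with ω h1 h2 h3
  rw [h1, h3, Pi.star_apply, h2]
  rfl

theorem conjS_indicatorOp {S : Set Ω} (hS : MeasurableSet S) (f : ScalarField P) :
    conjS P (indicatorOp hS f) = indicatorOp hS (conjS P f) := by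
  refine Lp.ext ?_
  filter_upwards [coeFn_conjS (indicatorFun hS f), coeFn_conjS f, coeFn_indicatorFun hS f,
    coeFn_indicatorFun hS (conjS P f)] with ω h1 h2 h3 h4
  change conjS P (indicatorFun hS f) ω = indicatorFun hS (conjS P f) ω
  rw [h1, h4, Pi.star_apply, h3]
  by_cases h : ω ∈ S
  · rw [Set.indicator_of_mem h, Set.indicator_of_mem h, h2, Pi.star_apply]
  · rw [Set.indicator_of_notMem h, Set.indicator_of_notMem h, star_zero]

theorem mean_conjS (f : ScalarField P) : mean P (conjS P f) = star (mean P f) := by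
  have h : (Lp.const 2 P 1 : ScalarField P) = conjS P (Lp.const 2 P 1) := by
    rw [conjS_const, star_one]
  rw [mean_eq_inner, mean_eq_inner, h, inner_conjS, ← h]
  exact (inner_conj_symm _ _).symm

variable (P) in
/-- Complex conjugation of vector fields. -/
def conjV (m : ℕ) : VField P m →L⋆[ℂ] VField P m where
  toFun ξ := WithLp.toLp 2 fun k => conjS P (ξ k)
  map_add' ξ ζ := PiLp.ext fun k => map_add (conjS P) (ξ k) (ζ k)
  map_smul' a ξ := PiLp.ext fun k => map_smulₛₗ (conjS P) a (ξ k)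
  cont := continuous_iff_continuousAt.2 fun ξ => tendsto_vfield fun k =>
    ((conjS P).continuous.comp (continuous_coord k)).tendsto ξ

variable {m : ℕ}

theorem conjV_apply (ξ : VField P m) (k : Fin m) : conjV P m ξ k = conjS P (ξ k) := rfl

theorem conjV_conjV (ξ : VField P m) : conjV P m (conjV P m ξ) = ξ :=
  PiLp.ext fun k => conjS_conjS (ξ k)

theorem inner_conjV (ξ ζ : VField P m) : ⟪conjV P m ξ, conjV P m ζ⟫_ℂ = ⟪ζ, ξ⟫_ℂ := by
  rw [inner_vfield, inner_vfield]
  exact Finset.sum_congr rfl fun k _ => inner_conjS _ _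

theorem conjV_basisV (j : Fin m) : conjV P m (basisV P j) = basisV P j := by
  refine PiLp.ext fun k => ?_
  refine (conjS_const _).trans (congrArg (Lp.const 2 P) ?_)
  by_cases h : k = j
  · subst h
    simp
  · simp [h]

theorem conjV_chi {c : Ω → Fin 2} (hc : Measurable c) (i : Fin 2) (ξ : VField P m) :
    conjV P m (chi hc i ξ) = chi hc i (conjV P m ξ) :=
  PiLp.ext fun k => conjS_indicatorOp (hc (measurableSet_singleton i)) (ξ k)

/-- Conjugation preserves `S` and reverses inner products, so it also preserves orthogonality to
`S`. -/
theorem conjV_apply_of_range {S : Submodule ℂ (VField P m)} {A : VField P m →L[ℂ] VField P m}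
    (hA : IsStarProjection A) (hr : Set.range A = S) (hS : ∀ ξ ∈ S, conjV P m ξ ∈ S)
    (ξ : VField P m) : conjV P m (A ξ) = A (conjV P m ξ) := by
  refine (apply_eq_of_inner hA hr (hS _ (apply_mem_of_range_eq hr ξ)) fun u hu => ?_).symm
  rw [← map_sub, ← conjV_conjV u, inner_conjV, ← inner_conj_symm,
    inner_sub_apply_eq_zero hA hr (hS u hu), map_zero]

variable {d : ℕ} [AddAction (Fin d → ℝ) Ω] [MeasurableConstVAdd (Fin d → ℝ) Ω]
variable [VAddInvariantMeasure (Fin d → ℝ) Ω P]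

theorem conjS_translate (x : Fin d → ℝ) (f : ScalarField P) :
    conjS P (translate P d x f) = translate P d x (conjS P f) := by
  have hm := measurePreserving_vadd (-x) P
  refine Lp.ext ?_
  filter_upwards [coeFn_conjS (translate P d x f), Lp.coeFn_compMeasurePreserving f hm,
    Lp.coeFn_compMeasurePreserving (conjS P f) hm,
    hm.quasiMeasurePreserving.ae_eq_comp (coeFn_conjS f)] with ω h1 h2 h3 h4
  refine h1.trans (Eq.trans ?_ h3.symm)
  refine Eq.trans ?_ h4.symm
  exact congrArg star h2

theorem hasDerivAt_conjS {f : ScalarField P} (hf : f ∈ D1 P d) (i : Fin d) :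
    HasDerivAt (fun t : ℝ => translate P d (Pi.single i t) (conjS P f))
      (conjS P (L P d i f)) 0 := by
  have h := ((conjS P : ScalarField P →+ ScalarField P).toRealLinearMap
    (conjS P).continuous).hasFDerivAt.comp_hasDerivAt 0 (hasDerivAt_translate hf i)
  simp only [← conjS_translate]
  exact h

theorem conjS_mem_D1 {f : ScalarField P} (hf : f ∈ D1 P d) : conjS P f ∈ D1 P d :=
  fun i => (hasDerivAt_conjS hf i).differentiableAt

theorem L_conjS {f : ScalarField P} (hf : f ∈ D1 P d) (i : Fin d) :
    L P d i (conjS P f) = conjS P (L P d i f) := (hasDerivAt_conjS hf i).deriv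

theorem inner_L_conjS {f : ScalarField P} (hf : f ∈ D1 P d) (i : Fin d) (g : ScalarField P) :
    ⟪L P d i f, conjS P g⟫_ℂ = star ⟪L P d i (conjS P f), g⟫_ℂ := by
  rw [L_conjS hf, ← inner_conjS (conjS P g), conjS_conjS]
  exact (inner_conj_symm _ _).symm

theorem conjV_mem_fluct {V : Submodule ℂ (VField P d)} (hV : ∀ ξ ∈ V, conjV P d ξ ∈ V)
    {ξ : VField P d} (hξ : ξ ∈ fluct V) : conjV P d ξ ∈ fluct V :=
  ⟨hV ξ hξ.1, fun k => by
    have h : mean P (ξ k) = 0 := hξ.2 k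
    exact (mean_conjS (ξ k)).trans (by rw [h, star_zero])⟩

theorem conjV_mem_CurlFree {ξ : VField P d} (hξ : ξ ∈ CurlFree P d) :
    conjV P d ξ ∈ CurlFree P d := fun i j f hf => by
  rw [conjV_apply, conjV_apply, inner_L_conjS hf, inner_L_conjS hf, hξ i j _ (conjS_mem_D1 hf)]

theorem conjV_mem_DivFree {ξ : VField P d} (hξ : ξ ∈ DivFree P d) :
    conjV P d ξ ∈ DivFree P d := fun f hf => by
  have h := congrArg star (hξ _ (conjS_mem_D1 hf))
  rw [star_sum, star_zero] at h
  rw [← h]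
  exact Finset.sum_congr rfl fun i _ => inner_L_conjS hf i (ξ i)

end Conjugation

/-! ### Density of the differentiable fields. -/

section Density

variable {Ω : Type u} [MeasurableSpace Ω] {P : Measure Ω} [IsProbabilityMeasure P]
variable {d : ℕ} [AddAction (Fin d → ℝ) Ω] [MeasurableConstVAdd (Fin d → ℝ) Ω]

theorem mem_topologicalClosure_vec_D2 [VAddInvariantMeasure (Fin d → ℝ) Ω P]
    (hT : ∀ f : ScalarField P, Continuous (fun x : Fin d → ℝ => translate P d x f)) {m : ℕ}
    (ξ : VField P m) : ξ ∈ (vec (D2 P d) m).topologicalClosure := by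
  obtain ⟨J, -, hs, hlim⟩ := exists_mollifier hT
  exact mem_closure_of_tendsto (tendsto_vfield (f := fun n => componentwise m (J n) ξ)
    fun k => hlim (ξ k)) (Eventually.of_forall fun n k => smooth.mem_D2 (hs n (ξ k)))

theorem vec_mono {S S' : Submodule ℂ (ScalarField P)} (h : S ≤ S') (m : ℕ) : vec S m ≤ vec S' m :=
  fun _ hξ k => h (hξ k)

theorem D2_le_D1 [VAddInvariantMeasure (Fin d → ℝ) Ω P] : D2 P d ≤ D1 P d := fun _ h => h.1

variable [ErgodicVAdd (Fin d → ℝ) Ω P]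

theorem mem_topologicalClosure_H2
    (hT : ∀ f : ScalarField P, Continuous (fun x : Fin d → ℝ => translate P d x f))
    {ξ : VField P d} (hξ : ξ ∈ vec (LinearMap.ker (mean P)) d) :
    ξ ∈ (H2 P d).topologicalClosure := by
  obtain ⟨J, hJ, hs, hlim⟩ := exists_mollifier hT
  exact mem_closure_of_tendsto (tendsto_vfield (f := fun n => componentwise d (J n) ξ)
    fun k => hlim (ξ k)) (Eventually.of_forall fun n k =>
      ⟨smooth.mem_D2 (hs n (ξ k)), (hJ n).mean_apply_eq_zero (hξ k)⟩)

theorem H2_le_H1 : H2 P d ≤ H1 P d := vec_mono (inf_le_inf_right _ D2_le_D1) d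

theorem essSelfAdjointOn_H1
    (hT : ∀ f : ScalarField P, Continuous (fun x : Fin d → ℝ => translate P d x f))
    {A : VField P d →L[ℂ] VField P d} (hA : IsSelfAdjoint A)
    (h : ∀ ξ ∈ H1 P d, A ξ ∈ vec (LinearMap.ker (mean P)) d) : EssSelfAdjointOn (H1 P d) A :=
  essSelfAdjointOn_of_isSelfAdjoint hA fun ξ hξ =>
    Submodule.topologicalClosure_mono H2_le_H1 (mem_topologicalClosure_H2 hT (h ξ hξ))

end Density

/-! ### Spectral theory of the compressed projections and the effective parameters. -/

section SpectralTheory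

variable {Ω : Type u} [MeasurableSpace Ω] {P : Measure Ω} [IsProbabilityMeasure P]
variable {d : ℕ} [AddAction (Fin d → ℝ) Ω] [MeasurableConstVAdd (Fin d → ℝ) Ω]
variable [ErgodicVAdd (Fin d → ℝ) Ω P]
variable {c : Ω → Fin 2} (hc : Measurable c)

theorem commute_ringInverse {A : Type*} [Ring A] {a b : A} (h : Commute a b) :
    Commute (Ring.inverse a) b := by
  by_cases hu : IsUnit a
  · obtain ⟨v, rfl⟩ := hu
    rw [Ring.inverse_unit]
    exact h.units_inv_left
  · rw [Ring.inverse_non_unit _ hu]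
    exact Commute.zero_left b

/-- A factor `χ i` on the left is free when `B` commutes with it. Thus `⟨Q χ i e_j · e_k⟩` is a
matrix element between `χ i e_j` and `χ i e_k`, to which polarization applies. -/
theorem inner_chi_apply_of_commute {i : Fin 2} {B : VField P d →L[ℂ] VField P d}
    (hB : Commute B (chi hc i)) (ξ ζ : VField P d) :
    ⟪chi hc i ζ, B (chi hc i ξ)⟫_ℂ = ⟪ζ, B (chi hc i ξ)⟫_ℂ := by
  rw [← inner_apply_of_isSelfAdjoint (isStarProjection_chi hc i).isSelfAdjoint]
  have h1 : chi hc i (B (chi hc i ξ)) = B (chi hc i (chi hc i ξ)) :=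
    (DFunLike.congr_fun hB.eq _).symm
  rw [h1, chi_apply_apply]

theorem commute_resolvent_compression_chi (Λ : VField P d →L[ℂ] VField P d) (i : Fin 2) (s : ℂ) :
    Commute (resolvent (compression hc Λ i) s) (chi hc i) :=
  commute_ringInverse (a := algebraMap ℂ _ s - compression hc Λ i)
    (Commute.sub_left (Algebra.commutes s (chi hc i)) (commute_compression_chi hc i))

theorem one_sub_div_ne_zero {a : Fin 2 → ℂ} (ha : Admissible a) {i : Fin 2}
    (hne : a i ≠ a (1 - i)) : 1 - a i / a (1 - i) ≠ 0 := by
  rw [sub_ne_zero, ne_comm, Ne, div_eq_one_iff_eq (ha.ne_zero _)]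
  exact hne

theorem contrast_notMem {a : Fin 2 → ℂ} (ha : Admissible a) {i : Fin 2}
    (hne : a i ≠ a (1 - i)) : contrast a i ∉ Complex.ofReal '' Set.Icc 0 1 :=
  (one_div_notMem (ha.div_mem i)).resolve_right (one_sub_div_ne_zero ha hne)

/-- The factor `1 - a i / a (1 - i)` in the mean flux cancels the contrast parameter in front of the
resolvent. -/
theorem IsFieldProjection.effComp_div_eq {V W : Submodule ℂ (VField P d)}
    {Λ : VField P d →L[ℂ] VField P d} (h : IsFieldProjection V W Λ) {a : Fin 2 → ℂ}
    (ha : Admissible a) {i : Fin 2} (hne : a i ≠ a (1 - i)) (j k : Fin d) :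
    effComp hc V W a j k / a (1 - i) = (if j = k then 1 else 0) -
      ⟪basisV P k, resolvent (compression hc Λ i) (contrast a i) (chi hc i (basisV P j))⟫_ℂ := by
  have hne' := one_sub_div_ne_zero ha hne
  rw [h.effComp_eq hc ha i, mul_div_cancel_left₀ _ (ha.ne_zero _),
    (inverse_one_sub_smul (isPositive_compression hc h.proj i) (norm_compression_le hc h.proj i)
      (ha.div_mem i) hne').2]
  congr 1
  change _ * ⟪basisV P k, (1 / (1 - a i / a (1 - i))) •
    resolvent (compression hc Λ i) _ (chi hc i (basisV P j))⟫_ℂ = _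
  rw [inner_smul_right, ← mul_assoc, mul_one_div_cancel hne', one_mul]
  rfl

theorem IsFieldProjection.spectralClaims
    (hT : ∀ f : ScalarField P, Continuous (fun x : Fin d → ℝ => translate P d x f))
    {V W : Submodule ℂ (VField P d)} {Λ : VField P d →L[ℂ] VField P d}
    (h : IsFieldProjection V W Λ) (hH1 : ∀ ξ ∈ vec (D1 P d) d, Λ ξ ∈ H1 P d)
    (hconj : ∀ ξ, conjV P d (Λ ξ) = Λ (conjV P d ξ)) : SpectralClaims hc V W Λ := by
  have hpos := isPositive_compression hc h.proj
  have hnorm := norm_compression_le hc h.proj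
  refine ⟨fun i => ⟨(hpos i).isSelfAdjoint, hpos i, hnorm i⟩,
    fun i => spectrumInUnit_of_isPositive (hpos i) (hnorm i), fun i => ⟨?_, ?_⟩,
    fun hχ i => ⟨?_, ?_, ?_⟩, fun a ha i hne U0 U hU => ?_, fun i => ?_⟩
  · exact essSelfAdjointOn_of_isSelfAdjoint (hpos i).isSelfAdjoint fun ξ _ =>
      Submodule.topologicalClosure_mono (vec_mono D2_le_D1 d) (mem_topologicalClosure_vec_D2 hT _)
  · exact essSelfAdjointOn_of_isSelfAdjoint (hpos i).isSelfAdjoint fun ξ _ =>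
      mem_topologicalClosure_vec_D2 hT _
  · intro ξ hξ
    exact hχ i _ (hH1 _ fun k => (hχ i ξ hξ k).1)
  · exact essSelfAdjointOn_H1 hT (hpos i).isSelfAdjoint fun ξ hξ k =>
      (hχ i _ (hH1 _ fun k => (hχ i ξ hξ k).1) k).2
  · exact essSelfAdjointOn_of_isSelfAdjoint (hpos i).isSelfAdjoint fun ξ hξ =>
      mem_topologicalClosure_H2 hT fun k =>
        (hχ i _ (hH1 _ fun k => (hχ i ξ (H2_le_H1 hξ) k).1) k).2
  · have hne' := one_sub_div_ne_zero ha hne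
    obtain ⟨h1, h2⟩ := inverse_one_sub_smul (hpos i) (hnorm i) (ha.div_mem i) hne'
    refine ⟨h1, ?_⟩
    rw [h.chi_apply_of_isField hc ha i hU, h2]
    rfl
  · obtain ⟨Q, hQ, -, -⟩ := exists_isResolutionOfIdentity (hpos i) (hnorm i)
    have hQχ : ∀ l, Commute (Q l) (chi hc i) :=
      hQ.commute_of_commute (hpos i) (hnorm i) (commute_compression_chi hc i)
    have hreal : ∀ j k l, (⟪chi hc i (basisV P k), Q l (chi hc i (basisV P j))⟫_ℂ).im = 0 :=
      fun j k l => hQ.inner_im_eq_zero (hpos i) (hnorm i) (conjV P d) conjV_conjV inner_conjV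
        (fun ξ => by
          rw [compression_apply, compression_apply, conjV_chi, hconj, conjV_chi])
        (by rw [conjV_chi, conjV_basisV]) (by rw [conjV_chi, conjV_basisV]) l
    choose μ hμ1 hμ2 hμ3 using fun j k =>
      hQ.exists_signedMeasure (hpos i) (hnorm i) (hreal j k)
    have hstieltjes : ∀ s : ℂ, s ∉ Complex.ofReal '' Set.Icc 0 1 → ∀ j k, _ :=
      fun s hs j k => (inner_chi_apply_of_commute hc (commute_resolvent_compression_chi hc Λ i s)
        (basisV P j) (basisV P k)).symm.trans (hμ3 j k s hs)
    refine ⟨Q, hQ, fun Q' hQ' => hQ.unique (hpos i) (hnorm i) hQ', hQχ, μ, fun j k l => ?_,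
      fun k => hμ2 k k rfl, hstieltjes, fun a ha hne j k => ?_⟩
    · rw [hμ1, inner_chi_apply_of_commute hc (hQχ l)]
      rfl
    · rw [h.effComp_div_eq hc ha hne,
        ← hstieltjes (contrast a i) (contrast_notMem ha hne) j k]

end SpectralTheory

/-! ### The operators `Γ` and `Υ` as closures of their differential formulas. -/

section GammaUpsilon

variable {Ω : Type u} [MeasurableSpace Ω] {P : Measure Ω} [IsProbabilityMeasure P]
variable {d : ℕ} [AddAction (Fin d → ℝ) Ω] [MeasurableConstVAdd (Fin d → ℝ) Ω]

section Invariant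

variable [VAddInvariantMeasure (Fin d → ℝ) Ω P]

theorem gradAdj_add {ξ ζ : VField P d} (hξ : ξ ∈ vec (D1 P d) d) (hζ : ζ ∈ vec (D1 P d) d) :
    gradAdj P d (ξ + ζ) = gradAdj P d ξ + gradAdj P d ζ := by
  rw [gradAdj, gradAdj, gradAdj, ← neg_add, ← Finset.sum_add_distrib]
  exact congrArg _ (Finset.sum_congr rfl fun i _ => L_add P d (hξ i) (hζ i) i)

theorem inner_gradAdj {f : ScalarField P} (hf : f ∈ D1 P d) {ξ : VField P d}
    (hξ : ξ ∈ vec (D1 P d) d) : ⟪f, gradAdj P d ξ⟫_ℂ = ∑ i, ⟪L P d i f, ξ i⟫_ℂ := by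
  rw [gradAdj, inner_neg_right, inner_sum, ← Finset.sum_neg_distrib]
  exact Finset.sum_congr rfl fun i _ => (inner_L hf (hξ i) i).symm

theorem grad_mem_vec_D1 {φ : ScalarField P} (hφ : φ ∈ D2 P d) : grad P d φ ∈ vec (D1 P d) d :=
  fun i => hφ.2 i

theorem Stationary.grad_apply {B : ScalarField P →L[ℂ] ScalarField P} (hB : Stationary d B)
    {f : ScalarField P} (hf : f ∈ D1 P d) : grad P d (B f) = componentwise d B (grad P d f) :=
  PiLp.ext fun i => hB.L_apply hf i

theorem curlCoeff_antisymm : ∀ (d : ℕ) (k : Fin (curlDim d)) (i j : Fin d),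
    curlCoeff d k i j = -curlCoeff d k j i
  | 2, _, i, j => by
    change ((j : ℕ) : ℂ) - (i : ℕ) = -((i : ℕ) - (j : ℕ))
    ring
  | 3, (k : Fin 3), i, j => by
    change ((k : ℕ) - (i : ℕ) : ℂ) * ((i : ℕ) - (j : ℕ) : ℂ) * ((j : ℕ) - (k : ℕ) : ℂ) / 2 =
      -(((k : ℕ) - (j : ℕ) : ℂ) * ((j : ℕ) - (i : ℕ) : ℂ) * ((i : ℕ) - (k : ℕ) : ℂ) / 2)
    ring
  | 0, k, _, _ => k.elim0
  | 1, k, _, _ => k.elim0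
  | _ + 4, k, _, _ => k.elim0

theorem star_curlCoeff : ∀ (d : ℕ) (k : Fin (curlDim d)) (i j : Fin d),
    (starRingEnd ℂ) (curlCoeff d k i j) = curlCoeff d k i j
  | 2, _, i, j => by simp [curlCoeff]
  | 3, (k : Fin 3), i, j => by
    simp only [curlCoeff, map_div₀, map_mul, map_sub, map_natCast, map_ofNat]
  | 0, k, _, _ => k.elim0
  | 1, k, _, _ => k.elim0
  | _ + 4, k, _, _ => k.elim0

/-- The contraction identity for the antisymmetric symbol. It recovers all the differences `L a (ξ
b) - L b (ξ a)` from the curl, and is where the dimension is restricted to two or three. -/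
theorem sum_curlCoeff_mul (hd : d = 2 ∨ d = 3) (i j a b : Fin d) :
    ∑ k, curlCoeff d k i j * curlCoeff d k a b =
      (if i = a ∧ j = b then 1 else 0) - (if i = b ∧ j = a then 1 else 0) := by
  rcases hd with rfl | rfl
  · have h : ∀ i j a b : Fin 2, (((j : ℕ) : ℤ) - (i : ℕ)) * ((b : ℕ) - (a : ℕ)) =
        (if i = a ∧ j = b then 1 else 0) - (if i = b ∧ j = a then 1 else 0) := by decide
    have h1 := congrArg (Int.cast : ℤ → ℂ) (h i j a b)
    push_cast at h1
    rw [← h1]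
    exact Fin.sum_univ_one (M := ℂ) _
  -- Each symbol carries a factor `1 / 2`; clearing both gives the factor `4` and an integer
  -- identity that can be decided.
  · have h : ∀ i j a b : Fin 3, ∑ k : Fin 3, ((((k : ℕ) : ℤ) - (i : ℕ)) * ((i : ℕ) - (j : ℕ)) *
        ((j : ℕ) - (k : ℕ))) * (((k : ℕ) - (a : ℕ)) * ((a : ℕ) - (b : ℕ)) * ((b : ℕ) - (k : ℕ))) =
        4 * ((if i = a ∧ j = b then 1 else 0) - (if i = b ∧ j = a then 1 else 0)) := by decide
    have h1 := congrArg (Int.cast : ℤ → ℂ) (h i j a b)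
    push_cast at h1
    have h2 : ∑ k, curlCoeff 3 k i j * curlCoeff 3 k a b = (1 / 4 : ℂ) * ∑ k : Fin 3,
        ((((k : ℕ) : ℂ) - (i : ℕ)) * ((i : ℕ) - (j : ℕ)) *
        ((j : ℕ) - (k : ℕ))) * (((k : ℕ) - (a : ℕ)) * ((a : ℕ) - (b : ℕ)) *
          ((b : ℕ) - (k : ℕ))) := by
      rw [Finset.mul_sum]
      refine Finset.sum_congr rfl fun (k : Fin 3) _ => ?_
      simp only [curlCoeff]
      ring
    rw [h2, h1]
    ring

theorem curl_apply (ξ : VField P d) (k : Fin (curlDim d)) :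
    curl P d ξ k = ∑ i, ∑ j, curlCoeff d k i j • L P d i (ξ j) := rfl

theorem curlAdj_apply (A : VField P (curlDim d)) (j : Fin d) :
    curlAdj P d A j = -∑ k, ∑ i, curlCoeff d k i j • L P d i (A k) := rfl

theorem curl_add {ξ ζ : VField P d} (hξ : ξ ∈ vec (D1 P d) d) (hζ : ζ ∈ vec (D1 P d) d) :
    curl P d (ξ + ζ) = curl P d ξ + curl P d ζ := by
  refine PiLp.ext fun k => ?_
  rw [PiLp.add_apply, curl_apply, curl_apply, curl_apply, ← Finset.sum_add_distrib]
  refine Finset.sum_congr rfl fun i _ => ?_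
  rw [← Finset.sum_add_distrib]
  refine Finset.sum_congr rfl fun j _ => ?_
  rw [PiLp.add_apply, L_add P d (hξ j) (hζ j), smul_add]

theorem curlAdj_add {A B : VField P (curlDim d)} (hA : A ∈ vec (D1 P d) (curlDim d))
    (hB : B ∈ vec (D1 P d) (curlDim d)) :
    curlAdj P d (A + B) = curlAdj P d A + curlAdj P d B := by
  refine PiLp.ext fun j => ?_
  rw [PiLp.add_apply, curlAdj_apply, curlAdj_apply, curlAdj_apply, ← neg_add,
    ← Finset.sum_add_distrib]
  refine congrArg _ (Finset.sum_congr rfl fun k _ => ?_)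
  rw [← Finset.sum_add_distrib]
  refine Finset.sum_congr rfl fun i _ => ?_
  rw [PiLp.add_apply, L_add P d (hA k) (hB k), smul_add]

theorem curlAdj_smul {A : VField P (curlDim d)} (hA : A ∈ vec (D1 P d) (curlDim d)) (a : ℂ) :
    curlAdj P d (a • A) = a • curlAdj P d A := by
  refine PiLp.ext fun j => ?_
  rw [PiLp.smul_apply, curlAdj_apply, curlAdj_apply, smul_neg, Finset.smul_sum]
  refine congrArg _ (Finset.sum_congr rfl fun k _ => ?_)
  rw [Finset.smul_sum]
  refine Finset.sum_congr rfl fun i _ => ?_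
  rw [PiLp.smul_apply, L_smul P d (hA k), smul_comm]

theorem curlAdj_constV (a : Fin (curlDim d) → ℂ) : curlAdj P d (constV P a) = 0 := by
  refine PiLp.ext fun j => ?_
  rw [curlAdj_apply]
  refine neg_eq_zero.2 (Finset.sum_eq_zero fun k _ => Finset.sum_eq_zero fun i _ => ?_)
  change curlCoeff d k i j • L P d i (Lp.const 2 P (a k)) = 0
  rw [L_const, smul_zero]

theorem constV_mem_vec_D1 {m : ℕ} (a : Fin m → ℂ) : constV P a ∈ vec (D1 P d) m :=
  fun k => const_mem_D1 (a k)

theorem curlAdj_mem_vec_D1 {A : VField P (curlDim d)} (hA : A ∈ vec (D2 P d) (curlDim d)) :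
    curlAdj P d A ∈ vec (D1 P d) d := fun j => by
  rw [curlAdj_apply]
  exact neg_mem (sum_mem fun k _ => sum_mem fun i _ => Submodule.smul_mem _ _ ((hA k).2 i))

theorem Stationary.curlAdj_apply {B : ScalarField P →L[ℂ] ScalarField P} (hB : Stationary d B)
    {A : VField P (curlDim d)} (hA : A ∈ vec (D1 P d) (curlDim d)) :
    curlAdj P d (componentwise _ B A) = componentwise d B (curlAdj P d A) := by
  refine PiLp.ext fun j => ?_
  rw [componentwise_apply, TwoComponent.curlAdj_apply, TwoComponent.curlAdj_apply, map_neg,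
    map_sum]
  refine congrArg _ (Finset.sum_congr rfl fun k _ => ?_)
  rw [map_sum]
  refine Finset.sum_congr rfl fun i _ => ?_
  rw [map_smul, componentwise_apply, hB.L_apply (hA k)]

theorem inner_curlAdj {A : VField P (curlDim d)} (hA : A ∈ vec (D1 P d) (curlDim d))
    {ξ : VField P d} (hξ : ξ ∈ vec (D1 P d) d) :
    ⟪curlAdj P d A, ξ⟫_ℂ = ⟪A, curl P d ξ⟫_ℂ := by
  have h1 : ⟪curlAdj P d A, ξ⟫_ℂ =
      ∑ j, ∑ k, ∑ i, curlCoeff d k i j * ⟪A k, L P d i (ξ j)⟫_ℂ := by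
    rw [inner_vfield]
    refine Finset.sum_congr rfl fun j _ => ?_
    rw [curlAdj_apply, inner_neg_left, sum_inner, ← Finset.sum_neg_distrib]
    refine Finset.sum_congr rfl fun k _ => ?_
    rw [sum_inner, ← Finset.sum_neg_distrib]
    refine Finset.sum_congr rfl fun i _ => ?_
    rw [inner_smul_left, star_curlCoeff, inner_L (hA k) (hξ j), mul_neg, neg_neg]
  have h2 : ⟪A, curl P d ξ⟫_ℂ =
      ∑ k, ∑ i, ∑ j, curlCoeff d k i j * ⟪A k, L P d i (ξ j)⟫_ℂ := by
    rw [inner_vfield]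
    refine Finset.sum_congr rfl fun k _ => ?_
    rw [curl_apply, inner_sum]
    refine Finset.sum_congr rfl fun i _ => ?_
    rw [inner_sum]
    exact Finset.sum_congr rfl fun j _ => inner_smul_right _ _ _
  rw [h1, h2, Finset.sum_comm]
  exact Finset.sum_congr rfl fun k _ => Finset.sum_comm

theorem curl_eq_zero_of_L_comm {ξ : VField P d}
    (h : ∀ i j, L P d i (ξ j) = L P d j (ξ i)) : curl P d ξ = 0 := by
  refine PiLp.ext fun k => ?_
  rw [curl_apply]
  -- A contraction of antisymmetric coefficients with symmetric terms equals its own negative.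
  have h1 : ∑ i, ∑ j, curlCoeff d k i j • L P d i (ξ j) =
      -∑ i, ∑ j, curlCoeff d k i j • L P d i (ξ j) := by
    conv_lhs => rw [Finset.sum_comm]
    rw [← Finset.sum_neg_distrib]
    refine Finset.sum_congr rfl fun i _ => ?_
    rw [← Finset.sum_neg_distrib]
    refine Finset.sum_congr rfl fun j _ => ?_
    rw [h j i, curlCoeff_antisymm, neg_smul]
  have h2 : (2 : ℂ) • ∑ i, ∑ j, curlCoeff d k i j • L P d i (ξ j) = 0 := by
    rw [two_smul]
    exact add_eq_zero_iff_eq_neg.2 h1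
  exact (smul_eq_zero.1 h2).resolve_left two_ne_zero

theorem L_comm_of_curl_eq_zero (hd : d = 2 ∨ d = 3) {ξ : VField P d} (h : curl P d ξ = 0)
    (a b : Fin d) : L P d a (ξ b) = L P d b (ξ a) := by
  have h1 : ∑ k, curlCoeff d k a b • curl P d ξ k = L P d a (ξ b) - L P d b (ξ a) := by
    simp only [curl_apply, Finset.smul_sum, smul_smul]
    rw [Finset.sum_comm]
    simp only [fun i => Finset.sum_comm (s := (Finset.univ : Finset (Fin (curlDim d))))
      (t := (Finset.univ : Finset (Fin d)))
      (f := fun k j => (curlCoeff d k a b * curlCoeff d k i j) • L P d i (ξ j)),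
      ← Finset.sum_smul, sum_curlCoeff_mul hd, sub_smul, Finset.sum_sub_distrib, ite_and,
      ite_smul, one_smul, zero_smul, Finset.sum_ite_eq, Finset.mem_univ, if_true]
    simp
  rw [h] at h1
  rw [← sub_eq_zero, ← h1]
  exact Finset.sum_eq_zero fun k _ => smul_zero _

theorem mem_CurlFree_of_curl_eq_zero (hd : d = 2 ∨ d = 3) {ξ : VField P d}
    (hξ : ξ ∈ vec (D1 P d) d) (h : curl P d ξ = 0) : ξ ∈ CurlFree P d := fun i j f hf => by
  rw [inner_L hf (hξ j), inner_L hf (hξ i), L_comm_of_curl_eq_zero hd h]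

theorem mem_CurlFree_of_inner_curlAdj (hd : d = 2 ∨ d = 3) {ξ : VField P d}
    (h : ∀ A ∈ vec (D1 P d) (curlDim d), ⟪curlAdj P d A, ξ⟫_ℂ = 0) : ξ ∈ CurlFree P d := by
  intro a b f hf
  -- By the contraction identity `(∇×)*` of this field has component `-L a f` in direction `b` and
  -- `L b f` in direction `a`, so orthogonality to it is the weak equation for the pair `a b`.
  let A : VField P (curlDim d) := WithLp.toLp 2 fun k => curlCoeff d k a b • f
  have h1 := h A fun k => Submodule.smul_mem _ _ hf
  have h2 : ∀ j, curlAdj P d A j = (if b = j then -L P d a f else 0) +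
      (if a = j then L P d b f else 0) := by
    intro j
    have h3 : ∀ k i, curlCoeff d k i j • L P d i (A k) =
        (curlCoeff d k i j * curlCoeff d k a b) • L P d i f := fun k i => by
      change _ • L P d i (curlCoeff d k a b • f) = _
      rw [L_smul P d hf, smul_smul]
    rw [curlAdj_apply]
    simp only [h3]
    rw [Finset.sum_comm]
    simp only [← Finset.sum_smul, sum_curlCoeff_mul hd, sub_smul, Finset.sum_sub_distrib, ite_and,
      ite_smul, one_smul, zero_smul, Finset.sum_ite_eq', Finset.mem_univ, if_true]
    simp only [eq_comm (a := j)]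
    split_ifs <;> simp
    abel
  have h4 : ∀ j, ⟪curlAdj P d A j, ξ j⟫_ℂ = (if b = j then -⟪L P d a f, ξ j⟫_ℂ else 0) +
      (if a = j then ⟪L P d b f, ξ j⟫_ℂ else 0) := fun j => by
    rw [h2, inner_add_left]
    congr 1 <;> split_ifs <;> simp
  rw [inner_vfield] at h1
  simp only [h4, Finset.sum_add_distrib, Finset.sum_ite_eq, Finset.mem_univ, if_true] at h1
  linear_combination -h1

end Invariant

variable [ErgodicVAdd (Fin d → ℝ) Ω P]

theorem exists_gamma
    (hT : ∀ f : ScalarField P, Continuous (fun x : Fin d → ℝ => translate P d x f)) :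
    ∃ Γ : VField P d →L[ℂ] VField P d, IsFieldProjection (CurlFree P d) (DivFree P d) Γ ∧
      (∀ ξ, conjV P d (Γ ξ) = Γ (conjV P d ξ)) ∧ ∀ ξ ∈ vec (D1 P d) d, Γ ξ ∈ H1 P d := by
  obtain ⟨Γ, hΓ, hr⟩ := exists_isStarProjection
    (isClosed_fluct (isClosed_CurlFree (P := P) (d := d)))
  exact ⟨Γ, ⟨hΓ, hr, constV_mem_CurlFree, fun ζ => mem_DivFree_iff hT⟩,
    conjV_apply_of_range hΓ hr fun ξ => conjV_mem_fluct fun ζ => conjV_mem_CurlFree,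
    fun ξ hξ k => ⟨(stationaryV_of_range hΓ hr
      fun x ξ => translate_mem_fluct_CurlFree x).mem_D1 hξ k, (apply_mem_of_range_eq hr ξ).2 k⟩⟩

theorem exists_upsilon
    (hT : ∀ f : ScalarField P, Continuous (fun x : Fin d → ℝ => translate P d x f)) :
    ∃ Υ : VField P d →L[ℂ] VField P d, IsFieldProjection (DivFree P d) (CurlFree P d) Υ ∧
      (∀ ξ, conjV P d (Υ ξ) = Υ (conjV P d ξ)) ∧ ∀ ξ ∈ vec (D1 P d) d, Υ ξ ∈ H1 P d := by
  obtain ⟨Υ, hΥ, hr⟩ := exists_isStarProjection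
    (isClosed_fluct (isClosed_DivFree (P := P) (d := d)))
  exact ⟨Υ, ⟨hΥ, hr, constV_mem_DivFree, fun ζ => mem_CurlFree_iff hT⟩,
    conjV_apply_of_range hΥ hr fun ξ => conjV_mem_fluct fun ζ => conjV_mem_DivFree,
    fun ξ hξ k => ⟨(stationaryV_of_range hΥ hr
      fun x ξ => translate_mem_fluct_DivFree x).mem_D1 hξ k, (apply_mem_of_range_eq hr ξ).2 k⟩⟩

theorem IsFieldProjection.essSelfAdjointOn
    (hT : ∀ f : ScalarField P, Continuous (fun x : Fin d → ℝ => translate P d x f))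
    {V W : Submodule ℂ (VField P d)} {Λ : VField P d →L[ℂ] VField P d}
    (h : IsFieldProjection V W Λ) : EssSelfAdjointOn (H1 P d) Λ :=
  essSelfAdjointOn_H1 hT h.proj.isSelfAdjoint fun ξ _ => (apply_mem_of_range_eq h.range_eq ξ).2

/-- A field is the sum of a divergence-free field `η` and an element of the range of `Γ`, which is a
limit of gradients. After mollification `η` has zero divergence in the strong sense, so `η + ∇φ` is
paired with `∇φ` in the differential graph itself. Conversely, the equation `∇*∇ φ = ∇* ξ` says that
`ξ - ∇φ` is weakly divergence-free. -/
theorem graph_gamma_eq_closure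
    (hT : ∀ f : ScalarField P, Continuous (fun x : Fin d → ℝ => translate P d x f))
    {Γ : VField P d →L[ℂ] VField P d} (hΓ : IsFieldProjection (CurlFree P d) (DivFree P d) Γ) :
    {p : VField P d × VField P d | p.2 = Γ p.1} = closure (gammaGraph P d) := by
  have hcl : IsClosed {p : VField P d × VField P d | p.2 = Γ p.1} :=
    isClosed_eq continuous_snd (Γ.continuous.comp continuous_fst)
  refine Set.Subset.antisymm ?_ (closure_minimal ?_ hcl)
  · obtain ⟨J, hJ, hs, hlim⟩ := exists_mollifier hT
    have key : ∀ η ∈ DivFree P d, ∀ x ∈ (gradRange P d).topologicalClosure,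
        (η + x, x) ∈ closure (gammaGraph P d) := by
      intro η hη x hx
      refine closure_minimal (t := {x | (η + x, x) ∈ closure (gammaGraph P d)}) ?_
        (isClosed_closure.preimage (by fun_prop)) hx
      rintro _ ⟨ψ, hψ, rfl⟩
      have hlimV : ∀ ζ : VField P d, Tendsto (fun n => componentwise d (J n) ζ) atTop (𝓝 ζ) :=
        fun ζ => tendsto_vfield fun k => hlim (ζ k)
      refine mem_closure_of_tendsto (((hlimV η).add (hlimV (grad P d ψ))).prodMk_nhds
        (hlimV (grad P d ψ))) (Eventually.of_forall fun n => ?_)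
      have hηn : componentwise d (J n) η ∈ vec (D1 P d) d := fun k => smooth.mem_D1 (hs n (η k))
      have hφ : J n ψ ∈ D2 P d := smooth.mem_D2 (hs n ψ)
      rw [← (hJ n).grad_apply hψ.1]
      refine ⟨add_mem hηn (grad_mem_vec_D1 hφ), J n ψ,
        ⟨hφ, (hJ n).mean_apply_eq_zero hψ.2⟩, ?_, rfl⟩
      have h0 : gradAdj P d (componentwise d (J n) η) = 0 :=
        neg_eq_zero.2 (sum_L_of_mem_DivFree (fun k => hs n (η k))
          ((hJ n).componentwise_mem_DivFree hη))
      exact ((gradAdj_add hηn (grad_mem_vec_D1 hφ)).trans (by rw [h0, zero_add])).symm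
    rintro ⟨ξ, ζ⟩ (rfl : ζ = Γ ξ)
    have h1 := key (ξ - Γ ξ) ((hΓ.mem_iff _).2 fun u hu =>
      inner_sub_apply_eq_zero hΓ.proj hΓ.range_eq hu ξ) (Γ ξ)
      (fluct_CurlFree_eq_closure hT ▸ apply_mem_of_range_eq hΓ.range_eq ξ)
    rwa [sub_add_cancel] at h1
  · rintro ⟨ξ, ζ⟩ ⟨hξ, φ, hφ, hdiv, rfl⟩
    refine (apply_eq_of_inner hΓ.proj hΓ.range_eq (grad_mem_fluct_CurlFree hT hφ.1.1)
      ((hΓ.mem_iff _).1 fun f hf => ?_)).symm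
    simp only [PiLp.sub_apply, inner_sub_right, Finset.sum_sub_distrib]
    rw [← inner_gradAdj hf hξ, ← inner_gradAdj hf (grad_mem_vec_D1 hφ.1), hdiv, sub_self]

variable (P d) in
/-- The image under `(∇×)*` of the mean-zero differentiable fields. -/
def curlAdjRange : Submodule ℂ (VField P d) where
  carrier := curlAdj P d '' vec (meanZero P (D1 P d)) (curlDim d)
  add_mem' := by
    rintro _ _ ⟨A, hA, rfl⟩ ⟨B, hB, rfl⟩
    exact ⟨A + B, add_mem hA hB, curlAdj_add (fun k => (hA k).1) fun k => (hB k).1⟩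
  zero_mem' := ⟨constV P 0, by
    have : (constV P 0 : VField P (curlDim d)) = 0 := PiLp.ext fun k => map_zero (Lp.constₗ 2 P ℂ)
    rw [this]
    exact zero_mem _, curlAdj_constV 0⟩
  smul_mem' := by
    rintro a _ ⟨A, hA, rfl⟩
    exact ⟨a • A, Submodule.smul_mem _ _ hA, curlAdj_smul (fun k => (hA k).1) a⟩

theorem curlAdj_mem_curlAdjRange {A : VField P (curlDim d)}
    (hA : A ∈ vec (D1 P d) (curlDim d)) : curlAdj P d A ∈ curlAdjRange P d := by
  have hm : A - constV P (meanV P A) ∈ vec (D1 P d) (curlDim d) :=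
    sub_mem hA (constV_mem_vec_D1 _)
  refine ⟨A - constV P (meanV P A), fun k => ⟨hm k, sub_constV_mem A k⟩, ?_⟩
  have h := curlAdj_add hm (constV_mem_vec_D1 (P := P) (d := d) (meanV P A))
  rw [sub_add_cancel, curlAdj_constV, add_zero] at h
  exact h.symm

/-- The divergence of a curl vanishes by antisymmetry of the coefficients; in the weak form only
first derivatives of `A` and of the test function are needed, thanks to `inner_L_L_comm`. -/
theorem curlAdj_mem_fluct_DivFree
    (hT : ∀ f : ScalarField P, Continuous (fun x : Fin d → ℝ => translate P d x f))
    {A : VField P (curlDim d)} (hA : A ∈ vec (D1 P d) (curlDim d)) :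
    curlAdj P d A ∈ fluct (DivFree P d) := by
  refine ⟨fun f hf => ?_, fun j => ?_⟩
  · have h1 : ∀ k, ∑ j, ∑ i, curlCoeff d k i j * ⟪L P d j f, L P d i (A k)⟫_ℂ = 0 := fun k => by
      have h2 : ∑ j, ∑ i, curlCoeff d k i j * ⟪L P d j f, L P d i (A k)⟫_ℂ =
          -∑ j, ∑ i, curlCoeff d k i j * ⟪L P d j f, L P d i (A k)⟫_ℂ := by
        conv_lhs => rw [Finset.sum_comm]
        rw [← Finset.sum_neg_distrib]
        refine Finset.sum_congr rfl fun j _ => ?_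
        rw [← Finset.sum_neg_distrib]
        refine Finset.sum_congr rfl fun i _ => ?_
        rw [inner_L_L_comm hT (hA k) hf, curlCoeff_antisymm, neg_mul]
      linear_combination h2 / 2
    have h3 : ∀ j, ⟪L P d j f, curlAdj P d A j⟫_ℂ =
        -∑ k, ∑ i, curlCoeff d k i j * ⟪L P d j f, L P d i (A k)⟫_ℂ := fun j => by
      rw [curlAdj_apply, inner_neg_right, inner_sum]
      refine congrArg _ (Finset.sum_congr rfl fun k _ => ?_)
      rw [inner_sum]
      exact Finset.sum_congr rfl fun i _ => inner_smul_right _ _ _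
    simp only [h3]
    rw [Finset.sum_neg_distrib, Finset.sum_comm, Finset.sum_eq_zero fun k _ => h1 k, neg_zero]
  · change mean P (curlAdj P d A j) = 0
    rw [curlAdj_apply, map_neg, map_sum]
    refine neg_eq_zero.2 (Finset.sum_eq_zero fun k _ => ?_)
    rw [map_sum]
    refine Finset.sum_eq_zero fun i _ => ?_
    rw [map_smul, mean_L (hA k), smul_zero]

/-- As for gradients: the remainder after projection is divergence-free, and orthogonality to the
range of `(∇×)*` makes it curl-free. -/
theorem fluct_DivFree_eq_closure (hd : d = 2 ∨ d = 3)
    (hT : ∀ f : ScalarField P, Continuous (fun x : Fin d → ℝ => translate P d x f)) :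
    fluct (DivFree P d) = (curlAdjRange P d).topologicalClosure := by
  have hle : (curlAdjRange P d).topologicalClosure ≤ fluct (DivFree P d) :=
    Submodule.topologicalClosure_minimal _ (by
      rintro _ ⟨A, hA, rfl⟩
      exact curlAdj_mem_fluct_DivFree hT fun k => (hA k).1) (isClosed_fluct isClosed_DivFree)
  refine le_antisymm (fun ξ hξ => ?_) hle
  obtain ⟨A, hA, hr⟩ := exists_isStarProjection (curlAdjRange P d).isClosed_topologicalClosure
  have hm := sub_mem hξ (hle (apply_mem_of_range_eq hr ξ))
  have h0 : ξ - A ξ = 0 := by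
    refine eq_zero_of_mem_CurlFree_of_mem_DivFree hT
      ⟨mem_CurlFree_of_inner_curlAdj hd fun B hB => ?_, hm.2⟩ hm.1
    exact inner_sub_apply_eq_zero hA hr
      (Submodule.le_topologicalClosure _ (curlAdj_mem_curlAdjRange hB)) ξ
  rw [sub_eq_zero.1 h0]
  exact apply_mem_of_range_eq hr ξ

variable (P d) in
/-- The kernel of `(∇×)*` on differentiable fields. -/
def curlAdjKer : Submodule ℂ (VField P (curlDim d)) where
  carrier := {B | B ∈ vec (D1 P d) (curlDim d) ∧ curlAdj P d B = 0}
  add_mem' h h' := ⟨add_mem h.1 h'.1, by rw [curlAdj_add h.1 h'.1, h.2, h'.2, add_zero]⟩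
  zero_mem' := ⟨zero_mem _, by
    have h := curlAdj_smul (zero_mem (vec (D1 P d) (curlDim d))) (0 : ℂ)
    rwa [zero_smul, zero_smul] at h⟩
  smul_mem' a _ h := ⟨Submodule.smul_mem _ _ h.1, by rw [curlAdj_smul h.1, h.2, smul_zero]⟩

theorem constV_mem_curlAdjKer (a : Fin (curlDim d) → ℂ) : constV P a ∈ curlAdjKer P d :=
  ⟨constV_mem_vec_D1 a, curlAdj_constV a⟩

/-- Pairing with `curl ξ` shows that `curlAdj A` is orthogonal to every differentiable `ξ`, and
these are dense. So projecting onto the closure of the kernel costs nothing for differentiable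
fields. -/
theorem curlAdj_eq_zero_of_mem_closure
    (hT : ∀ f : ScalarField P, Continuous (fun x : Fin d → ℝ => translate P d x f))
    {A : VField P (curlDim d)} (hA : A ∈ vec (D1 P d) (curlDim d))
    (h : A ∈ (curlAdjKer P d).topologicalClosure) : curlAdj P d A = 0 := by
  have h1 : ∀ ξ ∈ vec (D1 P d) d, ⟪curlAdj P d A, ξ⟫_ℂ = 0 := fun ξ hξ => by
    rw [inner_curlAdj hA hξ]
    refine closure_minimal (t := {A : VField P (curlDim d) | ⟪A, curl P d ξ⟫_ℂ = 0}) ?_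
      (isClosed_eq (by fun_prop) (by fun_prop)) h
    rintro B ⟨hB, hB0⟩
    change ⟪B, curl P d ξ⟫_ℂ = 0
    rw [← inner_curlAdj hB hξ, hB0, inner_zero_left]
  have h2 : curlAdj P d A ∈ {ξ : VField P d | ⟪curlAdj P d A, ξ⟫_ℂ = 0} :=
    closure_minimal (fun ξ hξ => h1 ξ hξ) (isClosed_eq (by fun_prop) (by fun_prop))
      (Submodule.topologicalClosure_mono (vec_mono D2_le_D1 d)
        (mem_topologicalClosure_vec_D2 hT (curlAdj P d A)))
  exact inner_self_eq_zero.1 h2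

/-- Removing the component in the kernel of `(∇×)*` from a vector potential. -/
theorem exists_potential_orthogonal
    (hT : ∀ f : ScalarField P, Continuous (fun x : Fin d → ℝ => translate P d x f))
    {A : VField P (curlDim d)} (hA : A ∈ vec (D2 P d) (curlDim d)) :
    ∃ A' ∈ vec (meanZero P (D2 P d)) (curlDim d),
      (∀ B ∈ vec (D1 P d) (curlDim d), curlAdj P d B = 0 → ⟪B, A'⟫_ℂ = 0) ∧
      curlAdj P d A' = curlAdj P d A := by
  obtain ⟨N, hN, hr⟩ := exists_isStarProjection (curlAdjKer P d).isClosed_topologicalClosure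
  -- The kernel is translation-invariant, so its projection commutes with translations and keeps the
  -- components in `D2`.
  have hstat : StationaryV d N := stationaryV_of_range hN hr fun x ξ hξ => by
    refine map_mem_closure (ContinuousLinearMap.continuous _) hξ fun B hB => ⟨fun k =>
      (stationary_translate x).mem_D1 (hB.1 k), ?_⟩
    rw [(stationary_translate x).curlAdj_apply hB.1, hB.2, map_zero]
  have hA1 : A ∈ vec (D1 P d) (curlDim d) := vec_mono D2_le_D1 _ hA
  have horth : ∀ B ∈ curlAdjKer P d, ⟪B, A - N A⟫_ℂ = 0 := fun B hB =>
    inner_sub_apply_eq_zero hN hr (Submodule.le_topologicalClosure _ hB) A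
  have hD2 : A - N A ∈ vec (D2 P d) (curlDim d) := sub_mem hA (hstat.mem_D2 hA)
  refine ⟨A - N A, fun k => ⟨hD2 k, ?_⟩, fun B hB hB0 => horth B ⟨hB, hB0⟩, ?_⟩
  -- Constant fields lie in the kernel, so orthogonality to it already forces mean zero.
  · change mean P ((A - N A) k) = 0
    rw [← inner_basisV]
    exact horth _ (constV_mem_curlAdjKer _)
  · have h := curlAdj_add (vec_mono D2_le_D1 _ hD2) (hstat.mem_D1 hA1)
    rw [sub_add_cancel, curlAdj_eq_zero_of_mem_closure hT (hstat.mem_D1 hA1)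
      (apply_mem_of_range_eq hr A), add_zero] at h
    exact h.symm

/-- The argument for `Γ` with the roles of curl and divergence exchanged. The new point is the
normalization of the vector potential, which `exists_potential_orthogonal` achieves without changing
`(∇×)* A`. -/
theorem graph_upsilon_eq_closure (hd : d = 2 ∨ d = 3)
    (hT : ∀ f : ScalarField P, Continuous (fun x : Fin d → ℝ => translate P d x f))
    {Υ : VField P d →L[ℂ] VField P d} (hΥ : IsFieldProjection (DivFree P d) (CurlFree P d) Υ) :
    {p : VField P d × VField P d | p.2 = Υ p.1} = closure (upsilonGraph P d) := by
  have hcl : IsClosed {p : VField P d × VField P d | p.2 = Υ p.1} :=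
    isClosed_eq continuous_snd (Υ.continuous.comp continuous_fst)
  refine Set.Subset.antisymm ?_ (closure_minimal ?_ hcl)
  · obtain ⟨J, hJ, hs, hlim⟩ := exists_mollifier hT
    have key : ∀ η ∈ CurlFree P d, ∀ x ∈ (curlAdjRange P d).topologicalClosure,
        (η + x, x) ∈ closure (upsilonGraph P d) := by
      intro η hη x hx
      refine closure_minimal (t := {x | (η + x, x) ∈ closure (upsilonGraph P d)}) ?_
        (isClosed_closure.preimage (by fun_prop)) hx
      rintro _ ⟨A, hA, rfl⟩
      have hA1 : A ∈ vec (D1 P d) (curlDim d) := fun k => (hA k).1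
      have hlimV : ∀ ζ : VField P d, Tendsto (fun n => componentwise d (J n) ζ) atTop (𝓝 ζ) :=
        fun ζ => tendsto_vfield fun k => hlim (ζ k)
      refine mem_closure_of_tendsto (((hlimV η).add (hlimV (curlAdj P d A))).prodMk_nhds
        (hlimV (curlAdj P d A))) (Eventually.of_forall fun n => ?_)
      have hηn : componentwise d (J n) η ∈ vec (D1 P d) d := fun k => smooth.mem_D1 (hs n (η k))
      have hAn : componentwise _ (J n) A ∈ vec (D2 P d) (curlDim d) :=
        fun k => smooth.mem_D2 (hs n (A k))
      obtain ⟨A', hA', horth, hcurl⟩ := exists_potential_orthogonal hT hAn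
      rw [← (hJ n).curlAdj_apply hA1, ← hcurl]
      have hA'1 : curlAdj P d A' ∈ vec (D1 P d) d := curlAdj_mem_vec_D1 fun k => (hA' k).1
      refine ⟨add_mem hηn hA'1, A', hA', horth, ?_, rfl⟩
      have h0 : curl P d (componentwise d (J n) η) = 0 :=
        curl_eq_zero_of_L_comm (L_comm_of_mem_CurlFree (fun k => hs n (η k))
          ((hJ n).componentwise_mem_CurlFree hη))
      exact ((curl_add hηn hA'1).trans (by rw [h0, zero_add])).symm
    rintro ⟨ξ, ζ⟩ (rfl : ζ = Υ ξ)
    have h1 := key (ξ - Υ ξ) ((hΥ.mem_iff _).2 fun u hu =>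
      inner_sub_apply_eq_zero hΥ.proj hΥ.range_eq hu ξ) (Υ ξ)
      (fluct_DivFree_eq_closure hd hT ▸ apply_mem_of_range_eq hΥ.range_eq ξ)
    rwa [sub_add_cancel] at h1
  · rintro ⟨ξ, ζ⟩ ⟨hξ, A, hA, -, hcurl, rfl⟩
    have hA2 : A ∈ vec (D2 P d) (curlDim d) := fun k => (hA k).1
    have hA1 := curlAdj_mem_vec_D1 hA2
    refine (apply_eq_of_inner hΥ.proj hΥ.range_eq
      (curlAdj_mem_fluct_DivFree hT (vec_mono D2_le_D1 _ hA2))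
      ((hΥ.mem_iff _).1 (mem_CurlFree_of_curl_eq_zero hd (sub_mem hξ hA1) ?_))).symm
    have h := curl_add (sub_mem hξ hA1) hA1
    rw [sub_add_cancel, hcurl] at h
    exact right_eq_add.1 h

end GammaUpsilon

/-! ### Potentials and curl-free fields. -/

section PotentialTheory

variable {Ω : Type u} [MeasurableSpace Ω] {P : Measure Ω} [IsProbabilityMeasure P]
variable {d : ℕ} [AddAction (Fin d → ℝ) Ω] [MeasurableConstVAdd (Fin d → ℝ) Ω]

section Invariant

variable [VAddInvariantMeasure (Fin d → ℝ) Ω P]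

theorem potential_apply_zero (φ : Potential P d) : φ.1 0 = 0 := by
  have h := φ.2.1 0 0
  rwa [add_zero, translate_zero, left_eq_add] at h

theorem hasDerivAt_potential_zero (φ : Potential P d) (i : Fin d) :
    HasDerivAt (fun t : ℝ => φ.1 (Pi.single i t)) (potGrad P d φ i) 0 :=
  (φ.2.2 i).hasDerivAt

theorem hasDerivAt_potential (φ : Potential P d) (i : Fin d) (s : ℝ) :
    HasDerivAt (fun t : ℝ => φ.1 (Pi.single i t))
      (translate P d (Pi.single i s) (potGrad P d φ i)) s := by
  have h1 : HasDerivAt (fun t : ℝ => φ.1 (Pi.single i (t - s))) (potGrad P d φ i) s := by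
    have h := hasDerivAt_potential_zero φ i
    rw [← sub_self s] at h
    exact h.comp_sub_const s s
  have h2 := (((translate P d (Pi.single i s)).toContinuousLinearMap.restrictScalars
    ℝ).hasFDerivAt.comp_hasDerivAt s h1).const_add (φ.1 (Pi.single i s))
  refine h2.congr_of_eventuallyEq (Eventually.of_forall fun t => ?_)
  change φ.1 (Pi.single i t) = φ.1 (Pi.single i s) +
    translate P d (Pi.single i s) (φ.1 (Pi.single i (t - s)))
  rw [← φ.2.1, ← Pi.single_add, add_sub_cancel]

/-- The cocycle identity propagates the derivative at the origin along each axis, and then adds up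
the increments along the axes. -/
theorem eq_zero_of_potGrad_eq_zero {φ : Potential P d} (h : potGrad P d φ = 0) :
    φ = 0 := by
  have h1 : ∀ (i : Fin d) (t : ℝ), φ.1 (Pi.single i t) = 0 := by
    intro i t
    have hd : ∀ s, HasDerivAt (fun t : ℝ => φ.1 (Pi.single i t)) 0 s := fun s => by
      have := hasDerivAt_potential φ i s
      rwa [h, PiLp.zero_apply, map_zero] at this
    have := is_const_of_deriv_eq_zero (fun s => (hd s).differentiableAt) (fun s => (hd s).deriv) t 0
    rwa [Pi.single_zero, potential_apply_zero φ] at this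
  refine Subtype.ext (funext fun x => ?_)
  change φ.1 x = 0
  rw [← Finset.univ_sum_single x]
  generalize (Finset.univ : Finset (Fin d)) = s
  induction s using Finset.induction_on with
  | empty => rw [Finset.sum_empty, potential_apply_zero φ]
  | insert a s ha ih => rw [Finset.sum_insert ha, φ.2.1, ih, h1, map_zero, add_zero]

theorem potGrad_injective : Function.Injective (potGrad P d) :=
  (injective_iff_map_eq_zero _).2 fun _ => eq_zero_of_potGrad_eq_zero

theorem hasDerivAt_inner_sub {f : ScalarField P} (hf : f ∈ D1 P d) (i : Fin d)
    (g : ScalarField P) :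
    HasDerivAt (fun t : ℝ => ⟪translate P d (Pi.single i (-t)) f - f, g⟫_ℂ)
      (-⟪L P d i f, g⟫_ℂ) 0 := by
  have h1 : HasDerivAt (fun t : ℝ => translate P d (Pi.single i (-t)) f) (-L P d i f) 0 := by
    have h := hasDerivAt_translate hf i
    rw [← neg_zero] at h
    have h2 := HasDerivAt.scomp (0 : ℝ) h (hasDerivAt_neg (0 : ℝ))
    rwa [neg_one_smul] at h2
  have h2 := (h1.sub_const f).inner ℂ (hasDerivAt_const (0 : ℝ) g)
  simpa using h2

/-- Expanding `φ (s e_i + t e_j)` in both orders gives the finite-difference form `h1` of the weak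
equation; differentiating at zero in `t` and then in `s` yields the equation. No second derivative
of `φ` is involved. -/
theorem potGrad_mem_CurlFree (φ : Potential P d) : potGrad P d φ ∈ CurlFree P d := by
  intro i j f hf
  have h1 : ∀ s t : ℝ,
      ⟪translate P d (Pi.single i (-s)) f - f, φ.1 (Pi.single j t)⟫_ℂ =
        ⟪translate P d (Pi.single j (-t)) f - f, φ.1 (Pi.single i s)⟫_ℂ := fun s t => by
    have h : φ.1 (Pi.single i s + Pi.single j t) = φ.1 (Pi.single j t + Pi.single i s) := by
      rw [add_comm]
    rw [φ.2.1, φ.2.1] at h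
    rw [Pi.single_neg, Pi.single_neg, inner_sub_left, inner_sub_left, inner_translate_left,
      inner_translate_left, neg_neg, neg_neg, sub_eq_sub_iff_add_eq_add, ← inner_add_right,
      ← inner_add_right, add_comm, h, add_comm]
  have h2 : ∀ s : ℝ, ⟪translate P d (Pi.single i (-s)) f - f, potGrad P d φ j⟫_ℂ =
      -⟪L P d j f, φ.1 (Pi.single i s)⟫_ℂ := fun s => by
    have ha := (hasDerivAt_const (0 : ℝ) (translate P d (Pi.single i (-s)) f - f)).inner ℂ
      (hasDerivAt_potential_zero φ j)
    rw [inner_zero_left, add_zero] at ha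
    simp only [h1 s] at ha
    exact ha.unique (hasDerivAt_inner_sub hf j _)
  have ha := hasDerivAt_inner_sub hf i (potGrad P d φ j)
  simp only [h2] at ha
  have hb := ((hasDerivAt_const (0 : ℝ) (L P d j f)).inner ℂ (hasDerivAt_potential_zero φ i)).neg
  rw [inner_zero_left, add_zero] at hb
  exact neg_injective (ha.unique hb)

theorem potGrad_linPot (E0 : Fin d → ℂ) : potGrad P d (linPot P d E0) = constV P E0 := by
  refine PiLp.ext fun i => ?_
  have h1 : ∀ t : ℝ, (linPot P d E0).1 (Pi.single i t) = t • Lp.const 2 P (E0 i) := fun t => by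
    change (∑ j, ((Pi.single i t : Fin d → ℝ) j : ℂ) * E0 j) • Lp.const 2 P (1 : ℂ) = _
    rw [Finset.sum_eq_single i, Pi.single_eq_same, mul_smul, ← const_eq_smul]
    · exact Complex.coe_smul t _
    · intro j _ hj
      rw [Pi.single_eq_of_ne hj, Complex.ofReal_zero, zero_mul]
    · simp
  have h2 := hasDerivAt_potential_zero (linPot P d E0) i
  simp only [h1] at h2
  have h3 := (hasDerivAt_id (0 : ℝ)).smul_const (Lp.const 2 P (E0 i) : ScalarField P)
  rw [one_smul] at h3
  exact h2.unique h3

theorem norm_translate_sub_le {f : ScalarField P} (hf : f ∈ D1 P d) (i : Fin d) (t : ℝ) :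
    ‖translate P d (Pi.single i t) f - f‖ ≤ ‖L P d i f‖ * |t| := by
  have h := Convex.norm_image_sub_le_of_norm_hasDerivWithin_le (s := Set.univ) (x := 0) (y := t)
    (fun s _ => (hasDerivAt_translate_at hf i s).hasDerivWithinAt)
    (fun s _ => ((translate P d (Pi.single i s)).norm_map (L P d i f)).le) convex_univ
    (Set.mem_univ _) (Set.mem_univ _)
  rwa [Pi.single_zero, translate_zero, sub_zero, Real.norm_eq_abs] at h

/-- The fields `f n` need not converge, but by the mean value inequality their increments along an
axis are controlled by the gradients. -/
theorem exists_tendsto_translate_sub {f : ℕ → ScalarField P} (hf : ∀ n, f n ∈ D1 P d)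
    {ξ : VField P d} (hlim : Tendsto (fun n => grad P d (f n)) atTop (𝓝 ξ)) (x : Fin d → ℝ) :
    ∃ g, Tendsto (fun n => translate P d x (f n) - f n) atTop (𝓝 g) := by
  have h1 : ∀ (i : Fin d) (t : ℝ),
      ∃ g, Tendsto (fun n => translate P d (Pi.single i t) (f n) - f n) atTop (𝓝 g) := by
    intro i t
    refine cauchySeq_tendsto_of_complete (cauchySeq_iff_tendsto_dist_atTop_0.2 ?_)
    have hL : CauchySeq fun n => L P d i (f n) :=
      (((continuous_coord i).tendsto ξ).comp hlim).cauchySeq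
    have hL' := (cauchySeq_iff_tendsto_dist_atTop_0.1 hL).mul_const |t|
    rw [zero_mul] at hL'
    refine squeeze_zero (fun _ => dist_nonneg) (fun p => ?_) hL'
    have h := norm_translate_sub_le (sub_mem (hf p.1) (hf p.2)) i t
    rw [L_sub (hf p.1) (hf p.2), map_sub] at h
    rw [dist_eq_norm, dist_eq_norm]
    have e : translate P d (Pi.single i t) (f p.1) - f p.1 -
        (translate P d (Pi.single i t) (f p.2) - f p.2) = translate P d (Pi.single i t) (f p.1) -
        translate P d (Pi.single i t) (f p.2) - (f p.1 - f p.2) := by abel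
    rw [e]
    exact h
  rw [← Finset.univ_sum_single x]
  generalize (Finset.univ : Finset (Fin d)) = s
  induction s using Finset.induction_on with
  | empty =>
    exact ⟨0, by simp only [Finset.sum_empty, translate_zero, sub_self, tendsto_const_nhds]⟩
  | insert a s ha ih =>
    obtain ⟨g, hg⟩ := ih
    obtain ⟨g', hg'⟩ := h1 a (x a)
    refine ⟨_, (hg'.add (((translate P d (Pi.single a (x a))).continuous.tendsto g).comp
      hg)).congr fun n => ?_⟩
    rw [Finset.sum_insert ha, translate_add, Function.comp_apply, map_sub]
    abel

theorem exists_potGrad_eq_of_tendsto {f : ℕ → ScalarField P} (hf : ∀ n, f n ∈ D1 P d)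
    {ξ : VField P d} (hlim : Tendsto (fun n => grad P d (f n)) atTop (𝓝 ξ)) :
    ∃ φ, potGrad P d φ = ξ := by
  choose φ hφ using exists_tendsto_translate_sub hf hlim
  have hder : ∀ i, HasDerivAt (fun t : ℝ => φ (Pi.single i t)) (ξ i) 0 := by
    intro i
    -- Translations are isometric, so the derivatives along the axis converge uniformly in `s`, and
    -- the limit may be differentiated.
    have hu : TendstoUniformly
        (fun (n : ℕ) (s : ℝ) => translate P d (Pi.single i s) (L P d i (f n)))
        (fun s : ℝ => translate P d (Pi.single i s) (ξ i)) atTop := by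
      rw [Metric.tendstoUniformly_iff]
      intro ε hε
      have hL : Tendsto (fun n => L P d i (f n)) atTop (𝓝 (ξ i)) :=
        ((continuous_coord i).tendsto ξ).comp hlim
      filter_upwards [Metric.tendsto_nhds.1 hL ε hε] with n hn s
      rw [(translate P d (Pi.single i s)).dist_map, dist_comm]
      exact hn
    have h := hasDerivAt_of_tendstoUniformly hu (Eventually.of_forall fun n s =>
      (hasDerivAt_translate_at (hf n) i s).sub_const (f n))
      (fun t => hφ (Pi.single i t)) 0
    rwa [Pi.single_zero, translate_zero] at h
  refine ⟨⟨φ, fun x y => ?_, fun i => (hder i).differentiableAt⟩,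
    PiLp.ext fun i => (hder i).deriv⟩
  refine tendsto_nhds_unique (hφ (x + y)) (((hφ x).add
    (((translate P d x).continuous.tendsto _).comp (hφ y))).congr fun n => ?_)
  rw [translate_add, Function.comp_apply, map_sub]
  abel

end Invariant

variable [ErgodicVAdd (Fin d → ℝ) Ω P]

/-- The mean-zero part is a limit of gradients, hence itself the gradient of a potential although
perhaps not of a stationary field; the mean is supplied by a linear potential. -/
theorem exists_potGrad_eq
    (hT : ∀ f : ScalarField P, Continuous (fun x : Fin d → ℝ => translate P d x f))
    {ξ : VField P d} (hξ : ξ ∈ CurlFree P d) : ∃ φ, potGrad P d φ = ξ := by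
  have h1 : ξ - constV P (meanV P ξ) ∈ closure (gradRange P d : Set (VField P d)) := by
    have h : ξ - constV P (meanV P ξ) ∈ fluct (CurlFree P d) :=
      ⟨sub_mem hξ (constV_mem_CurlFree _), sub_constV_mem ξ⟩
    rwa [fluct_CurlFree_eq_closure hT] at h
  obtain ⟨ζ, hζ, hlim⟩ := mem_closure_iff_seq_limit.1 h1
  choose f hf hfζ using hζ
  obtain ⟨φ, hφ⟩ := exists_potGrad_eq_of_tendsto (fun n => (hf n).1)
    (hlim.congr fun n => (hfζ n).symm)
  exact ⟨φ + linPot P d (meanV P ξ), by rw [map_add, hφ, potGrad_linPot, sub_add_cancel]⟩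

theorem mem_potFluct_iff {f : Potential P d} :
    f ∈ potFluct P d ↔ potGrad P d f ∈ fluct (CurlFree P d) :=
  ⟨fun h => ⟨potGrad_mem_CurlFree f, h⟩, fun h => h.2⟩

/-- The operator `(∇*∇)⁻¹ ∇* χ i ∇` on potentials. -/
theorem exists_potential_operator
    (hT : ∀ f : ScalarField P, Continuous (fun x : Fin d → ℝ => translate P d x f))
    {B : VField P d →L[ℂ] VField P d} (hB : ∀ ξ, B ξ ∈ CurlFree P d) :
    ∃ M : Module.End ℂ (Potential P d), ∀ f, potGrad P d (M f) = B (potGrad P d f) := by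
  choose g hg using fun f => exists_potGrad_eq hT (hB (potGrad P d f))
  exact ⟨{ toFun := g
           map_add' := fun f f' => potGrad_injective (by
            rw [hg, map_add (potGrad P d), map_add, map_add, hg, hg])
           map_smul' := fun a f => potGrad_injective (by
            rw [hg, map_smul (potGrad P d), map_smul, RingHom.id_apply, map_smul, hg]) }, hg⟩

end PotentialTheory

/-! ### The operator `M` on potentials and on their Dirichlet completions. -/

section SobolevSpace

variable {Ω : Type u} [MeasurableSpace Ω] {P : Measure Ω} [IsProbabilityMeasure P]
variable {d : ℕ} [AddAction (Fin d → ℝ) Ω] [MeasurableConstVAdd (Fin d → ℝ) Ω]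
variable [ErgodicVAdd (Fin d → ℝ) Ω P]
variable {c : Ω → Fin 2} {hc : Measurable c}
variable {Γ : VField P d →L[ℂ] VField P d} {i : Fin 2} {M : Module.End ℂ (Potential P d)}

theorem norm_sq_chi (ξ : VField P d) :
    ((‖chi hc i ξ‖ ^ 2 : ℝ) : ℂ) = ⟪ξ, chi hc i ξ⟫_ℂ :=
  (inner_apply_of_isStarProjection (isStarProjection_chi hc i) ξ).symm

theorem compression_chi_apply (ξ : VField P d) :
    compression hc Γ i (chi hc i ξ) = compression hc Γ i ξ := by
  rw [compression_apply, compression_apply, chi_apply_apply]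

/-- The inverse is `1 + y (1 - x y)⁻¹ x`. With `x = χ i` and `y = z Γ χ i` this passes from the
self-adjoint `χ i Γ χ i` to the non-self-adjoint `Γ χ i`. -/
theorem isUnit_one_sub_mul_swap {R : Type*} [Ring R] {x y : R} (h : IsUnit (1 - x * y)) :
    IsUnit (1 - y * x) := by
  refine ⟨⟨1 - y * x, 1 + y * h.unit.inv * x, ?_, ?_⟩, rfl⟩
  · calc (1 - y * x) * (1 + y * h.unit.inv * x) =
        1 - y * x + y * ((1 - x * y) * h.unit.inv) * x := by noncomm_ring
      _ = 1 := by simp only [Units.inv_eq_val_inv, IsUnit.mul_val_inv, mul_one, sub_add_cancel]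
  · calc (1 + y * h.unit.inv * x) * (1 - y * x) =
        1 - y * x + y * (h.unit.inv * (1 - x * y)) * x := by noncomm_ring
      _ = 1 := by simp only [Units.inv_eq_val_inv, IsUnit.val_inv_mul, mul_one, sub_add_cancel]

theorem isUnit_one_sub_smul_mul_chi (hΓ : IsStarProjection Γ) {h : ℂ}
    (hh : h ∈ Complex.slitPlane) : IsUnit (1 - (1 - h) • (Γ * chi hc i)) := by
  have h1 := isUnit_one_sub_smul (isPositive_compression hc hΓ i) (norm_compression_le hc hΓ i) hh
  have e1 : (1 - h) • compression hc Γ i = chi hc i * ((1 - h) • (Γ * chi hc i)) := by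
    rw [mul_smul_comm, ← mul_assoc]
    rfl
  have e2 : ((1 - h) • (Γ * chi hc i)) * chi hc i = (1 - h) • (Γ * chi hc i) := by
    rw [smul_mul_assoc, mul_assoc, (isStarProjection_chi hc i).isIdempotentElem.eq]
  rw [e1] at h1
  have h2 := isUnit_one_sub_mul_swap h1
  rwa [e2] at h2

theorem exists_isometry_extension {E K H : Type u} [AddCommMonoid E] [Module ℂ E]
    [NormedAddCommGroup K] [InnerProductSpace ℂ K] [CompleteSpace K]
    [NormedAddCommGroup H] [InnerProductSpace ℂ H] [CompleteSpace H]
    {ι : E →ₗ[ℂ] K} (hι : DenseRange ι) {g : E →ₗ[ℂ] H} (hg : ∀ x, ‖g x‖ = ‖ι x‖) :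
    ∃ X : K →ₗᵢ[ℂ] H, ∀ x, X (ι x) = g x := by
  let _ : AddCommGroup E := Module.addCommMonoidToAddCommGroup ℂ
  have h1 : ∀ x, g.extendOfNorm ι (ι x) = g x := fun x =>
    LinearMap.extendOfNorm_eq hι ⟨1, fun x => by rw [one_mul, hg]⟩ x
  refine ⟨⟨(g.extendOfNorm ι : K →ₗ[ℂ] H), fun y => ?_⟩, h1⟩
  refine hι.induction_on (p := fun y => ‖g.extendOfNorm ι y‖ = ‖y‖) y
    (isClosed_eq (by fun_prop) (by fun_prop)) fun x => ?_
  rw [h1, hg]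

/-- Half-lines form a generating π-system; the total masses agree because `ℝ` is an increasing union
of half-lines. -/
theorem signedMeasure_eq_of_Iic {μ : SignedMeasure ℝ} {ν : Measure ℝ} [IsFiniteMeasure ν]
    (h : ∀ l, μ (Set.Iic l) = ν.real (Set.Iic l)) : μ = ν.toSignedMeasure := by
  refine VectorMeasure.ext_of_generateFrom (Set.range Set.Iic) ?_
    ((BorelSpace.measurable_eq (α := ℝ)).trans (borel_eq_generateFrom_Iic ℝ)) isPiSystem_Iic ?_
  · rintro _ ⟨l, rfl⟩
    rw [h, Measure.toSignedMeasure_apply_measurable measurableSet_Iic]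
  · have hu : (⋃ n : ℕ, Set.Iic (n : ℝ)) = Set.univ := Set.eq_univ_of_forall fun x => by
      obtain ⟨n, hn⟩ := exists_nat_ge x
      exact Set.mem_iUnion.2 ⟨n, hn⟩
    have hm : Monotone fun n : ℕ => Set.Iic (n : ℝ) :=
      fun m n hmn => Set.Iic_subset_Iic.2 (Nat.cast_le.2 hmn)
    have h1 := μ.tendsto_vectorMeasure_iUnion_atTop_nat hm fun _ => measurableSet_Iic
    have h2 := ν.toSignedMeasure.tendsto_vectorMeasure_iUnion_atTop_nat hm
      fun _ => measurableSet_Iic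
    rw [hu] at h1 h2
    refine tendsto_nhds_unique h1 (h2.congr fun n => ?_)
    rw [Measure.toSignedMeasure_apply_measurable measurableSet_Iic, h]

section Operator

theorem dirichlet_apply (f g : Potential P d)
    (hM : ∀ f, potGrad P d (M f) = Γ (chi hc i (potGrad P d f))) :
    dirichlet hc i (M f) g = ⟪potGrad P d g, compression hc Γ i (potGrad P d f)⟫_ℂ := by
  rw [dirichlet, hM]
  rfl

theorem potential_operator_mem (hΓ : IsFieldProjection (CurlFree P d) (DivFree P d) Γ)
    (hM : ∀ f, potGrad P d (M f) = Γ (chi hc i (potGrad P d f))) (f : Potential P d) :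
    M f ∈ potFluct P d := by
  rw [mem_potFluct_iff, hM]
  exact apply_mem_of_range_eq hΓ.range_eq _

theorem bijOn_potGrad
    (hT : ∀ f : ScalarField P, Continuous (fun x : Fin d → ℝ => translate P d x f)) :
    Set.BijOn (potGrad P d) (potFluct P d) (fluct (CurlFree P d)) :=
  ⟨fun _ hf => mem_potFluct_iff.1 hf, potGrad_injective.injOn, fun ξ hξ => by
    obtain ⟨f, rfl⟩ := exists_potGrad_eq hT hξ.1
    exact ⟨f, mem_potFluct_iff.2 hξ, rfl⟩⟩

theorem bijOn_potGrad_chi_ne_zero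
    (hT : ∀ f : ScalarField P, Continuous (fun x : Fin d → ℝ => translate P d x f)) :
    Set.BijOn (potGrad P d) {f | f ∈ potFluct P d ∧ chi hc i (potGrad P d f) ≠ 0}
      {ξ | ξ ∈ fluct (CurlFree P d) ∧ chi hc i ξ ≠ 0} :=
  ⟨fun _ hf => ⟨mem_potFluct_iff.1 hf.1, hf.2⟩, potGrad_injective.injOn, fun ξ hξ => by
    obtain ⟨f, rfl⟩ := exists_potGrad_eq hT hξ.1.1
    exact ⟨f, ⟨mem_potFluct_iff.2 hξ.1, hξ.2⟩, rfl⟩⟩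

/-- The space of potentials carries no norm here, so invertibility means bijectivity. It is
inherited through the gradient from `1 - z Γ χ i`, whose inverse preserves curl-free fields because
`Γ` takes values in them. -/
theorem potential_operator_resolvent
    (hT : ∀ f : ScalarField P, Continuous (fun x : Fin d → ℝ => translate P d x f))
    (hΓ : IsFieldProjection (CurlFree P d) (DivFree P d) Γ)
    (hM : ∀ f, potGrad P d (M f) = Γ (chi hc i (potGrad P d f))) {a : Fin 2 → ℂ}
    (ha : Admissible a) (hne : a i ≠ a (1 - i)) : contrast a i ∈ resolventSet ℂ M := by
  have hu := isUnit_one_sub_smul_mul_chi (hc := hc) (i := i) hΓ.proj (ha.div_mem i)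
  have hz := one_sub_div_ne_zero ha hne
  rw [spectrum.mem_resolventSet_iff, contrast]
  set z := 1 - a i / a (1 - i)
  refine (Module.End.isUnit_iff _).2 ⟨(injective_iff_map_eq_zero _).2 fun f hf => ?_, fun g => ?_⟩
  · have h1 : (1 / z) • f - M f = 0 := hf
    have h2 : (1 / z) • potGrad P d f - Γ (chi hc i (potGrad P d f)) = 0 := by
      rw [← hM, ← map_smul, ← map_sub, h1, map_zero]
    refine eq_zero_of_potGrad_eq_zero ?_
    have h3 : (1 - z • (Γ * chi hc i) : VField P d →L[ℂ] VField P d) (potGrad P d f) = 0 := by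
      change potGrad P d f - z • Γ (chi hc i (potGrad P d f)) = 0
      rw [← sub_eq_zero.1 h2, smul_smul, mul_one_div_cancel hz, one_smul, sub_self]
    have h4 := DFunLike.congr_fun (Ring.inverse_mul_cancel _ hu) (potGrad P d f)
    rw [mul_apply_eq_comp, h3, map_zero] at h4
    exact h4.symm
  · set y := (Ring.inverse (1 - z • (Γ * chi hc i)) : VField P d →L[ℂ] VField P d)
      (potGrad P d g)
    have h1 : y - z • Γ (chi hc i y) = potGrad P d g :=
      DFunLike.congr_fun (Ring.mul_inverse_cancel _ hu) (potGrad P d g)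
    have h2 : y ∈ CurlFree P d := by
      rw [sub_eq_iff_eq_add.1 h1]
      exact add_mem (potGrad_mem_CurlFree g)
        (Submodule.smul_mem _ _ (apply_mem_of_range_eq hΓ.range_eq _).1)
    obtain ⟨f, hf⟩ := exists_potGrad_eq hT h2
    -- The factor `z` appears because `1 / z - M` applied to `z f` is `f - z M f`.
    refine ⟨z • f, potGrad_injective ?_⟩
    change potGrad P d ((1 / z) • z • f - M (z • f)) = potGrad P d g
    rw [map_sub, smul_smul, one_div_mul_cancel hz, one_smul, map_smul, map_smul, hM, hf, h1]

theorem potential_resolvent_rep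
    (hT : ∀ f : ScalarField P, Continuous (fun x : Fin d → ℝ => translate P d x f))
    (hΓ : IsFieldProjection (CurlFree P d) (DivFree P d) Γ)
    (hM : ∀ f, potGrad P d (M f) = Γ (chi hc i (potGrad P d f))) {a : Fin 2 → ℂ}
    (ha : Admissible a) (hne : a i ≠ a (1 - i)) {E0 : Fin d → ℂ} {E : VField P d}
    (hE : IsField hc (CurlFree P d) (DivFree P d) a E0 E) :
    ∃ φ ∈ potFluct P d, E = constV P E0 + potGrad P d φ ∧
      φ = resolvent M (contrast a i) (M (linPot P d E0)) := by
  have hr := potential_operator_resolvent hT hΓ hM ha hne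
  have hz := one_sub_div_ne_zero ha hne
  have h1 := (hΓ.isField_iff hc (ha.ne_zero (1 - i)) E0 E).1 hE
  rw [contrast] at hr ⊢
  set z := 1 - a i / a (1 - i)
  obtain ⟨φ, hφ, hφE⟩ := (bijOn_potGrad hT).surjOn (Submodule.smul_mem (fluct (CurlFree P d)) z
    (apply_mem_of_range_eq hΓ.range_eq (chi hc i E)))
  rw [← hφE] at h1
  refine ⟨φ, hφ, h1, ?_⟩
  have h2 : φ = z • M (linPot P d E0 + φ) := potGrad_injective (by
    rw [hφE, map_smul, hM, map_add, potGrad_linPot, ← h1])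
  have h3 : (algebraMap ℂ (Module.End ℂ (Potential P d)) (1 / z) - M) φ =
      M (linPot P d E0) := by
    change (1 / z) • φ - M φ = _
    rw [sub_eq_iff_eq_add, ← map_add]
    conv_lhs => rw [h2, smul_smul, one_div_mul_cancel hz, one_smul]
  rw [← h3]
  exact (DFunLike.congr_fun (Ring.inverse_mul_cancel _ hr) φ).symm

theorem exists_dirichlet_isometry {S : Submodule ℂ (Potential P d)} {K : Type u}
    [NormedAddCommGroup K] [InnerProductSpace ℂ K] [CompleteSpace K] {ι : S →ₗ[ℂ] K}
    (hι : IsDirichletCompletion hc i S ι) :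
    ∃ X : K →ₗᵢ[ℂ] VField P d, ∀ f : S, X (ι f) = chi hc i (potGrad P d f) := by
  let g : S →ₗ[ℂ] VField P d :=
    { toFun := fun f => chi hc i (potGrad P d f)
      map_add' := fun f f' => by rw [Submodule.coe_add, map_add, map_add]
      map_smul' := fun a f => by rw [Submodule.coe_smul, map_smul, map_smul, RingHom.id_apply] }
  have hg : ∀ f : S, ‖g f‖ = ‖ι f‖ := fun f => by
    have h1 : ((‖chi hc i (potGrad P d f)‖ ^ 2 : ℝ) : ℂ) = ((‖ι f‖ ^ 2 : ℝ) : ℂ) := by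
      have h2 := hι.inner_eq f f
      rw [inner_self_eq_norm_sq_to_K, dirichlet] at h2
      rw [norm_sq_chi, ← h2]
      norm_cast
    have h3 : ‖chi hc i (potGrad P d f)‖ ^ 2 = ‖ι f‖ ^ 2 := Complex.ofReal_injective h1
    change ‖chi hc i (potGrad P d f)‖ = ‖ι f‖
    have h4 := norm_nonneg (chi hc i (potGrad P d f))
    have h5 := norm_nonneg (ι f)
    generalize ‖chi hc i (potGrad P d f)‖ = x at *
    generalize ‖ι f‖ = y at *
    exact (sq_eq_sq₀ h4 h5).1 h3
  exact exists_isometry_extension hι.dense hg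

/-- The isometry `X` extending `χ i ∇` intertwines `M` with `χ i Γ χ i` on the dense image of `S`:
since `M` takes values in `potFluct P d ≤ S`, the operator maps `X (ι f)` to `X (ι (M f))`. The
range of `X` is closed, hence invariant, and everything is pulled back. -/
theorem potential_completion
    (hΓ : IsFieldProjection (CurlFree P d) (DivFree P d) Γ)
    (hM : ∀ f, potGrad P d (M f) = Γ (chi hc i (potGrad P d f)))
    (S : Submodule ℂ (Potential P d)) (hS : potFluct P d ≤ S)
    (K : Type u) [NormedAddCommGroup K] [InnerProductSpace ℂ K] [CompleteSpace K]
    (ι : S →ₗ[ℂ] K) (hι : IsDirichletCompletion hc i S ι) :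
    ∃ M' : K →L[ℂ] K, (∀ f g : S, (g : Potential P d) = M f → M' (ι f) = ι g) ∧
      IsSelfAdjoint M' ∧ M'.IsPositive ∧ ‖M'‖ ≤ 1 ∧ SpectrumInUnit M' ∧
      ∃ Q' : ℝ → K →L[ℂ] K, IsResolutionOfIdentity M' Q' ∧
        (∀ Q'', IsResolutionOfIdentity M' Q'' → Q'' = Q') ∧
        ∀ Q, IsResolutionOfIdentity (compression hc Γ i) Q →
          (∃ X : K →ₗᵢ[ℂ] VField P d, (∀ f : S, X (ι f) = chi hc i (potGrad P d f)) ∧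
            ∀ l (f : S), X (Q' l (ι f)) = chi hc i (Q l (potGrad P d f))) ∧
          ∀ (j : Fin d) (φ : S), (φ : Potential P d) = linPot P d (Pi.single j 1) →
            ∃ ν : Measure ℝ, IsFiniteMeasure ν ∧
              (∀ l, (ν.real (Set.Iic l) : ℂ) = ⟪ι φ, Q' l (ι φ)⟫_ℂ) ∧
              (∀ μ : SignedMeasure ℝ,
                (∀ l, ((μ (Set.Iic l) : ℝ) : ℂ) = spectralFun hc Q i j j l) →
                ∀ B, MeasurableSet B → μ B = ν.real B) ∧
              ∀ a, Admissible a → a i ≠ a (1 - i) →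
                effComp hc (CurlFree P d) (DivFree P d) a j j / a (1 - i) =
                  1 - ∫ l in Set.Icc (0 : ℝ) 1, (contrast a i - (l : ℂ))⁻¹ ∂ν := by
  have hpos := isPositive_compression hc hΓ.proj i
  have hnorm := norm_compression_le hc hΓ.proj i
  obtain ⟨X, hX⟩ := exists_dirichlet_isometry hι
  have hMX : ∀ f : S, ∀ g : S, (g : Potential P d) = M f →
      compression hc Γ i (X (ι f)) = X (ι g) := fun f g hg => by
    rw [hX, hX, compression_chi_apply, hg, hM]
    rfl
  have hrange : ∀ x, compression hc Γ i (X x) ∈ Set.range X := fun x =>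
    hι.dense.induction_on (p := fun x => compression hc Γ i (X x) ∈ Set.range X) x
      (X.isometry.isClosedEmbedding.isClosed_range.preimage
        ((compression hc Γ i).continuous.comp X.continuous)) fun f =>
      ⟨_, (hMX f ⟨M f, hS (potential_operator_mem hΓ hM f)⟩ rfl).symm⟩
  have hMpos := pullback_isPositive X hpos
  have hMnorm := norm_pullback_le X hnorm
  obtain ⟨Q0, hQ0, -, -⟩ := exists_isResolutionOfIdentity hpos hnorm
  obtain ⟨hQ', hQrange⟩ := hQ0.pullback hpos hnorm X hrange
  refine ⟨pullback X (compression hc Γ i), fun f g hg => X.injective ?_, hMpos.isSelfAdjoint,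
    hMpos, hMnorm, spectrumInUnit_of_isPositive hMpos hMnorm, _, hQ',
    fun Q'' hQ'' => hQ'.unique hMpos hMnorm hQ'', fun Q hQ => ?_⟩
  · rw [apply_pullback X hrange, hMX f g hg]
  · obtain rfl : Q = Q0 := hQ0.unique hpos hnorm hQ
    have hcomm : ∀ l, Commute (Q l) (chi hc i) :=
      hQ.commute_of_commute hpos hnorm (commute_compression_chi hc i)
    refine ⟨⟨X, hX, fun l f => ?_⟩, fun j φ hφ => ?_⟩
    -- The factor `χ i` passes through `Q l`, because `Q l` commutes with whatever commutes with `χ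
    -- i Γ χ i`.
    · rw [apply_pullback X (hQrange l), hX]
      exact DFunLike.congr_fun (hcomm l).eq (potGrad P d f)
    · obtain ⟨ν, hν, hI, hs⟩ := hQ.exists_measure hpos hnorm (chi hc i (basisV P j))
      -- The linear potential corresponds to `χ i e_j`, so its spectral measure on the completion is
      -- the diagonal measure of `χ i Γ χ i`.
      have hXφ : X (ι φ) = chi hc i (basisV P j) := by
        rw [hX, hφ, potGrad_linPot]
        rfl
      refine ⟨ν, hν, fun l => ?_, fun μ hμ B hB => ?_, fun a ha hne => ?_⟩
      · rw [hI, inner_pullback, hXφ]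
      · rw [signedMeasure_eq_of_Iic (μ := μ) (ν := ν) fun l => Complex.ofReal_injective ?_,
          Measure.toSignedMeasure_apply_measurable hB]
        rw [hμ, hI, inner_chi_apply_of_commute hc (hcomm l)]
        rfl
      · rw [hΓ.effComp_div_eq hc ha hne, if_pos rfl, ← hs _ (contrast_notMem ha hne),
          inner_chi_apply_of_commute hc (commute_resolvent_compression_chi hc Γ i _)]

theorem sobolevClaims
    (hT : ∀ f : ScalarField P, Continuous (fun x : Fin d → ℝ => translate P d x f))
    (hΓ : IsFieldProjection (CurlFree P d) (DivFree P d) Γ)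
    (hM : ∀ f, potGrad P d (M f) = Γ (chi hc i (potGrad P d f))) : SobolevClaims hc Γ i M where
  weak_solution f g := by
    constructor
    · rintro rfl
      refine ⟨potential_operator_mem hΓ hM f, fun ψ hψ => ?_⟩
      have h := inner_sub_apply_eq_zero hΓ.proj hΓ.range_eq (grad_mem_fluct_CurlFree hT hψ)
        (chi hc i (potGrad P d f))
      rw [inner_sub_right, sub_eq_zero] at h
      rw [hM, h]
    · rintro ⟨hg, h⟩
      refine potGrad_injective ?_
      rw [hM]
      refine apply_eq_of_inner hΓ.proj hΓ.range_eq (mem_potFluct_iff.1 hg)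
        ((hΓ.mem_iff _).1 (mem_DivFree_of_grad fun ψ hψ => ?_))
      rw [inner_sub_right, h ψ hψ, sub_self]
  grad_pow n f := by
    induction n with
    | zero => rfl
    | succ n ih =>
      rw [pow_succ', pow_succ', Module.End.mul_apply, hM, ih]
      rfl
  symmetric f g := by
    rw [dirichlet_apply f g hM, dirichlet, hM,
      inner_apply_of_isSelfAdjoint (isPositive_compression hc hΓ.proj i).isSelfAdjoint,
      compression_apply, ← inner_apply_of_isSelfAdjoint (isStarProjection_chi hc i).isSelfAdjoint]
  positive f := by
    rw [dirichlet_apply f f hM, inner_compression hc hΓ.proj]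
    exact ⟨sq_nonneg ‖Γ (chi hc i (potGrad P d f))‖, Complex.ofReal_im _⟩
  bounded f := by
    rw [dirichlet, dirichlet, ← norm_sq_chi, ← norm_sq_chi, hM, Complex.ofReal_re,
      Complex.ofReal_re]
    have h1 : chi hc i (Γ (chi hc i (potGrad P d f))) =
        compression hc Γ i (chi hc i (potGrad P d f)) := by
      rw [compression_chi_apply]
      rfl
    rw [h1]
    gcongr
    exact ((compression hc Γ i).le_of_opNorm_le (norm_compression_le hc hΓ.proj i) _).trans
      (one_mul _).le
  domains := ⟨bijOn_potGrad hT, bijOn_potGrad_chi_ne_zero hT⟩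
  ranges := by
    have h1 : ∀ f, compression hc Γ i (potGrad P d f) = chi hc i (potGrad P d (M f)) := fun f => by
      rw [hM]
      rfl
    refine ⟨h1, fun f => by rw [h1, norm_sq_chi]; rfl, ?_, ?_, ?_⟩
    · rintro _ ⟨f, hf, rfl⟩
      exact ⟨potGrad P d f, (bijOn_potGrad_chi_ne_zero hT).mapsTo hf, h1 f⟩
    · rintro _ ⟨f, -, rfl⟩ _ ⟨g, -, rfl⟩ hfg
      -- Injectivity on the range of `M`: the quadratic form of `χ i Γ χ i` at `∇(f - g)` is `‖∇ M
      -- (f - g)‖²`, so its vanishing forces `M f = M g`.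
      have h2 : compression hc Γ i (potGrad P d (f - g)) = 0 := by
        rw [map_sub, map_sub, h1, h1, sub_eq_zero]
        exact hfg
      have h3 := inner_compression hc hΓ.proj i (potGrad P d (f - g))
      rw [h2, inner_zero_right, eq_comm, Complex.ofReal_eq_zero, sq_eq_zero_iff, norm_eq_zero,
        ← hM] at h3
      rw [← sub_eq_zero, ← map_sub]
      exact eq_zero_of_potGrad_eq_zero h3
    · rintro _ ⟨ξ, hξ, rfl⟩
      obtain ⟨f, hf, rfl⟩ := (bijOn_potGrad_chi_ne_zero hT).surjOn hξ
      exact ⟨M f, ⟨f, hf, rfl⟩, (h1 f).symm⟩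
  resolvent_rep a ha hne E0 E hE :=
    ⟨potential_operator_resolvent hT hΓ hM ha hne, potential_resolvent_rep hT hΓ hM ha hne hE⟩
  completion S hS K _ _ _ ι hι := potential_completion hΓ hM S hS K ι hι

end Operator

end SobolevSpace

end TwoComponent

end

/-! ### Assembly of the theorem. -/

open TwoComponent in
theorem mainTheorem12 {Ω : Type*} [MeasurableSpace Ω] (P : Measure Ω) [IsProbabilityMeasure P]
    (d : ℕ) [AddAction (Fin d → ℝ) Ω] [MeasurableConstVAdd (Fin d → ℝ) Ω]
    [ErgodicVAdd (Fin d → ℝ) Ω P]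
    (hT : ∀ f : ScalarField P, Continuous (fun x : Fin d → ℝ => translate P d x f))
    (c : Ω → Fin 2) (hc : Measurable c) :
    -- `χ i* = χ i`, `χ i χ j = χ i δ i j`, `χ 0 + χ 1 = 1`, and `ρ = σ⁻¹`
    ((∀ i, IsStarProjection (chi (P := P) (m := d) hc i)) ∧
      (∀ i j, i ≠ j → chi (P := P) (m := d) hc i * chi hc j = 0) ∧
      chi (P := P) (m := d) hc 0 + chi hc 1 = 1 ∧
      (∀ σ : Fin 2 → ℂ, (∀ i, σ i ≠ 0) →
        medium (P := P) (m := d) hc σ * medium hc (fun i => 1 / σ i) = 1)) ∧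
    -- the effective conductivity and resistivity problems
    FieldClaims hc (CurlFree P d) (DivFree P d) ∧
    FieldClaims hc (DivFree P d) (CurlFree P d) ∧
    -- the operator `Γ` and the spectral theory of `χ i Γ χ i` and `M`
    (∃ Γ : VField P d →L[ℂ] VField P d,
      {p | p.2 = Γ p.1} = closure (gammaGraph P d) ∧
      IsStarProjection Γ ∧
      Set.range Γ = closure (grad P d '' (meanZero P (D1 P d))) ∧
      Set.range Γ = fluct (CurlFree P d) ∧
      (∀ ξ ∈ vec (D1 P d) d, Γ ξ ∈ H1 P d) ∧
      EssSelfAdjointOn (H1 P d) Γ ∧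
      SpectralClaims hc (CurlFree P d) (DivFree P d) Γ ∧
      ∀ i, ∃ M, SobolevClaims hc Γ i M) ∧
    -- the operator `Υ` and the spectral theory of `χ i Υ χ i`
    (d = 2 ∨ d = 3 →
      ∃ Υ : VField P d →L[ℂ] VField P d,
        {p | p.2 = Υ p.1} = closure (upsilonGraph P d) ∧
        IsStarProjection Υ ∧
        Set.range Υ = closure (curlAdj P d '' (vec (meanZero P (D1 P d)) (curlDim d))) ∧
        Set.range Υ = fluct (DivFree P d) ∧
        (∀ ξ ∈ vec (D1 P d) d, Υ ξ ∈ H1 P d) ∧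
        EssSelfAdjointOn (H1 P d) Υ ∧
        SpectralClaims hc (DivFree P d) (CurlFree P d) Υ) := by
  have h0 := chi_add (P := P) (m := d) hc 0
  rw [sub_zero] at h0
  obtain ⟨Γ, hΓ, hΓconj, hΓ1⟩ := exists_gamma (P := P) (d := d) hT
  -- The projection onto divergence-free fluctuations exists in every dimension, which settles the
  -- current problem for all `d`; only its description through the curl needs `d = 2` or `d = 3`.
  obtain ⟨Υ, hΥ, hΥconj, hΥ1⟩ := exists_upsilon (P := P) (d := d) hT
  refine ⟨⟨fun i => isStarProjection_chi hc i, fun i j hij => chi_mul_chi_of_ne hc hij, h0,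
    fun σ hσ => medium_mul_inv hc σ hσ⟩, hΓ.fieldClaims hc, hΥ.fieldClaims hc,
    ⟨Γ, graph_gamma_eq_closure hT hΓ, hΓ.proj, ?_, hΓ.range_eq, hΓ1, hΓ.essSelfAdjointOn hT,
      hΓ.spectralClaims hc hT hΓ1 hΓconj, fun i => ?_⟩,
    fun hd => ⟨Υ, graph_upsilon_eq_closure hd hT hΥ, hΥ.proj, ?_, hΥ.range_eq, hΥ1,
      hΥ.essSelfAdjointOn hT, hΥ.spectralClaims hc hT hΥ1 hΥconj⟩⟩
  · rw [hΓ.range_eq, fluct_CurlFree_eq_closure hT]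
    rfl
  · obtain ⟨M, hM⟩ := exists_potential_operator hT (B := Γ * chi hc i)
      fun ξ => (apply_mem_of_range_eq hΓ.range_eq _).1
    exact ⟨M, sobolevClaims hT hΓ hM⟩
  · rw [hΥ.range_eq, fluct_DivFree_eq_closure hd hT]
    rfl
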